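/- All graphs are finite, simple and undirected, $n=|V(G)|$ and $m=|E(G)|$; graph classes are closed under isomorphism. A class $\mathcal H$ is hereditary if it is closed under deleting a vertex. **Problems.** A $p$-partition of a set $X$ is a tuple $\mathcal X=(X_1,\dots,X_p)$ of pairwise disjoint, possibly empty sets with union $X=:\cup\mathcal X$; $\mathcal P_p(X)$ is the set of these, and $\mathcal X\subseteq\mathcal P$ means $X_i\subseteq P_i$ for all $i$. A $p$-partition-evaluation function $g$ assigns to a graph $G$ and $\mathcal P\in\mathcal P_p(V(G))$ an isomorphism-invariant value $g(G,\mathcal P)\in\mathbb N\cup\{\infty\}$. For $\mathrm{opt}\in\{\min,\max\}$ the optimization problem $\Pi$ asks for $\mathsf p_{g,\mathrm{opt}}(G)=\mathrm{opt}\{g(G,\mathcal P):\mathcal P\in\mathcal P_p(V(G))\}$. Its $p$-annotated extension $\Pi'$ asks, given also $\mathcal X\in\mathcal P_p(X)$ with $X\subseteq V(G)$, for $\hat{\mathsf p}_{g,\mathrm{opt}}(G,\mathcal X)=\mathrm{opt}\{g(G,\mathcal P):\mathcal P\in\mathcal P_p(V(G)),\ \mathcal X\subseteq\mathcal P\}$.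 **Boundaried graphs.** A boundaried graph $\mathbf G=(G,X)$ is a graph with a set $X\subseteq V(G)$ of injectively labelled boundary vertices. $\mathbf G\oplus\mathbf F$ is the graph obtained from the disjoint union by identifying boundary vertices with equal labels, and $\mathbf G\boxplus\mathbf F$ is this graph with the union of the two boundaries as its boundary. $\mathbf F$ and $\mathbf G$ are compatible if they have the same boundary labels and induce the same graph on the boundary. $\mathbf G'\triangleright\mathbf F$ is obtained from $\mathbf G'\oplus\mathbf F$ by removing the boundary vertices of $\mathbf F$ that are not vertices of $\mathbf G'$ and the edges of $F$ between two boundary vertices of $\mathbf F$ that are not edges of $G'$. **Nice problems.** $\Pi'$ is $\mathcal H$-nice if there are a constant $K$ and an algorithm that receives $\mathbf G=(G,X)$; boundaried graphs $\mathbf G_1,\dots,\mathbf G_d$ (with boundaries $X_i$) such that $\mathbf G=(G[X],X)\boxplus\mathbf G_1\boxplus\dots\boxplus\mathbf G_d$; a partition $(A,B)$ of $X$ with $|X_i\setminus A|\le1$ for all $i$; some $\mathcal A\in\mathcal P_p(A)$; and all values $\hat{\mathsf p}_{g,\mathrm{opt}}(G_i,\mathcal X_i)$ for $i\le d$, $\mathcal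 X_i\in\mathcal P_p(X_i)$; and that outputs in time at most $K(|A|+1)(d+1)$ a boundaried graph $\mathbf G'=(G',X')$ (as a list of modifications of $G[X]$), a $p$-partition $\mathcal A'$ of a set $A'\subseteq V(G')$ and an offset $s'\in\mathbb Z\cup\{\infty\}$ such that * $|A'|\le|A|+K$; $|V(G')|\le|X|+K(|B|+1)$; $|E(G')|\le|E(G[X])|+K(|B|+1)$; and $\mathbf G'=(G'[X'],X')\boxplus\mathbf G_1'\boxplus\dots\boxplus\mathbf G'_{d'}$ for some boundaried graphs $\mathbf G_j'$; * for every $\mathbf F$ compatible with $\mathbf G$, $\hat{\mathsf p}_{g,\mathrm{opt}}(\mathbf G\oplus\mathbf F,\mathcal A)=\hat{\mathsf p}_{g,\mathrm{opt}}(\mathbf G'\triangleright\mathbf F,\mathcal A')+s'$; * for every $\mathbf F=(F,X)$ compatible with $\mathbf G$, if $(\mathbf F\oplus\mathbf G)[V(F)]\setminus A\in\mathcal H$ then $(\mathbf G'\triangleright\mathbf F)\setminus A'\in\mathcal H$. **Decompositions.** A $1$-$\mathcal H$-tree decomposition of $G$ is a triple $(T,\alpha,\beta)$ with $T$ a tree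 and $\alpha,\beta:V(T)\to2^{V(G)}$ such that $(T,\alpha\cup\beta)$ is a tree decomposition of $G$, $\alpha(t)\cap\beta(t)=\emptyset$ and $G[\beta(t)]\in\mathcal H$ for every node $t$, and $|(\alpha\cup\beta)(t')\cap\beta(t)|\le1$ for every pair of adjacent nodes $t,t'$. Its width is $\max_t|\alpha(t)|$. **Time** is measured on a unit-cost random access machine (addition and truncated subtraction). For the algorithms that solve $\Pi'$ and $\Pi$, loading the input (graphs are given by $n$ and a list of edges) counts towards the time. The nice reduction has random access to its input, and writing its output counts. A tree decomposition is given as a rooted tree in which every parent precedes its children, together with the lists of the $\alpha(t)$ and $\beta(t)$. **Lemma.** Let $p\ge1$, let $\mathcal H$ be a hereditary graph class, let $g$ be a $p$-partition-evaluation function, let $\mathrm{opt}\in\{\min,\max\}$, let $f:\mathbb N\to\mathbb N$ be non-decreasing, and let $c,d\in\mathbb N$ be not both $0$. Let $\Pi$ be the optimization problem of $g$ and $\mathrm{opt}$ and let $\Pi'$ be its $p$-annotated extension. Suppose that $\Pi'$ is $\mathcal H$-nice, and that $\Pi'$ is solvable on the instances $(G,\mathcal X)$ with $G\setminus\cup\mathcal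 X\in\mathcal H$ in time $f(|\cup\mathcal X|)\cdot(n+1)^c\cdot(m+1)^d$. Then there are an algorithm and a constant $K$ such that, given a graph $G$ and a $1$-$\mathcal H$-tree decomposition $(T,\alpha,\beta)$ of $G$ of width $k$, the algorithm computes $\mathsf p_{g,\mathrm{opt}}(G)$ in time at most $$K\cdot p^k\cdot f(k+K)\cdot\big((k+1)N\big)^c\cdot(m+1)^d\quad\text{if }c\ge1,\qquad K\cdot p^k\cdot f(k+K)\cdot\big(m+(k+1)^2N\big)^d\quad\text{if }c=0,$$ where $N=\max(n,|V(T)|)$. In particular $N=n$ when $T$ has at most $n$ nodes. -/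

import Mathlib

/-! ## Finite simple graphs, graph classes -/

/-- A finite simple graph; vertices are natural numbers. -/
@[ext] structure FinGraph where
  verts : Finset ℕ
  edges : Finset (Sym2 ℕ)
  not_diag : ∀ e ∈ edges, ¬ e.IsDiag
  mem_verts : ∀ e ∈ edges, ∀ v ∈ e, v ∈ verts

namespace FinGraph

open scoped Classical in
/-- `G[S]`, the subgraph induced by `V(G) ∩ S`. -/
noncomputable def induce (G : FinGraph) (S : Finset ℕ) : FinGraph where
  verts := G.verts ∩ S
  edges := G.edges.filter (fun e => ∀ v ∈ e, v ∈ S)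
  not_diag := fun e he => G.not_diag e (Finset.mem_filter.1 he).1
  mem_verts := fun e he v hv =>
    Finset.mem_inter.2 ⟨G.mem_verts e (Finset.mem_filter.1 he).1 v hv,
      (Finset.mem_filter.1 he).2 v hv⟩

/-- `G ∖ S`. -/
noncomputable def del (G : FinGraph) (S : Finset ℕ) : FinGraph := G.induce (G.verts \ S)

/-- The union of two graphs; vertices with the same name are identified. -/
def union (G H : FinGraph) : FinGraph where
  verts := G.verts ∪ H.verts
  edges := G.edges ∪ H.edges
  not_diag := fun e he => (Finset.mem_union.1 he).elim (G.not_diag e) (H.not_diag e)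
  mem_verts := fun e he v hv => Finset.mem_union.2 <|
    (Finset.mem_union.1 he).imp (fun h => G.mem_verts e h v hv) (fun h => H.mem_verts e h v hv)

/-- The copy of `G` under a renaming of the vertices. -/
def rename (G : FinGraph) (π : ℕ ≃ ℕ) : FinGraph where
  verts := G.verts.image π
  edges := G.edges.image (Sym2.map π)
  not_diag := by
    intro e he
    obtain ⟨e', he', rfl⟩ := Finset.mem_image.1 he
    rw [Sym2.isDiag_map π.injective]
    exact G.not_diag e' he'
  mem_verts := by
    intro e he v hv
    obtain ⟨e', he', rfl⟩ := Finset.mem_image.1 he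
    obtain ⟨w, hw, rfl⟩ := Sym2.mem_map.1 hv
    exact Finset.mem_image_of_mem _ (G.mem_verts e' he' w hw)

end FinGraph

/-- A graph class: a set of finite graphs closed under isomorphism. -/
structure GraphClass where
  mem : Set FinGraph
  iso : ∀ G ∈ mem, ∀ π : ℕ ≃ ℕ, G.rename π ∈ mem

/-- Closed under the deletion of a vertex. -/
def GraphClass.Hereditary (H : GraphClass) : Prop :=
  ∀ G ∈ H.mem, ∀ v : ℕ, G.del {v} ∈ H.mem

/-! ## `p`-partitions, optimization problems and their annotated extensions -/

/-- The domain `∪𝒳` of a tuple of sets. -/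
def dom {p : ℕ} (P : Fin p → Finset ℕ) : Finset ℕ := Finset.univ.biUnion P

/-- `P` is a `p`-partition of `X` (ordered, empty parts allowed). -/
def IsPPartition {p : ℕ} (P : Fin p → Finset ℕ) (X : Finset ℕ) : Prop :=
  (Pairwise fun i j => Disjoint (P i) (P j)) ∧ dom P = X

/-- A `p`-partition-evaluation function on graphs: it depends only on the isomorphism type of
the graph with its partition.  The value `⊤` stands for `+∞`. -/
structure PartitionEval (p : ℕ) where
  val : FinGraph → (Fin p → Finset ℕ) → ℕ∞
  iso : ∀ (G : FinGraph) (P : Fin p → Finset ℕ), IsPPartition P G.verts → ∀ π : ℕ ≃ ℕ,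
    val (G.rename π) (fun i => (P i).image π) = val G P

/-- The choice of `opt`. -/
inductive Opt
  | min
  | max

/-- `p_{g,opt}(G) = opt {g(G,P) | P a p-partition of V(G)}`. -/
noncomputable def optValue {p : ℕ} (g : PartitionEval p) (opt : Opt) (G : FinGraph) : ℕ∞ :=
  match opt with
  | .min => ⨅ (P : Fin p → Finset ℕ) (_ : IsPPartition P G.verts), g.val G P
  | .max => ⨆ (P : Fin p → Finset ℕ) (_ : IsPPartition P G.verts), g.val G P

/-- The annotated extension
`p̂_{g,opt}(G,𝒳) = opt {g(G,P) | P a p-partition of V(G) with 𝒳 ⊆ P}`. -/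
noncomputable def annOptValue {p : ℕ} (g : PartitionEval p) (opt : Opt) (G : FinGraph)
    (𝒳 : Fin p → Finset ℕ) : ℕ∞ :=
  match opt with
  | .min => ⨅ (P : Fin p → Finset ℕ) (_ : IsPPartition P G.verts ∧ ∀ i, 𝒳 i ⊆ P i), g.val G P
  | .max => ⨆ (P : Fin p → Finset ℕ) (_ : IsPPartition P G.verts ∧ ∀ i, 𝒳 i ⊆ P i), g.val G P

/-! ## Boundaried graphs

A boundary vertex is named by its label.  Two boundaried graphs that are glued have to be in
general position (`Glueable`): a common vertex is a boundary vertex of both.  Then gluing along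
equal labels is the union. -/

@[ext] structure BGraph where
  graph : FinGraph
  bd : Finset ℕ
  bd_sub : bd ⊆ graph.verts

namespace BGraph

/-- The graphs meet only in common boundary vertices. -/
def Glueable (G F : BGraph) : Prop := G.graph.verts ∩ F.graph.verts ⊆ G.bd ∩ F.bd

/-- Same boundary labels, and the same graph on the boundary. -/
def Compatible (F G : BGraph) : Prop :=
  F.bd = G.bd ∧ F.graph.induce F.bd = G.graph.induce G.bd

/-- `G ⊕ F`. -/
def glue (G F : BGraph) : FinGraph := G.graph.union F.graph

/-- `G ⊞ F`. -/
def box (G F : BGraph) : BGraph where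
  graph := G.glue F
  bd := G.bd ∪ F.bd
  bd_sub := Finset.union_subset_union G.bd_sub F.bd_sub

/-- The trivial boundaried graph `(G[X], X)` on the boundary `X` of `G`. -/
noncomputable def core (G : BGraph) : BGraph where
  graph := G.graph.induce G.bd
  bd := G.bd
  bd_sub := fun _ hv => Finset.mem_inter.2 ⟨G.bd_sub hv, hv⟩

/-- `G = X ⊞ (⊞ᵢ Gᵢ)`, where `X = (G[X], X)` is the trivial boundaried graph on the boundary
of `G` and the `Gᵢ` are the members of `parts`. -/
def IsBoxSum (G : BGraph) (parts : List BGraph) : Prop :=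
  (G.core :: parts).Pairwise Glueable ∧ G = parts.foldr box G.core

open scoped Classical in
/-- `G ▷ F`: from `G ⊕ F` remove the boundary vertices of `F` that are not vertices of `G`, and
the edges of `F` between boundary vertices of `F` that are not edges of `G`. -/
noncomputable def overlay (G F : BGraph) : FinGraph where
  verts := G.graph.verts ∪ (F.graph.verts \ F.bd)
  edges := G.graph.edges ∪ F.graph.edges.filter (fun e =>
    (∃ v ∈ e, v ∉ F.bd) ∧ ∀ v ∈ e, v ∈ F.bd → v ∈ G.graph.verts)
  not_diag := fun e he => (Finset.mem_union.1 he).elim (G.graph.not_diag e)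
    (fun h => F.graph.not_diag e (Finset.mem_filter.1 h).1)
  mem_verts := by
    intro e he v hv
    rcases Finset.mem_union.1 he with h | h
    · exact Finset.mem_union_left _ (G.graph.mem_verts e h v hv)
    · obtain ⟨h1, -, h3⟩ := Finset.mem_filter.1 h
      by_cases hb : v ∈ F.bd
      · exact Finset.mem_union_left _ (h3 v hv hb)
      · exact Finset.mem_union_right _
          (Finset.mem_sdiff.2 ⟨F.graph.mem_verts e h1 v hv, hb⟩)

end BGraph

/-! ## `1`-`H`-tree decompositions -/

/-- A `1`-`H`-tree decomposition `(T, α, β)` of `G`, the nodes of `T` being `0, …, N-1`. -/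
structure HTreeDec (H : GraphClass) (G : FinGraph) where
  N : ℕ
  T : SimpleGraph (Fin N)
  isTree : T.IsTree
  α : Fin N → Finset ℕ
  β : Fin N → Finset ℕ
  cover : (Finset.univ.biUnion fun t => α t ∪ β t) = G.verts
  edge : ∀ e ∈ G.edges, ∃ t, ∀ v ∈ e, v ∈ α t ∪ β t
  conn : ∀ v ∈ G.verts, (T.induce {t | v ∈ α t ∪ β t}).Connected
  disj : ∀ t, Disjoint (α t) (β t)
  mem_class : ∀ t, G.induce (β t) ∈ H.mem
  adhesion : ∀ t u, T.Adj t u → ((α u ∪ β u) ∩ β t).card ≤ 1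

/-- The width `max |α(t)|`. -/
def HTreeDec.width {H : GraphClass} {G : FinGraph} (D : HTreeDec H G) : ℕ :=
  Finset.univ.sup fun t => (D.α t).card

/-! ## The machine model

A unit-cost random access machine with addition and truncated subtraction of natural numbers.
The memory consists of arrays, which have fixed names in the program; initially it is zero.
A program also reads from read-only input arrays.  A procedure call runs the procedure on a fresh
zero memory; its input arrays are pointers into arrays of the caller, and its result is the array
`0` of its memory. -/

/-- Array name, index ↦ content. -/
abbrev Arrays := ℕ → ℕ → ℕ

inductive Expr
  | lit (n : ℕ)
  | inp (a : ℕ) (i : Expr)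
  | mem (a : ℕ) (i : Expr)
  | add (x y : Expr)
  | sub (x y : Expr)

/-- The value of an expression for the input arrays `I` and the memory `M`. -/
def Expr.eval (I M : Arrays) : Expr → ℕ
  | .lit n => n
  | .inp a i => I a (i.eval I M)
  | .mem a i => M a (i.eval I M)
  | .add x y => x.eval I M + y.eval I M
  | .sub x y => x.eval I M - y.eval I M

/-- A pointer into an input array or a memory array. -/
inductive Ref
  | inp (a : ℕ) (offset : Expr)
  | mem (a : ℕ) (offset : Expr)

/-- The array that starts at the pointer. -/
def Ref.deref (I M : Arrays) : Ref → ℕ → ℕ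
  | .inp a o, i => I a (o.eval I M + i)
  | .mem a o, i => M a (o.eval I M + i)

inductive Prog
  | skip
  | set (a : ℕ) (i v : Expr)
  | seq (P Q : Prog)
  | ite (c : Expr) (P Q : Prog)
  | loop (c : Expr) (P : Prog)
  | call (P : Prog) (args : List Ref) (out : ℕ)

/-- The input arrays that a call passes. -/
def passArgs (I M : Arrays) (args : List Ref) : Arrays := fun j =>
  match args[j]? with
  | some r => r.deref I M
  | none => fun _ => 0

/-- `Exec I P M M' t`: on input arrays `I` and memory `M`, the program `P` halts with memory `M'`
after `t` steps.  An assignment, a test and a call are one step each. -/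
inductive Exec : Arrays → Prog → Arrays → Arrays → ℕ → Prop
  | skip (I M) : Exec I .skip M M 0
  | set (I M : Arrays) (a : ℕ) (i v : Expr) :
      Exec I (.set a i v) M
        (Function.update M a (Function.update (M a) (i.eval I M) (v.eval I M))) 1
  | seq {I P Q M M₁ M₂ t₁ t₂} : Exec I P M M₁ t₁ → Exec I Q M₁ M₂ t₂ →
      Exec I (.seq P Q) M M₂ (t₁ + t₂)
  | ite_true {I c P Q M M₁ t} : Expr.eval I M c ≠ 0 → Exec I P M M₁ t →
      Exec I (.ite c P Q) M M₁ (t + 1)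
  | ite_false {I c P Q M M₁ t} : Expr.eval I M c = 0 → Exec I Q M M₁ t →
      Exec I (.ite c P Q) M M₁ (t + 1)
  | loop_done {I c P M} : Expr.eval I M c = 0 → Exec I (.loop c P) M M 1
  | loop_step {I c P M M₁ M₂ t₁ t₂} : Expr.eval I M c ≠ 0 → Exec I P M M₁ t₁ →
      Exec I (.loop c P) M₁ M₂ t₂ → Exec I (.loop c P) M M₂ (t₁ + t₂ + 1)
  | call {I P args out M M₁ t} : Exec (passArgs I M args) P 0 M₁ t →
      Exec I (.call P args out) M (Function.update M out (M₁ 0)) (t + 1)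

/-- The input arrays that hold the given lists. -/
def load (ls : List (List ℕ)) : Arrays := fun a i => (ls.getD a []).getD i 0

/-- On the input `ls` the program computes the number `out` in time at most `time`, where loading
the input takes as many steps as it has cells. -/
def Prog.ComputesWithin (P : Prog) (ls : List (List ℕ)) (out time : ℕ) : Prop :=
  ∃ M t, Exec (load ls) P 0 M t ∧ M 0 0 = out ∧ (ls.map List.length).sum + t ≤ time

/-! ## Encodings -/

/-- A value in `ℕ ∪ {∞}` as a number: `∞` is `0`, and `n` is `n + 1`. -/
def encValue (x : ℕ∞) : ℕ := if x = ⊤ then 0 else x.toNat + 1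

/-- `l` lists the elements of `S`, each once. -/
def ListsSet (l : List ℕ) (S : Finset ℕ) : Prop := l.Nodup ∧ l.toFinset = S

def toEdges (l : List (ℕ × ℕ)) : List (Sym2 ℕ) := l.map fun e => s(e.1, e.2)

/-- `l` lists the edges in `E`, each once. -/
def ListsEdges (l : List (ℕ × ℕ)) (E : Finset (Sym2 ℕ)) : Prop :=
  (toEdges l).Nodup ∧ (toEdges l).toFinset = E

/-- `l` lists the pairs (vertex, index of its part), each once. -/
def ListsPartition {p : ℕ} (l : List (ℕ × ℕ)) (P : Fin p → Finset ℕ) : Prop :=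
  l.Nodup ∧ ∀ v i, (v, i) ∈ l ↔ ∃ h : i < p, v ∈ P ⟨i, h⟩

def flat (l : List (ℕ × ℕ)) : List ℕ := l.flatMap fun e => [e.1, e.2]

/-- An annotated graph on the vertices `0, …, n-1`, from a list of its edges and a list of its
annotated vertices. -/
def encAnnotated (n : ℕ) (es as : List (ℕ × ℕ)) : List (List ℕ) :=
  [[n, es.length, as.length], flat es, flat as]

/-- `parent` presents `T` as a tree with root `0` whose nodes are numbered so that each parent
precedes its children. -/
def IsParentMap {N : ℕ} (T : SimpleGraph (Fin N)) (parent : Fin N → Fin N) : Prop :=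
  ∀ t : Fin N, t.val ≠ 0 → parent t < t ∧ T.Adj t (parent t)

/-- A graph on the vertices `0, …, n-1` with a tree decomposition: the edges, the parents of the
nodes, and for every node the lists `as t` and `bs t` of the vertices in `α(t)` and `β(t)`. -/
def encDec {N : ℕ} (n : ℕ) (es : List (ℕ × ℕ)) (parent : Fin N → Fin N)
    (as bs : Fin N → List ℕ) : List (List ℕ) :=
  [[n, es.length, N], flat es, List.ofFn fun t => (parent t).val,
    List.ofFn fun t => (as t).length, (List.ofFn as).flatten,
    List.ofFn fun t => (bs t).length, (List.ofFn bs).flatten]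

/-! ## Problems solvable in a given time -/

/-- The annotated problem of `g` and `opt` is solvable on instances `(G,𝒳)` with `G ∖ ∪𝒳 ∈ H` in
time `f(|∪𝒳|)·n^c·m^d`.  The factors are `n + 1` and `m + 1`, so that the bound is not zero. -/
def AnnSolvable {p : ℕ} (g : PartitionEval p) (opt : Opt) (H : GraphClass) (f : ℕ → ℕ)
    (c d : ℕ) : Prop :=
  ∃ P : Prog, ∀ (n : ℕ) (G : FinGraph) (𝒳 : Fin p → Finset ℕ) (es as : List (ℕ × ℕ)),
    G.verts = Finset.range n → IsPPartition 𝒳 (dom 𝒳) → dom 𝒳 ⊆ G.verts →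
    G.del (dom 𝒳) ∈ H.mem → ListsEdges es G.edges → ListsPartition as 𝒳 →
    P.ComputesWithin (encAnnotated n es as) (encValue (annOptValue g opt G 𝒳))
      (f (dom 𝒳).card * (n + 1) ^ c * (G.edges.card + 1) ^ d)

/-! ## Nice reductions and nice problems -/

/-- `(G', 𝒜', s')` is an `H`-nice reduction of `(G, 𝒜)`, where `𝒜` is a `p`-partition of the
subset `A` of the boundary of `G`, the offset is `s' = s⁺ - s⁻`, and `K` bounds the implied
constants. -/
structure IsNiceReduction {p : ℕ} (H : GraphClass) (g : PartitionEval p) (opt : Opt) (K : ℕ)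
    (G : BGraph) (A : Finset ℕ) (𝒜 : Fin p → Finset ℕ)
    (G' : BGraph) (𝒜' : Fin p → Finset ℕ) (sneg : ℕ) (spos : ℕ∞) : Prop where
  general_position : G'.Glueable G
  partition : IsPPartition 𝒜' (dom 𝒜')
  dom_sub : dom 𝒜' ⊆ G'.graph.verts
  dom_card : (dom 𝒜').card ≤ A.card + K
  boxSum : ∃ parts', G'.IsBoxSum parts'
  verts_card : G'.graph.verts.card ≤ G.bd.card + K * ((G.bd \ A).card + 1)
  edges_card : G'.graph.edges.card ≤
    (G.graph.induce G.bd).edges.card + K * ((G.bd \ A).card + 1)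
  value : ∀ F : BGraph, F.Compatible G → G.Glueable F → G'.Glueable F →
    annOptValue g opt (G.glue F) 𝒜 + sneg = annOptValue g opt (G'.overlay F) 𝒜' + spos
  modulator : ∀ F : BGraph, F.Compatible G → G.Glueable F → G'.Glueable F →
    ((F.glue G).induce F.graph.verts).del A ∈ H.mem → (G'.overlay F).del (dom 𝒜') ∈ H.mem

/-- The array `a` holds the list `l` from the index `o` on. -/
def Holds (a : ℕ → ℕ) (o : ℕ) (l : List ℕ) : Prop :=
  ∀ (i : ℕ) (h : i < l.length), a (o + i) = l[i]

/-- Adjacency matrix of `G`: the row of `u` begins in the array `bits` at `row (o + u)`. -/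
def HoldsAdj (row : ℕ → ℕ) (o : ℕ) (bits : ℕ → ℕ) (G : FinGraph) : Prop :=
  ∀ u ∈ G.verts, ∀ v ∈ G.verts,
    (s(u, v) ∈ G.edges → bits (row (o + u) + v) = 1) ∧
    (s(u, v) ∉ G.edges → bits (row (o + u) + v) = 0)

/-- The `p`-partition of `X` into the colour classes of `φ`. -/
def colourClasses {p : ℕ} (φ : ℕ → Fin p) (X : Finset ℕ) : Fin p → Finset ℕ :=
  fun i => X.filter fun v => φ v = i

/-- The array `a` holds from the index `o` on all values `p̂_{g,opt}(G,𝒳)`, for the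
`p`-partitions `𝒳` of the set listed by `xs`; the place of a value is given by the parts of the
vertices in `xs`, read as digits in base `p`. -/
def HoldsTable {p : ℕ} (g : PartitionEval p) (opt : Opt) (a : ℕ → ℕ) (o : ℕ) (G : FinGraph)
    (xs : List ℕ) : Prop :=
  ∀ φ : ℕ → Fin p, a (o + Nat.ofDigits p (xs.map fun v => (φ v).val)) =
    encValue (annOptValue g opt G (colourClasses φ xs.toFinset))

/-- The input arrays `I` hold the input of a nice reduction: the sizes, `𝒜`, `B = X ∖ A`, `G`, and
for every part `Gᵢ` a record of six cells: the number and the place of its boundary vertices, the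
number and the place of its other vertices, the place of the table of the values
`p̂_{g,opt}(Gᵢ,𝒳ᵢ)`, the place of the adjacency matrix.  All vertex names are below `b`. -/
def HoldsNiceInput {p : ℕ} (g : PartitionEval p) (opt : Opt) (I : Arrays) (G : BGraph)
    (parts : List BGraph) (A : Finset ℕ) (𝒜 : Fin p → Finset ℕ) (b : ℕ) : Prop :=
  (∀ v ∈ G.graph.verts, v < b) ∧
  (∃ (as : List (ℕ × ℕ)) (bs : List ℕ), ListsPartition as 𝒜 ∧ ListsSet bs (G.bd \ A) ∧
    Holds (I 0) 0 [as.length, bs.length, parts.length, b] ∧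
    Holds (I 1) 0 (flat as) ∧ Holds (I 2) 0 bs) ∧
  HoldsAdj (I 3) 0 (I 4) G.graph ∧
  ∀ (i : ℕ) (h : i < parts.length), ∃ (xs ys : List ℕ) (px py pt pr : ℕ),
    ListsSet xs (parts[i]).bd ∧ ListsSet ys ((parts[i]).graph.verts \ (parts[i]).bd) ∧
    Holds (I 5) (6 * i) [xs.length, px, ys.length, py, pt, pr] ∧
    Holds (I 6) px xs ∧ Holds (I 7) py ys ∧
    HoldsTable g opt (I 8) pt (parts[i]).graph xs ∧
    HoldsAdj (I 9) pr (I 10) (parts[i]).graph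

open scoped Classical in
/-- The list `l` is the output of a nice reduction: the offset, `G'` as a modification of `G[X]`
(delete the vertices `rv` and the edges `re`, create `q` vertices `b, b+1, …`, add the edges `ae`),
and `𝒜'`. -/
def IsNiceOutput {p : ℕ} (l : List ℕ) (G : BGraph) (b : ℕ)
    (G' : BGraph) (𝒜' : Fin p → Finset ℕ) (sneg : ℕ) (spos : ℕ∞) : Prop :=
  ∃ (q : ℕ) (rv : List ℕ) (re ae an : List (ℕ × ℕ)),
    l = [sneg, encValue spos, q, rv.length, re.length, ae.length, an.length] ++
      rv ++ flat re ++ flat ae ++ flat an ∧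
    G'.graph.verts = (G.bd \ rv.toFinset) ∪ Finset.Ico b (b + q) ∧
    (let kept := (G.graph.induce (G.bd \ rv.toFinset)).edges \ (toEdges re).toFinset
     (toEdges ae).Nodup ∧ Disjoint kept (toEdges ae).toFinset ∧
      G'.graph.edges = kept ∪ (toEdges ae).toFinset) ∧
    ListsPartition an 𝒜'

/-- The annotated problem of `g` and `opt` is `H`-nice: an `H`-nice reduction is computed in time
`O(|A|·d)`, including the time to write the output.  The factors are `|A| + 1` and `d + 1`, so that
the bound is not zero. -/
def IsNiceProblem {p : ℕ} (H : GraphClass) (g : PartitionEval p) (opt : Opt) : Prop :=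
  ∃ (P : Prog) (K : ℕ), ∀ (G : BGraph) (parts : List BGraph) (A : Finset ℕ)
    (𝒜 : Fin p → Finset ℕ) (b : ℕ) (I : Arrays),
    G.IsBoxSum parts → A ⊆ G.bd → (∀ Gi ∈ parts, (Gi.bd \ A).card ≤ 1) →
    IsPPartition 𝒜 A → HoldsNiceInput g opt I G parts A 𝒜 b →
    ∃ (M : Arrays) (t : ℕ) (l : List ℕ) (G' : BGraph) (𝒜' : Fin p → Finset ℕ)
      (sneg : ℕ) (spos : ℕ∞),
      Exec I P 0 M t ∧ Holds (M 0) 0 l ∧ IsNiceOutput l G b G' 𝒜' sneg spos ∧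
      l.length + t ≤ K * (A.card + 1) * (parts.length + 1) ∧
      IsNiceReduction H g opt K G A 𝒜 G' 𝒜' sneg spos

set_option linter.unusedSimpArgs false


/-! ## Weakest preconditions for the machine -/

/-! The algorithm is dynamic programming over the rooted decomposition, from the leaves to the root.
Parents precede children, so the first node `top v` whose bag contains `v` is the root of the
subtree of nodes that contain `v`. The part at a node `t` is induced by the vertices whose first
node lies in the subtree of `t`, together with the boundary `bdry t`: the non-isolated vertices of
the bag that have appeared before. For each `t` the program tabulates the annotated values of this
part for all `p`-partitions of `bdry t`. At the root the boundary is empty and the part is `G`, so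
the only entry is the answer.

At a node, the set `X = cut t` consists of `A`, the boundary and the new vertices of `α(t)`, and
`B`, the new vertices of `β(t)` that lie on the boundary of a child. The part is glued along `X`
from `inner t`, the box sum of the parts of the children, and `outer t`, the graph induced by `piece
t` (`inner_isBoxSum`, `inner_glue_outer`). Both facts rest on `neighbour_partVerts`: a neighbour of
a vertex below a child belongs to the part of that child. The adhesion condition towards the parent
leaves at most one old vertex in `β(t)`, so `|A| ≤ k + 1` (`annotated_length`). Towards the children
it gives every child at most one boundary vertex outside `A`, so `|B|` is at most the number of
children (`parts_bd_card`, `ownB_length`). For each of the at most `p ^ (k + 1)` partitions of `A`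
the nice reduction replaces `inner t` by a graph that adds `O(|B| + 1)` to the size of `outer t`.
The solver applies to the result because `outer t` without `A` is an induced subgraph of `G[β(t)]`
(`outer_del_mem`). An entry of the table is the best value over all extensions from `bdry t` to `A`
(`table_entry`).

For the running time, every vertex and every edge is new at exactly one node, and there are `N - 1`
children in total. Besides its new edges a piece has only edges inside the boundary. Powers with a
positive exponent are superadditive (`sum_pow_le`), so the times of the solver add up. Two devices
make the overhead fit. Isolated vertices are kept out of the boundaries, so `|bdry t|` and `|B|` are
at most `2m`, as the factor `(m + 1) ^ d` requires when `c ≥ 1`. If `d = 0`, the bound does not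
mention `m`; but a solver has to load its input, so its own time bound dominates the number of edges
of each instance (`Solves.size_le`), and complete graphs with all vertices annotated give `j² ≤ f(j)
(j + 1) ^ c` (`Solves.sq_le`).

The programs are verified by weakest preconditions. The memory is initially zero, so an adjacency
matrix costs only its edges. The parts are never copied: their vertices are intervals of one
preorder array and all of them share the matrix of `G`, so a part is handed to the reduction as a
record of pointers. -/

instance : Add Expr := ⟨Expr.add⟩
instance : Sub Expr := ⟨Expr.sub⟩
instance (k : ℕ) : OfNat Expr k := ⟨Expr.lit k⟩

@[simp] theorem Expr.eval_ofNat (I M : Arrays) (k : ℕ) :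
    Expr.eval I M (no_index (OfNat.ofNat k)) = k := rfl
@[simp] theorem Expr.eval_lit (I M : Arrays) (k : ℕ) : Expr.eval I M (.lit k) = k := rfl
@[simp] theorem Expr.eval_add (I M : Arrays) (x y : Expr) :
    Expr.eval I M (x + y) = x.eval I M + y.eval I M := rfl
@[simp] theorem Expr.eval_sub (I M : Arrays) (x y : Expr) :
    Expr.eval I M (x - y) = x.eval I M - y.eval I M := rfl
@[simp] theorem Expr.eval_inp (I M : Arrays) (a : ℕ) (i : Expr) :
    Expr.eval I M (.inp a i) = I a (i.eval I M) := rfl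
@[simp] theorem Expr.eval_mem (I M : Arrays) (a : ℕ) (i : Expr) :
    Expr.eval I M (.mem a i) = M a (i.eval I M) := rfl

infixr:60 " ;; " => Prog.seq

/-- From the memory `M` the program halts after some number `t` of steps with a memory `M'` such
that `Q M' t`. -/
def Wp (I : Arrays) (P : Prog) (M : Arrays) (Q : Arrays → ℕ → Prop) : Prop :=
  ∃ M' t, Exec I P M M' t ∧ Q M' t

theorem Wp.mono {I P M} {Q R : Arrays → ℕ → Prop} (h : Wp I P M Q)
    (hQR : ∀ M' t, Q M' t → R M' t) : Wp I P M R :=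
  let ⟨M', t, he, hq⟩ := h
  ⟨M', t, he, hQR M' t hq⟩

@[simp] theorem wp_skip {I M Q} : Wp I .skip M Q ↔ Q M 0 := by
  constructor
  · rintro ⟨_, _, h, hq⟩; cases h; exact hq
  · exact fun h => ⟨_, _, .skip I M, h⟩

@[simp] theorem wp_set {I a i v M Q} : Wp I (.set a i v) M Q ↔
    Q (Function.update M a (Function.update (M a) (i.eval I M) (v.eval I M))) 1 := by
  constructor
  · rintro ⟨_, _, h, hq⟩; cases h; exact hq
  · exact fun h => ⟨_, _, .set I M a i v, h⟩

@[simp] theorem wp_seq {I P R M Q} : Wp I (P ;; R) M Q ↔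
    Wp I P M fun M₁ t₁ => Wp I R M₁ fun M₂ t₂ => Q M₂ (t₁ + t₂) := by
  constructor
  · rintro ⟨_, _, h, hq⟩; cases h with
    | seq h₁ h₂ => exact ⟨_, _, h₁, _, _, h₂, hq⟩
  · rintro ⟨_, _, h₁, _, _, h₂, hq⟩; exact ⟨_, _, .seq h₁ h₂, hq⟩

@[simp] theorem wp_ite {I c P R M Q} : Wp I (.ite c P R) M Q ↔
    if c.eval I M = 0 then Wp I R M fun M' t => Q M' (t + 1)
    else Wp I P M fun M' t => Q M' (t + 1) := by
  split_ifs with hc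
  · constructor
    · rintro ⟨_, _, h, hq⟩; cases h with
      | ite_true h => exact absurd hc h
      | ite_false _ h => exact ⟨_, _, h, hq⟩
    · rintro ⟨_, _, h, hq⟩; exact ⟨_, _, .ite_false hc h, hq⟩
  · constructor
    · rintro ⟨_, _, h, hq⟩; cases h with
      | ite_true _ h => exact ⟨_, _, h, hq⟩
      | ite_false h => exact absurd h hc
    · rintro ⟨_, _, h, hq⟩; exact ⟨_, _, .ite_true hc h, hq⟩

/-- A callee starts from the zero memory, so a procedure only needs a specification at the memory
`0`. -/
theorem wp_call {I P args out M Q} : Wp I (.call P args out) M Q ↔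
    Wp (passArgs I M args) P 0 fun M₁ t => Q (Function.update M out (M₁ 0)) (t + 1) := by
  constructor
  · rintro ⟨_, _, h, hq⟩; cases h with
    | call h => exact ⟨_, _, h, hq⟩
  · rintro ⟨_, _, h, hq⟩; exact ⟨_, _, .call h, hq⟩

/-- `for x = 0, …, b - 1 do P`, the counter `x` being a scalar. -/
def Prog.for (x : ℕ) (b : Expr) (P : Prog) : Prog :=
  .set x 0 0 ;; .loop (b - .mem x 0) (P ;; .set x 0 (.mem x 0 + 1))

/-- The budget `T i` covers the body and the increment of the counter. Every round adds one test,
and the constant 2 stands for the initialisation and the last test. -/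
theorem Wp.for {I x b P M} (n : ℕ) (Inv : ℕ → Arrays → Prop) (T : ℕ → ℕ)
    (hb : ∀ i ≤ n, ∀ M, Inv i M → b.eval I M = n ∧ M x 0 = i)
    (h0 : Inv 0 (Function.update M x (Function.update (M x) 0 0)))
    (hs : ∀ i < n, ∀ M, Inv i M →
      Wp I (P ;; .set x 0 (.mem x 0 + 1)) M fun M' t => t ≤ T i ∧ Inv (i + 1) M') :
    Wp I (.for x b P) M fun M' t => Inv n M' ∧ t ≤ 2 + ∑ i ∈ Finset.range n, (T i + 1) := by
  -- Induction on the number `j` of rounds that remain.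
  have key : ∀ j ≤ n, ∀ M, Inv (n - j) M →
      Wp I (.loop (b - .mem x 0) (P ;; .set x 0 (.mem x 0 + 1))) M fun M' t =>
        Inv n M' ∧ t ≤ 1 + ∑ i ∈ Finset.Ico (n - j) n, (T i + 1) := by
    intro j
    induction j with
    | zero =>
      intro _ M hM
      obtain ⟨h1, h2⟩ := hb _ (by omega) M hM
      refine ⟨_, _, .loop_done ?_, by simpa using hM, by simp⟩
      show b.eval I M - M x 0 = 0
      omega
    | succ j ih =>
      intro hj M hM
      obtain ⟨h1, h2⟩ := hb _ (by omega) M hM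
      obtain ⟨M₁, t₁, e₁, ht, hi⟩ := hs (n - (j + 1)) (by omega) M hM
      obtain ⟨M₂, t₂, e₂, hi₂, ht₂⟩ := ih (by omega) M₁
        (by rwa [show n - j = n - (j + 1) + 1 by omega])
      refine ⟨_, _, .loop_step ?_ e₁ e₂, hi₂, ?_⟩
      · show b.eval I M - M x 0 ≠ 0
        omega
      · rw [Finset.sum_eq_sum_Ico_succ_bot (by omega),
          show n - (j + 1) + 1 = n - j by omega]
        omega
  rw [Prog.for, wp_seq, wp_set]
  refine (key n le_rfl _ (by simpa using h0)).mono ?_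
  rintro M' t ⟨h, ht⟩
  refine ⟨h, ?_⟩
  simp only [Nat.sub_self, Nat.Ico_zero_eq_range] at ht
  omega

/-- A loop whose memory is known exactly after each iteration. -/
theorem Wp.for_eq {I x b P M} (n : ℕ) (S : ℕ → Arrays) (T : ℕ → ℕ)
    (hb : ∀ i ≤ n, b.eval I (S i) = n ∧ S i x 0 = i)
    (h0 : Function.update M x (Function.update (M x) 0 0) = S 0)
    (hs : ∀ i < n, Wp I (P ;; .set x 0 (.mem x 0 + 1)) (S i) fun M' t =>
      t ≤ T i ∧ M' = S (i + 1)) :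
    Wp I (.for x b P) M fun M' t => M' = S n ∧ t ≤ 2 + ∑ i ∈ Finset.range n, (T i + 1) :=
  Wp.for n (fun i M => M = S i) T (by rintro i hi M rfl; exact hb i hi) h0
    (by rintro i hi M rfl; exact hs i hi)

/-! ## Memories with finitely many arrays -/

/-- The memory with the given arrays. -/
def mk (l : List (ℕ → ℕ)) : Arrays := fun a => l.getD a 0

/-- An array that holds a list and is zero elsewhere. -/
def arr (l : List ℕ) : ℕ → ℕ := fun i => l.getD i 0

/-- A scalar. -/
def sc (x : ℕ) : ℕ → ℕ := arr [x]

/-- An array that is `1` at the members of a list. -/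
def marks (l : List ℕ) : ℕ → ℕ := fun x => if x ∈ l then 1 else 0

@[simp] theorem mk_zero (x : ℕ → ℕ) (l) : mk (x :: l) 0 = x := rfl
@[simp] theorem mk_succ (x : ℕ → ℕ) (l) (a : ℕ) : mk (x :: l) (a + 1) = mk l a := rfl
-- The side condition compares numerals, so `simp` can execute assignments on an explicit list of
-- arrays.
theorem mk_update (l : List (ℕ → ℕ)) (a : ℕ) (y : ℕ → ℕ) (h : a < l.length) :
    Function.update (mk l) a y = mk (l.set a y) := by
  funext b
  rcases eq_or_ne b a with rfl | hb
  · simp [mk, h]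
  · simp [mk, hb, hb.symm]

/-- Here `k` is chosen as the number of arrays that a program uses, so that `mk_update` applies to
each of them. -/
theorem zero_eq_mk (k : ℕ) : (0 : Arrays) = mk (List.replicate k 0) := by
  funext a
  by_cases h : a < k <;> simp [mk, h]

@[simp] theorem arr_nil : arr [] = 0 := rfl
@[simp] theorem sc_zero (x : ℕ) : sc x 0 = x := rfl
@[simp] theorem update_sc (x y : ℕ) : Function.update (sc x) 0 y = sc y := by
  funext i; cases i <;> simp [sc, arr]
@[simp] theorem update_zero_sc (y : ℕ) : Function.update (0 : ℕ → ℕ) 0 y = sc y := by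
  funext i; cases i <;> simp [sc, arr]
@[simp] theorem sc_zero_eq : sc 0 = 0 := by
  funext i; cases i <;> simp [sc, arr]

@[simp] theorem arr_zero : arr [0] = 0 := sc_zero_eq

theorem arr_get (l : List ℕ) (i : ℕ) (h : i < l.length) : arr l i = l[i] := by
  simp [arr, h]

@[simp] theorem arr_cons_zero (x : ℕ) (l : List ℕ) : arr (x :: l) 0 = x := rfl
@[simp] theorem arr_cons_succ (x : ℕ) (l : List ℕ) (i : ℕ) : arr (x :: l) (i + 1) = arr l i := rfl

/-- The invariant step of the loops that write a list: the cell just behind the list is overwritten.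
-/
theorem arr_push {l : List ℕ} {i : ℕ} (h : i = l.length) (x : ℕ) :
    Function.update (arr l) i x = arr (l ++ [x]) := by
  subst h
  funext j
  rcases lt_trichotomy j l.length with hj | rfl | hj
  · simp [arr, hj.ne, List.getElem?_append, hj]
  · simp [arr]
  · rw [Function.update_of_ne hj.ne', arr, arr, List.getD_eq_default _ _ hj.le,
      List.getD_eq_default _ _ (by simp; omega)]

theorem arr_cons_update (x y : ℕ) (l : List ℕ) :
    Function.update (arr (x :: l)) 0 y = arr (y :: l) := by
  funext j; cases j <;> simp [arr]

theorem holds_arr (l : List ℕ) : Holds (arr l) 0 l := fun i h => by simp [arr, h]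

theorem holds_arr_cons (x : ℕ) (l : List ℕ) : Holds (arr (x :: l)) 1 l := fun i h => by
  rw [add_comm]; simp [arr, h]

theorem holds_iff_offset {a : ℕ → ℕ} {o : ℕ} {l : List ℕ} :
    Holds a o l ↔ Holds (fun i => a (o + i)) 0 l := by simp [Holds]

theorem marks_push (l : List ℕ) (x : ℕ) :
    Function.update (marks l) x 1 = marks (l ++ [x]) := by
  funext j
  by_cases h : j = x
  · simp [marks, h]
  · simp [marks, h]

@[simp] theorem marks_nil : marks [] = 0 := by funext; simp [marks]

theorem marks_eq_zero {l : List ℕ} {x : ℕ} : marks l x = 0 ↔ x ∉ l := by simp [marks]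

theorem passArgs_eq (I M : Arrays) (args : List Ref) :
    passArgs I M args = mk (args.map (Ref.deref I M)) := by
  funext j
  simp only [passArgs, mk, List.getD_eq_getElem?_getD, List.getElem?_map]
  cases args[j]? <;> rfl

@[simp] theorem deref_inp (I M : Arrays) (a : ℕ) (o : Expr) :
    Ref.deref I M (.inp a o) = fun i => I a (o.eval I M + i) := rfl
@[simp] theorem deref_mem (I M : Arrays) (a : ℕ) (o : Expr) :
    Ref.deref I M (.mem a o) = fun i => M a (o.eval I M + i) := rfl

theorem load_eq_mk (ls : List (List ℕ)) : load ls = mk (ls.map arr) := by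
  funext a i
  simp only [load, mk, List.getD_eq_getElem?_getD, List.getElem?_map]
  cases ls[a]? <;> rfl

@[simp] theorem flat_nil : flat [] = [] := rfl
@[simp] theorem flat_append (l l' : List (ℕ × ℕ)) : flat (l ++ l') = flat l ++ flat l' := by
  simp [flat]
@[simp] theorem flat_cons (e : ℕ × ℕ) (l : List (ℕ × ℕ)) : flat (e :: l) = e.1 :: e.2 :: flat l :=
  rfl
@[simp] theorem flat_length (l : List (ℕ × ℕ)) : (flat l).length = l.length + l.length := by
  induction l with
  | nil => rfl
  | cons e l ih => simp [ih]; omega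

theorem flat_get (l : List (ℕ × ℕ)) (i : ℕ) (h : i < l.length) :
    (flat l)[i + i]'(by simp; omega) = l[i].1 ∧ (flat l)[i + i + 1]'(by simp; omega) = l[i].2 := by
  induction l generalizing i with
  | nil => simp at h
  | cons e l ih =>
    cases i with
    | zero => simp
    | succ i =>
      have := ih i (by simpa using h)
      simpa [show i + 1 + (i + 1) = i + i + 1 + 1 by omega] using this

theorem holds_flat {a : ℕ → ℕ} {o : ℕ} {l : List (ℕ × ℕ)} (h : Holds a o (flat l)) (i : ℕ)
    (hi : i < l.length) : a (o + (i + i)) = l[i].1 ∧ a (o + (i + i + 1)) = l[i].2 := by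
  rw [h _ (by simp; omega), h _ (by simp; omega)]
  exact flat_get l i hi

theorem take_succ_eq {α : Type*} (l : List α) (i : ℕ) (h : i < l.length) :
    l.take (i + 1) = l.take i ++ [l[i]] := by
  rw [List.take_add_one, List.getElem?_eq_getElem h]; rfl

/-! ## Elementary procedures -/

/-- The multiples of `n + m + N + 1`. -/
def mulP : Prog :=
  .for 1 (.inp 0 0 + .inp 0 2 + 1) (.set 0 (.mem 1 0) (.mem 2 0) ;;
    .set 2 0 (.mem 2 0 + .inp 0 0 + .inp 0 1 + .inp 0 2 + 1))

/-- The machine cannot multiply. The multiples are the starts of the rows of the adjacency matrix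
and of the buckets; the row length exceeds `n`, `m` and `N`. -/
theorem mulP_spec (I : Arrays) (n m N : ℕ) (h0 : I 0 0 = n) (h1 : I 0 1 = m) (h2 : I 0 2 = N) :
    Wp I mulP 0 fun M' t =>
      M' 0 = arr ((List.range (n + N + 1)).map (· * (n + m + N + 1))) ∧
      t ≤ 2 + (n + N + 1) * 4 := by
  rw [mulP, zero_eq_mk 3]
  refine (Wp.for_eq (n + N + 1) (fun i => mk [arr ((List.range i).map (· * (n + m + N + 1))), sc i,
    sc (i * (n + m + N + 1))]) (fun _ => 3) ?_ ?_ ?_).mono ?_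
  · simp [h0, h2]
  · simp [mk_update]
  · intro i hi
    simp [mk_update, h0, h1, h2, arr_push, List.range_succ]
    rw [show i * (n + m + N + 1) + n + m + N + 1 = (i + 1) * (n + m + N + 1) by ring]
  · rintro M' t ⟨rfl, ht⟩
    exact ⟨rfl, by simpa using ht⟩

/-- The characteristic function of a list. -/
def marksP : Prog := .for 1 (.inp 1 0) (.set 0 (.inp 0 (.mem 1 0)) 1)

theorem marksP_spec (I : Arrays) (l : List ℕ) (h0 : Holds (I 0) 0 l) (h1 : I 1 0 = l.length) :
    Wp I marksP 0 fun M' t => M' 0 = marks l ∧ t ≤ 2 + l.length * 3 := by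
  rw [marksP, zero_eq_mk 2]
  refine (Wp.for_eq l.length (fun i => mk [marks (l.take i), sc i]) (fun _ => 2) ?_ ?_ ?_).mono ?_
  · simp [h1]
  · simp [mk_update]
  · intro i hi
    have := h0 i hi
    simp at this
    simp [mk_update, this, take_succ_eq _ _ hi, -List.take_append_getElem, marks_push]
  · rintro M' t ⟨rfl, ht⟩
    exact ⟨by simp, by simpa using ht⟩

/-- The concatenation of two lists, preceded by its length. -/
def catP : Prog :=
  .set 0 0 (.inp 1 0 + .inp 3 0) ;;
  .for 1 (.inp 1 0) (.set 0 (.mem 1 0 + 1) (.inp 0 (.mem 1 0))) ;;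
  .for 1 (.inp 3 0) (.set 0 (.inp 1 0 + .mem 1 0 + 1) (.inp 2 (.mem 1 0)))

theorem catP_spec (I : Arrays) (l l' : List ℕ) (h0 : Holds (I 0) 0 l) (h1 : I 1 0 = l.length)
    (h2 : Holds (I 2) 0 l') (h3 : I 3 0 = l'.length) :
    Wp I catP 0 fun M' t => M' 0 = arr ((l ++ l').length :: (l ++ l')) ∧
      t ≤ 5 + (l ++ l').length * 3 := by
  rw [catP, zero_eq_mk 2]
  simp only [wp_seq, wp_set]
  refine (Wp.for_eq l.length (fun i => mk [arr ((l.length + l'.length) :: l.take i), sc i])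
    (fun _ => 2) ?_ ?_ ?_).mono ?_
  · simp [h1]
  · simp [mk_update, h1, h3]; rfl
  · intro i hi
    have := h0 i hi
    simp at this
    have hl : i + 1 = ((l.length + l'.length) :: l.take i).length := by simp; omega
    simp [mk_update, this, take_succ_eq _ _ hi, -List.take_append_getElem, arr_push hl]
  rintro M' t ⟨rfl, ht⟩
  refine (Wp.for_eq l'.length
    (fun i => mk [arr ((l.length + l'.length) :: (l ++ l'.take i)), sc i])
    (fun _ => 2) ?_ ?_ ?_).mono ?_
  · simp [h3]
  · simp [mk_update]
  · intro i hi
    have := h2 i hi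
    simp at this
    have hl : l.length + i + 1 = ((l.length + l'.length) :: (l ++ l'.take i)).length := by
      simp; omega
    simp [mk_update, this, take_succ_eq _ _ hi, -List.take_append_getElem, h1, arr_push hl]
  · rintro M' t ⟨rfl, ht'⟩
    simp at ht ht' ⊢
    omega

/-- The members of a list that satisfy a test, preceded by their number. -/
def filterP (c : Expr) : Prog :=
  .for 1 (.inp 1 0) (.set 3 0 (.inp 0 (.mem 1 0)) ;;
    .ite c (.set 2 0 (.mem 2 0 + 1) ;; .set 0 (.mem 2 0) (.mem 3 0)) .skip) ;;
  .set 0 0 (.mem 2 0)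

theorem filterP_spec (I : Arrays) (l : List ℕ) (c : Expr) (q : ℕ → Prop) [DecidablePred q]
    (h0 : Holds (I 0) 0 l) (h1 : I 1 0 = l.length)
    (hc : ∀ M : Arrays, M 3 0 ∈ l → (c.eval I M = 0 ↔ ¬ q (M 3 0))) :
    Wp I (filterP c) 0 fun M' t =>
      M' 0 = arr ((l.filter (q ·)).length :: l.filter (q ·)) ∧ t ≤ 3 + l.length * 6 := by
  rw [filterP, zero_eq_mk 4]
  simp only [wp_seq, wp_set]
  -- Cell 3 holds the element tested last, and zero before the first round.
  refine (Wp.for_eq l.length (fun i => mk [arr (0 :: (l.take i).filter (q ·)), sc i,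
    sc ((l.take i).filter (q ·)).length, sc (if i = 0 then 0 else arr l (i - 1))])
    (fun _ => 5) ?_ ?_ ?_).mono ?_
  · simp [h1]
  · simp [mk_update, sc]
  · intro i hi
    have h := h0 i hi
    have hm := List.getElem_mem hi
    simp at h
    have hcc := fun a1 a2 a3 => hc (mk [a1, a2, a3, sc l[i]]) (by simp [hm])
    simp only [mk_zero, mk_succ, sc_zero, show (3 : ℕ) = 0 + 1 + 1 + 1 from rfl] at hcc
    by_cases hq : q l[i]
    · simp [mk_update, h, take_succ_eq _ _ hi, -List.take_append_getElem, hcc, hq, arr_get _ _ hi]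
      rw [arr_push (by simp)]; simp
    · simp [mk_update, h, take_succ_eq _ _ hi, -List.take_append_getElem, hcc, hq, arr_get _ _ hi]
  · rintro M' t ⟨rfl, ht⟩
    simp at ht
    simp [arr_cons_update]
    omega

/-- The adjacency matrix of the graph with the given edges. -/
def adjP : Prog :=
  .for 1 (.inp 2 0) (.set 2 0 (.inp 0 (.mem 1 0 + .mem 1 0)) ;;
    .set 3 0 (.inp 0 (.mem 1 0 + .mem 1 0 + 1)) ;;
    .set 0 (.inp 1 (.mem 2 0) + .mem 3 0) 1 ;; .set 0 (.inp 1 (.mem 3 0) + .mem 2 0) 1)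

/-- The cells of the adjacency matrix that belong to the edges, in both orientations. -/
def adjList (row : ℕ → ℕ) (es : List (ℕ × ℕ)) : List ℕ :=
  es.flatMap fun e => [row e.1 + e.2, row e.2 + e.1]

/-- Cells that are not written stay zero, so the time depends on the number of edges and not on the
size of the matrix. -/
theorem adjP_spec (I : Arrays) (es : List (ℕ × ℕ)) (h0 : Holds (I 0) 0 (flat es))
    (h2 : I 2 0 = es.length) :
    Wp I adjP 0 fun M' t => M' 0 = marks (adjList (I 1) es) ∧ t ≤ 2 + es.length * 6 := by
  rw [adjP, zero_eq_mk 4]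
  refine (Wp.for es.length (fun i M => ∃ y z, M = mk [marks (adjList (I 1) (es.take i)), sc i, sc y, sc z])
    (fun _ => 5) ?_ ?_ ?_).mono ?_
  · rintro i hi _ ⟨y, z, rfl⟩; simp [h2]
  · exact ⟨0, 0, by simp [mk_update, adjList]⟩
  · rintro i hi _ ⟨y, z, rfl⟩
    obtain ⟨h3, h4⟩ := holds_flat h0 i hi
    rw [zero_add] at h3 h4
    simp only [wp_seq, wp_set]
    refine ⟨by omega, (es[i]).1, (es[i]).2, ?_⟩
    simp [mk_update, h3, h4, take_succ_eq _ _ hi, -List.take_append_getElem, adjList, marks_push]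
  · rintro M' t ⟨⟨y, z, rfl⟩, ht⟩
    exact ⟨by simp, by simpa using ht⟩

/-- The partial sums of the first `count` numbers. -/
def partialSumsP : Prog :=
  .for 1 (.inp 1 0) (.set 0 (.mem 1 0) (.mem 2 0) ;; .set 2 0 (.mem 2 0 + .inp 0 (.mem 1 0)))

theorem partialSumsP_spec (I : Arrays) (N : ℕ) (h1 : I 1 0 = N) :
    Wp I partialSumsP 0 fun M' t =>
      M' 0 = arr ((List.range N).map fun t => ∑ s ∈ Finset.range t, I 0 s) ∧ t ≤ 2 + N * 4 := by
  rw [partialSumsP, zero_eq_mk 3]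
  refine (Wp.for_eq N (fun i => mk [arr ((List.range i).map fun t => ∑ s ∈ Finset.range t, I 0 s),
    sc i, sc (∑ s ∈ Finset.range i, I 0 s)]) (fun _ => 3) ?_ ?_ ?_).mono ?_
  · simp [h1]
  · simp [mk_update]
  · intro i hi
    simp [mk_update, arr_push, List.range_succ, Finset.sum_range_succ]
  · rintro M' t ⟨rfl, ht⟩
    exact ⟨rfl, by simpa using ht⟩

/-- The first component, plus one, of the first pair with a given second component. -/
def firstArr (l : List (ℕ × ℕ)) : ℕ → ℕ := fun v =>
  ((l.find? fun e => e.2 == v).map fun e => e.1 + 1).getD 0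

theorem firstArr_push (l : List (ℕ × ℕ)) (t v : ℕ) :
    firstArr (l ++ [(t, v)]) =
      if firstArr l v = 0 then Function.update (firstArr l) v (t + 1) else firstArr l := by
  funext w
  rw [apply_ite (fun f : ℕ → ℕ => f w)]
  simp only [Function.update_apply, firstArr, List.find?_append]
  by_cases hw : w = v
  · subst hw
    cases h : l.find? fun e => e.2 == w <;> simp
  · have : ¬ v = w := fun h => hw h.symm
    cases h' : l.find? fun e => e.2 == w <;> simp [hw, this]

/-- Enters the current node for the members of one list that have no entry yet. Nodes are stored
plus one, so that zero means no entry. -/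
def topLoop (a b c : ℕ) : Prog :=
  .for 2 (.inp a (.mem 1 0)) (.set 3 0 (.inp c (.inp b (.mem 1 0) + .mem 2 0)) ;;
    .ite (.mem 0 (.mem 3 0)) .skip (.set 0 (.mem 3 0) (.mem 1 0 + 1)))

theorem topLoop_spec (I : Arrays) (a b c t : ℕ) (l : List ℕ) (L : List (ℕ × ℕ)) (y z : ℕ)
    (ha : I a t = l.length) (hl : Holds (I c) (I b t) l) :
    Wp I (topLoop a b c) (mk [firstArr L, sc t, sc y, sc z]) fun M' s =>
      (∃ y z, M' = mk [firstArr (L ++ l.map (t, ·)), sc t, sc y, sc z]) ∧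
        s ≤ 2 + l.length * 5 := by
  rw [topLoop]
  refine (Wp.for l.length (fun i M => ∃ z, M = mk [firstArr (L ++ (l.take i).map (t, ·)), sc t,
    sc i, sc z]) (fun _ => 4) ?_ ?_ ?_).mono ?_
  · rintro i hi _ ⟨z, rfl⟩; simp [ha]
  · exact ⟨z, by simp [mk_update]⟩
  · rintro i hi _ ⟨z, rfl⟩
    have := hl i hi
    simp only [wp_seq, wp_set, wp_ite]
    have hp := firstArr_push (L ++ (l.take i).map (t, ·)) t l[i]
    rw [List.append_assoc] at hp
    by_cases hz : firstArr (L ++ (l.take i).map (t, ·)) l[i] = 0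
    · rw [if_pos hz] at hp
      simp [mk_update, this, take_succ_eq _ _ hi, -List.take_append_getElem, hz, hp, -List.map_take]
      exact ⟨_, rfl⟩
    · rw [if_neg hz] at hp
      simp [mk_update, this, take_succ_eq _ _ hi, -List.take_append_getElem, hz, hp, -List.map_take]
      exact ⟨_, rfl⟩
  · rintro M' s ⟨⟨z, rfl⟩, hs⟩
    exact ⟨⟨l.length, z, by simp⟩, by simpa using hs⟩

/-- For every vertex the first node, plus one, whose bag contains it. -/
def topP : Prog := .for 1 (.inp 0 2) (topLoop 1 2 3 ;; topLoop 4 5 6)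

theorem topP_spec (I : Arrays) (N : ℕ) (as bs : ℕ → List ℕ) (hN : I 0 2 = N)
    (h1 : ∀ t < N, I 1 t = (as t).length) (h3 : ∀ t < N, Holds (I 3) (I 2 t) (as t))
    (h4 : ∀ t < N, I 4 t = (bs t).length) (h6 : ∀ t < N, Holds (I 6) (I 5 t) (bs t)) :
    Wp I topP 0 fun M' s =>
      M' 0 = firstArr ((List.range N).flatMap fun t => (as t ++ bs t).map (t, ·)) ∧
      s ≤ 2 + ∑ t ∈ Finset.range N, (((as t).length + (bs t).length) * 5 + 6) := by
  rw [topP, zero_eq_mk 4]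
  refine (Wp.for N (fun i M => ∃ y z, M = mk [firstArr ((List.range i).flatMap fun t =>
    (as t ++ bs t).map (t, ·)), sc i, sc y, sc z])
    (fun t => ((as t).length + (bs t).length) * 5 + 5) ?_ ?_ ?_).mono ?_
  · rintro i hi _ ⟨y, z, rfl⟩; simp [hN]
  · exact ⟨0, 0, by simp [mk_update]; rfl⟩
  · rintro i hi _ ⟨y, z, rfl⟩
    simp only [wp_seq]
    refine (topLoop_spec I 1 2 3 i (as i) _ y z (h1 i hi) (h3 i hi)).mono ?_
    rintro _ s ⟨⟨y, z, rfl⟩, hs⟩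
    refine (topLoop_spec I 4 5 6 i (bs i) _ y z (h4 i hi) (h6 i hi)).mono ?_
    rintro _ s' ⟨⟨y, z, rfl⟩, hs'⟩
    rw [wp_set]
    refine ⟨by omega, y, z, ?_⟩
    simp [mk_update, List.range_succ]
  · rintro M' s ⟨⟨y, z, rfl⟩, hs⟩
    exact ⟨rfl, hs⟩

/-- The bucket of the key `k` begins at `I 1 k` with its size. -/
def bucketP : Prog :=
  .for 1 (.inp 2 0) (.set 2 0 (.inp 1 (.inp 0 (.mem 1 0))) ;;
    .set 0 (.mem 2 0) (.mem 0 (.mem 2 0) + 1) ;;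
    .set 0 (.mem 2 0 + .mem 0 (.mem 2 0)) (.mem 1 0))

/-- The indices below `L` with the given key. -/
def bucket (key : ℕ → ℕ) (L k : ℕ) : List ℕ := (List.range L).filter fun i => key i = k

theorem bucket_succ (key : ℕ → ℕ) (L k : ℕ) :
    bucket key (L + 1) k = if key L = k then bucket key L k ++ [L] else bucket key L k := by
  by_cases h : key L = k <;> simp [bucket, List.range_succ, h]

theorem bucket_length_le (key : ℕ → ℕ) (L k : ℕ) : (bucket key L k).length ≤ L := by
  simpa [bucket] using List.length_filter_le (fun i => decide (key i = k)) (List.range L)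

/-- Uniqueness of the leading digit in base `S`. -/
theorem mul_add_ne {S t t' j j' : ℕ} (hj : j < S) (hj' : j' < S) (h : t ≠ t') :
    t * S + j ≠ t' * S + j' := by
  intro he
  apply h
  have h1 : (t * S + j) / S = t := by
    rw [mul_comm, Nat.mul_add_div (by omega), Nat.div_eq_of_lt hj, add_zero]
  have h2 : (t' * S + j') / S = t' := by
    rw [mul_comm, Nat.mul_add_div (by omega), Nat.div_eq_of_lt hj', add_zero]
  rw [← h1, he, h2]

theorem holds_cons {a : ℕ → ℕ} {o x : ℕ} {l : List ℕ} :
    Holds a o (x :: l) ↔ a o = x ∧ Holds a (o + 1) l := by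
  constructor
  · intro h
    refine ⟨h 0 (by simp), fun i hi => ?_⟩
    have := h (i + 1) (by simpa using hi)
    rw [add_assoc, add_comm 1 i]
    simpa using this
  · rintro ⟨h0, h⟩ i hi
    cases i with
    | zero => simpa using h0
    | succ i =>
      have := h i (by simpa using hi)
      rw [add_assoc, add_comm 1 i] at this
      simpa using this

theorem Holds.congr {a a' : ℕ → ℕ} {o : ℕ} {l : List ℕ} (h : Holds a o l)
    (ha : ∀ i < l.length, a' (o + i) = a (o + i)) : Holds a' o l :=
  fun i hi => (ha i hi).trans (h i hi)

theorem holds_append_singleton {a : ℕ → ℕ} {o x : ℕ} {l : List ℕ} (h : Holds a o l)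
    (hx : a (o + l.length) = x) : Holds a o (l ++ [x]) := by
  intro i hi
  rcases Nat.lt_or_ge i l.length with h1 | h1
  · rw [h i h1, List.getElem_append_left h1]
  · obtain rfl : i = l.length := by simp at hi; omega
    simp [hx]

/-- A bucket occupies its length cell and at most `L` further cells. As `L < S`, buckets that begin
at multiples of `S` do not overlap. -/
theorem bucketP_spec (I : Arrays) (L K S : ℕ) (h2 : I 2 0 = L) (hk : ∀ i < L, I 0 i < K)
    (h1 : ∀ k < K, I 1 k = k * S) (hS : L < S) :
    Wp I bucketP 0 fun M' t =>
      (∀ k < K, Holds (M' 0) (k * S) ((bucket (I 0) L k).length :: bucket (I 0) L k)) ∧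
      t ≤ 2 + L * 5 := by
  rw [bucketP, zero_eq_mk 3]
  refine (Wp.for L (fun i M => ∃ R y, M = mk [R, sc i, sc y] ∧
    ∀ k < K, Holds R (k * S) ((bucket (I 0) i k).length :: bucket (I 0) i k))
    (fun _ => 4) ?_ ?_ ?_).mono ?_
  · rintro i hi _ ⟨R, y, rfl, -⟩; simp [h2]
  · refine ⟨0, 0, by simp [mk_update], fun k _ => ?_⟩
    simp [bucket, Holds]
  · rintro i hi _ ⟨R, y, rfl, hR⟩
    have hki := hk i hi
    have hb := h1 _ hki
    simp only [wp_seq, wp_set]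
    refine ⟨by omega, ?_⟩
    simp only [mk_update, List.length_cons, List.length_nil, Nat.lt_add_one, List.set_cons_zero,
      List.set_cons_succ, mk_zero, mk_succ, Expr.eval_ofNat, Expr.eval_inp, Expr.eval_mem,
      Expr.eval_add, sc_zero, update_sc]
    simp [mk_update, hb]
    refine ⟨_, ⟨_, rfl⟩, fun k hkK => ?_⟩
    obtain ⟨c0, c1⟩ := holds_cons.1 (hR _ hki)
    have hlen := bucket_length_le (I 0) i (I 0 i)
    rw [bucket_succ]
    by_cases hkk : I 0 i = k
    · subst hkk
      rw [if_pos rfl, holds_cons, c0]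
      refine ⟨?_, holds_append_singleton (c1.congr fun j hj => ?_) ?_⟩
      · rw [Function.update_of_ne (by omega)]; simp
      · rw [Function.update_of_ne (by omega), Function.update_of_ne (by omega)]
      · rw [add_assoc, add_comm 1]; simp
    · rw [if_neg hkk]
      have hlk := bucket_length_le (I 0) i k
      refine (hR k hkK).congr fun j hj => ?_
      simp only [List.length_cons] at hj
      rw [Function.update_of_ne, Function.update_of_ne]
      · have := mul_add_ne (S := S) (j := j) (j' := 0) (by omega) (by omega) (Ne.symm hkk)
        simpa using this
      · rw [c0]
        exact mul_add_ne (by omega) (by omega) (Ne.symm hkk)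
  · rintro M' t ⟨⟨R, y, rfl, hR⟩, ht⟩
    exact ⟨hR, by simpa using ht⟩

/-- The maximum of the values at the two ends of every edge. -/
def edgeKeyP : Prog :=
  .for 1 (.inp 2 0) (.set 2 0 (.inp 1 (.inp 0 (.mem 1 0 + .mem 1 0))) ;;
    .set 3 0 (.inp 1 (.inp 0 (.mem 1 0 + .mem 1 0 + 1))) ;;
    .set 0 (.mem 1 0) (.mem 2 0 + (.mem 3 0 - .mem 2 0)))

theorem edgeKeyP_spec (I : Arrays) (es : List (ℕ × ℕ)) (h0 : Holds (I 0) 0 (flat es))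
    (h2 : I 2 0 = es.length) :
    Wp I edgeKeyP 0 fun M' t => M' 0 = arr (es.map fun e => max (I 1 e.1) (I 1 e.2)) ∧
      t ≤ 2 + es.length * 5 := by
  rw [edgeKeyP, zero_eq_mk 4]
  have hL : (es.map fun e => max (I 1 e.1) (I 1 e.2)).length = es.length := by simp
  generalize hl : es.map (fun e => max (I 1 e.1) (I 1 e.2)) = l at *
  refine (Wp.for es.length (fun i M => ∃ y z, M = mk [arr (l.take i), sc i, sc y, sc z])
    (fun _ => 4) ?_ ?_ ?_).mono ?_
  · rintro i hi _ ⟨y, z, rfl⟩; simp [h2]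
  · exact ⟨0, 0, by simp [mk_update]⟩
  · rintro i hi _ ⟨y, z, rfl⟩
    obtain ⟨h3, h4⟩ := holds_flat h0 i hi
    rw [zero_add] at h3 h4
    simp only [wp_seq, wp_set]
    refine ⟨by omega, I 1 (es[i]).1, I 1 (es[i]).2, ?_⟩
    have hi' : i < l.length := by omega
    have hli : l[i] = I 1 (es[i]).1 + (I 1 (es[i]).2 - I 1 (es[i]).1) := by
      simp [← hl]; omega
    have hlen : i = (l.take i).length := by simp; omega
    simp [mk_update, h3, h4, take_succ_eq _ _ hi', -List.take_append_getElem, arr_push hlen, hli]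
  · rintro M' t ⟨⟨y, z, rfl⟩, ht⟩
    exact ⟨by simp [← hL], by simpa using ht⟩

/-- The weights of the subtrees, the weight of the node `t` being `I 2 (I 3 (t + 1))`. -/
def subP : Prog :=
  .for 1 (.inp 0 2) (.set 2 0 (.inp 0 2 - (.mem 1 0 + 1)) ;;
    .set 0 (.mem 2 0) (.mem 0 (.mem 2 0) + .inp 2 (.inp 3 (.mem 2 0 + 1))) ;;
    .ite (.mem 2 0) (.set 0 (.inp 1 (.mem 2 0))
      (.mem 0 (.inp 1 (.mem 2 0)) + .mem 0 (.mem 2 0))) .skip)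

/-- The sum of `S` over the children of `s` in the interval `[a, b)`. -/
def childSum (par S : ℕ → ℕ) (a b s : ℕ) : ℕ :=
  ∑ c ∈ (Finset.Ico a b).filter fun c => c ≠ 0 ∧ par c = s, S c

theorem childSum_congr {par S S' : ℕ → ℕ} {a b s : ℕ}
    (h : ∀ c, a ≤ c → c < b → S c = S' c) : childSum par S a b s = childSum par S' a b s := by
  refine Finset.sum_congr rfl fun c hc => ?_
  simp at hc
  exact h c hc.1.1 hc.1.2

theorem childSum_succ {par S : ℕ → ℕ} {b s : ℕ} :
    childSum par S 0 (b + 1) s =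
      childSum par S 0 b s + if b ≠ 0 ∧ par b = s then S b else 0 := by
  unfold childSum
  rw [Nat.Ico_zero_eq_range, Nat.Ico_zero_eq_range, Finset.range_add_one, Finset.filter_insert]
  split_ifs with h
  · rw [Finset.sum_insert (by simp), add_comm]
  · simp

theorem childSum_bot {par S : ℕ → ℕ} {a b s : ℕ} (hab : a < b) :
    childSum par S a b s =
      childSum par S (a + 1) b s + if a ≠ 0 ∧ par a = s then S a else 0 := by
  unfold childSum
  rw [← Finset.insert_Ico_add_one_left_eq_Ico hab, Finset.filter_insert]
  split_ifs with h
  · rw [Finset.sum_insert (by simp), add_comm]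
  · simp

/-- Nodes are treated in decreasing order. When a node has its turn, all its children have been
added to it, so its entry is final. -/
theorem subP_spec (I : Arrays) (N : ℕ) (hN : I 0 2 = N)
    (hp : ∀ t < N, t ≠ 0 → I 1 t < t) :
    Wp I subP 0 fun M' s =>
      (∀ t < N, M' 0 t = I 2 (I 3 (t + 1)) + childSum (I 1) (M' 0) 0 N t) ∧ s ≤ 2 + N * 6 := by
  rw [subP, zero_eq_mk 3]
  -- An untreated node holds the sum over its treated children, without its own weight.
  refine (Wp.for N (fun i M => ∃ R y, M = mk [R, sc i, sc y] ∧
    ∀ t < N, R t = (if N - i ≤ t then I 2 (I 3 (t + 1)) else 0) + childSum (I 1) R (N - i) N t)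
    (fun _ => 5) ?_ ?_ ?_).mono ?_
  · rintro i hi _ ⟨R, y, rfl, -⟩; simp [hN]
  · refine ⟨0, 0, by simp [mk_update], fun t ht => ?_⟩
    simp [childSum, ht]
  · rintro i hi _ ⟨R, y, rfl, hR⟩
    have hlt : N - (i + 1) < N := by omega
    have e1 : N - i = N - (i + 1) + 1 := by omega
    rw [e1] at hR
    simp only [wp_seq, wp_set, wp_ite]
    obtain ⟨u, hu⟩ : ∃ u, N - (i + 1) = u := ⟨_, rfl⟩
    rw [hu] at hR hlt e1 ⊢
    set R' := Function.update R u (R u + I 2 (I 3 (u + 1))) with hR'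
    -- Common to both branches: after the own weight of `u` has been added, the total is passed to
    -- the parent unless `u` is the root.
    have hstep : ∀ R'' : ℕ → ℕ, (∀ t < N, R'' t = R' t + if u ≠ 0 ∧ I 1 u = t then R' u else 0) →
        ∀ t < N, R'' t = (if u ≤ t then I 2 (I 3 (t + 1)) else 0) + childSum (I 1) R'' u N t := by
      intro R'' h t ht
      have hch : ∀ c, u ≤ c → c < N → R'' c = R' c := by
        intro c hc hcN
        rw [h c hcN, if_neg, add_zero]
        rintro ⟨hu0, rfl⟩
        exact absurd (hp u hlt hu0) (by omega)
      have hch' : ∀ c, u + 1 ≤ c → c < N → R'' c = R c := by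
        intro c hc hcN
        rw [hch c (by omega) hcN, hR', Function.update_of_ne (by omega)]
      rw [childSum_bot hlt, childSum_congr hch', hch u le_rfl hlt, h t ht, hR']
      rcases eq_or_ne t u with rfl | htu
      · rw [Function.update_self, hR t ht]; simp; omega
      · rw [Function.update_of_ne htu, hR t ht]
        have : u + 1 ≤ t ↔ u ≤ t := by omega
        simp only [this]
        omega
    by_cases hu0 : u = 0
    · simp [mk_update, hN, hu, hu0]
      refine ⟨R', ⟨0, by rw [hR', hu0]; simp⟩, ?_⟩
      simpa [hu0] using hstep R' fun t _ => by simp [hu0]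
    · simp [mk_update, hN, hu, hu0]
      refine ⟨_, ⟨_, rfl⟩, hstep _ fun t _ => ?_⟩
      rw [← hR', Function.update_apply]
      rcases eq_or_ne t (I 1 u) with rfl | h
      · simp [hu0, hR']
      · simp [h, h.symm]
  · rintro M' t ⟨⟨R, y, rfl, hR⟩, ht⟩
    refine ⟨fun t ht => by simpa using hR t ht, by simpa using ht⟩

/-- The first position of the block of every node, in the order in which the block of a node is
followed by the blocks of its children. -/
def startP : Prog :=
  .for 1 (.inp 0 2) (.ite (.mem 1 0)
      (.set 0 (.mem 1 0) (.mem 2 (.inp 1 (.mem 1 0))) ;;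
        .set 2 (.inp 1 (.mem 1 0)) (.mem 2 (.inp 1 (.mem 1 0)) + .inp 4 (.mem 1 0))) .skip ;;
    .set 2 (.mem 1 0) (.mem 0 (.mem 1 0) + .inp 2 (.inp 3 (.mem 1 0 + 1))))

theorem startP_spec (I : Arrays) (N : ℕ) (hN : I 0 2 = N)
    (hp : ∀ t < N, t ≠ 0 → I 1 t < t) :
    Wp I startP 0 fun M' s =>
      (M' 0 0 = 0 ∧ ∀ t < N, t ≠ 0 → M' 0 t = M' 0 (I 1 t) + I 2 (I 3 (I 1 t + 1)) +
        childSum (I 1) (I 4) 0 t (I 1 t)) ∧ s ≤ 2 + N * 6 := by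
  rw [startP, zero_eq_mk 3]
  -- The array `X` keeps for every placed node the first place that is not yet taken by its block or
  -- by its children so far.
  refine (Wp.for N (fun i M => ∃ R X, M = mk [R, sc i, X] ∧ (R 0 = 0 ∧ ∀ t < i, t ≠ 0 →
      R t = R (I 1 t) + I 2 (I 3 (I 1 t + 1)) + childSum (I 1) (I 4) 0 t (I 1 t)) ∧
      ∀ t < i, X t = R t + I 2 (I 3 (t + 1)) + childSum (I 1) (I 4) 0 i t)
    (fun _ => 5) ?_ ?_ ?_).mono ?_
  · rintro i hi _ ⟨R, X, rfl, -⟩; simp [hN]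
  · exact ⟨0, 0, by simp [mk_update], by simp, by simp⟩
  · rintro i hi _ ⟨R, X, rfl, ⟨h0, hR⟩, hX⟩
    -- No node numbered at most `i` is a child of `i`, since parents precede children.
    have hnil : childSum (I 1) (I 4) 0 (i + 1) i = 0 := by
      refine Finset.sum_eq_zero fun c hc => ?_
      simp at hc
      exact absurd (hp c (by omega) hc.2.1) (by omega)
    by_cases hi0 : i = 0
    · subst hi0
      simp [mk_update]
      refine ⟨_, _, rfl, h0, ?_⟩
      rw [hnil]; simp
    · simp [mk_update, hi0]
      have hpi := hp i hi hi0
      refine ⟨_, _, rfl, ⟨?_, ?_⟩, ?_⟩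
      · rw [Function.update_of_ne (by omega), h0]
      · intro t ht ht0
        have := hp t (by omega) ht0
        rw [Function.update_of_ne (a := I 1 t) (by omega)]
        rcases eq_or_ne t i with rfl | hti
        · rw [Function.update_self, hX _ hpi]
        · rw [Function.update_of_ne hti, hR t (by omega) ht0]
      · intro t ht
        rcases eq_or_ne t i with rfl | hti
        · rw [hnil]; simp
        · have h1 := hX t (by omega)
          rw [Function.update_of_ne hti, Function.update_of_ne hti, childSum_succ]
          rcases eq_or_ne (I 1 i) t with rfl | h
          · simp [hi0, h1]; omega
          · simp [h.symm, h, h1]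
  · rintro M' t ⟨⟨R, X, rfl, hR, -⟩, ht⟩
    exact ⟨hR, by simpa using ht⟩

/-- Puts the block of every node in its place. -/
def orderP : Prog :=
  .for 1 (.inp 0 2) (.for 2 (.inp 1 (.inp 2 (.mem 1 0 + 1)))
    (.set 0 (.inp 3 (.mem 1 0) + .mem 2 0) (.inp 1 (.inp 2 (.mem 1 0 + 1) + .mem 2 0 + 1))))

/-- Distinct places keep the blocks already written intact. In the application they are distinct by
a counting argument, `place_injective`. -/
theorem orderP_spec (I : Arrays) (N : ℕ) (w : ℕ → List ℕ) (hN : I 0 2 = N)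
    (hw : ∀ t < N, Holds (I 1) (I 2 (t + 1)) ((w t).length :: w t))
    (hinj : ∀ t < N, ∀ t' < N, ∀ j < (w t).length, ∀ j' < (w t').length,
      I 3 t + j = I 3 t' + j' → t = t' ∧ j = j') :
    Wp I orderP 0 fun M' s => (∀ t < N, Holds (M' 0) (I 3 t) (w t)) ∧
      s ≤ 2 + ∑ t ∈ Finset.range N, ((w t).length * 3 + 4) := by
  rw [orderP, zero_eq_mk 3]
  refine (Wp.for N (fun i M => ∃ R y, M = mk [R, sc i, sc y] ∧ ∀ t < i, Holds R (I 3 t) (w t))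
    (fun t => (w t).length * 3 + 3) ?_ ?_ ?_).mono ?_
  · rintro i hi _ ⟨R, y, rfl, -⟩; simp [hN]
  · exact ⟨0, 0, by simp [mk_update], by simp⟩
  · rintro i hi _ ⟨R, y, rfl, hR⟩
    obtain ⟨hl, hh⟩ := holds_cons.1 (hw i hi)
    rw [wp_seq]
    refine (Wp.for (w i).length (fun j M => ∃ R, M = mk [R, sc i, sc j] ∧
      (∀ t < i, Holds R (I 3 t) (w t)) ∧ Holds R (I 3 i) ((w i).take j))
      (fun _ => 2) ?_ ?_ ?_).mono ?_
    · rintro j hj _ ⟨R, rfl, -⟩; simp [hl]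
    · exact ⟨R, by simp [mk_update], hR, by simp [Holds]⟩
    · rintro j hj _ ⟨R, rfl, h1, h2⟩
      have := hh j hj
      rw [add_right_comm] at this
      simp [mk_update, this]
      refine ⟨_, rfl, fun t ht => (h1 t ht).congr fun k hk => ?_, ?_⟩
      · refine Function.update_of_ne (fun he => ?_) _ _
        have := (hinj t (by omega) i hi k hk j hj he).1
        omega
      · rw [take_succ_eq _ _ hj]
        refine holds_append_singleton (h2.congr fun k hk => ?_) ?_
        · refine Function.update_of_ne (fun he => ?_) _ _
          simp at hk; omega
        · simp [hj.le]
    · rintro M' t ⟨⟨R, rfl, h1, h2⟩, ht⟩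
      rw [wp_set]
      refine ⟨by simp at ht; omega, R, (w i).length, by simp [mk_update], fun t ht => ?_⟩
      rcases eq_or_ne t i with rfl | h
      · simpa using h2
      · exact h1 t (by omega)
  · rintro M' t ⟨⟨R, y, rfl, hR⟩, ht⟩
    exact ⟨hR, ht⟩

theorem sum_range_getD (l : List ℕ) (F : ℕ → ℕ) :
    ∑ i ∈ Finset.range l.length, F (l.getD i 0) = (l.map F).sum := by
  induction l with
  | nil => simp
  | cons x l ih => rw [List.length_cons, Finset.sum_range_succ']; simp at ih ⊢; rw [ih, add_comm]

/-- `6 (x + 1)`. -/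
def recPos (x : Expr) : Expr := (x + 1) + (x + 1) + ((x + 1) + (x + 1)) + ((x + 1) + (x + 1))

@[simp] theorem eval_recPos (I M : Arrays) (x : Expr) :
    Expr.eval I M (recPos x) = 6 * (x.eval I M + 1) := by
  simp [recPos]; omega

/-- The concatenation of lists that are described by records of six cells. -/
def gatherP : Prog :=
  .for 1 (.inp 1 0) (.set 2 0 (recPos (.inp 0 (.mem 1 0))) ;;
    .for 3 (.inp 2 (.mem 2 0)) (.set 4 0 (.mem 4 0 + 1) ;;
      .set 0 (.mem 4 0) (.inp 3 (.inp 2 (.mem 2 0 + 1) + .mem 3 0)))) ;;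
  .set 0 0 (.mem 4 0)

/-- Children are listed minus one, so the record of the listed child `j` begins at the cell `6 * (j
+ 1)`. -/
theorem gatherP_spec (I : Arrays) (cl : List ℕ) (dl : ℕ → List ℕ) (h0 : Holds (I 0) 0 cl)
    (h1 : I 1 0 = cl.length)
    (hd : ∀ j ∈ cl, I 2 (6 * (j + 1)) = (dl j).length ∧ Holds (I 3) (I 2 (6 * (j + 1) + 1)) (dl j)) :
    Wp I gatherP 0 fun M' t => M' 0 = arr ((cl.flatMap dl).length :: cl.flatMap dl) ∧
      t ≤ 3 + cl.length * 5 + (cl.flatMap dl).length * 4 := by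
  rw [gatherP, zero_eq_mk 5]
  simp only [wp_seq, wp_set]
  refine (Wp.for cl.length (fun i M => ∃ y z, M = mk [arr (0 :: (cl.take i).flatMap dl), sc i,
    sc y, sc z, sc ((cl.take i).flatMap dl).length]) (fun i => 4 + (dl (cl.getD i 0)).length * 4)
    ?_ ?_ ?_).mono ?_
  · rintro i hi _ ⟨y, z, rfl⟩; simp [h1]
  · exact ⟨0, 0, by simp [mk_update]⟩
  · rintro i hi _ ⟨y, z, rfl⟩
    have h := h0 i hi
    obtain ⟨hd1, hd2⟩ := hd _ (List.getElem_mem hi)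
    simp only [wp_seq, wp_set]
    simp only [zero_add] at h
    simp [mk_update, h, -List.length_flatMap]
    have hg : cl[i]?.getD 0 = cl[i] := by simp [hi]
    refine (Wp.for_eq (dl cl[i]).length (fun j => mk [arr (0 :: ((cl.take i).flatMap dl ++
      (dl cl[i]).take j)), sc i, sc (6 * (cl[i] + 1)), sc j,
      sc ((cl.take i).flatMap dl ++ (dl cl[i]).take j).length]) (fun _ => 3) ?_ ?_ ?_).mono ?_
    · simp [hd1]
    · simp [mk_update, -List.length_flatMap]
    · intro j hj
      have := hd2 j hj
      simp [mk_update, this, take_succ_eq _ _ hj, -List.take_append_getElem, -List.length_flatMap]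
      rw [arr_push (by simp), add_assoc]; simp
    · rintro M' t ⟨rfl, ht⟩
      simp at ht
      refine ⟨by simp only [hg]; omega, 6 * (cl[i] + 1), (dl cl[i]).length, ?_⟩
      simp [mk_update, take_succ_eq _ _ hi, -List.take_append_getElem, -List.length_flatMap]
  · rintro M' t ⟨⟨y, z, rfl⟩, ht⟩
    have := sum_range_getD cl fun x => (dl x).length
    rw [← List.length_flatMap] at this
    simp only [List.getD_eq_getElem?_getD] at this
    simp [Finset.sum_add_distrib, ← Finset.sum_mul] at ht
    rw [this] at ht
    simp only [arr_cons_update, mk_update, mk_zero, List.length_cons, List.length_nil,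
      Expr.eval_ofNat, Expr.eval_mem, mk_succ, sc_zero, Nat.zero_lt_succ, List.set_cons_zero,
      List.take_length, true_and]
    omega

/-- Copies records. -/
def recordsP : Prog :=
  .for 1 (.inp 1 0) (.set 2 0 (recPos (.inp 0 (.mem 1 0))) ;; .set 3 0 (recPos (.mem 1 0) - 6) ;;
    .set 0 (.mem 3 0) (.inp 2 (.mem 2 0)) ;; .set 0 (.mem 3 0 + 1) (.inp 2 (.mem 2 0 + 1)) ;;
    .set 0 (.mem 3 0 + 2) (.inp 2 (.mem 2 0 + 2)) ;;
    .set 0 (.mem 3 0 + 3) (.inp 2 (.mem 2 0 + 3)) ;;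
    .set 0 (.mem 3 0 + 4) (.inp 2 (.mem 2 0 + 4)) ;;
    .set 0 (.mem 3 0 + 5) (.inp 2 (.mem 2 0 + 5)))

/-- The reduction expects consecutive records. Only the pointers are copied, so the cost per child
is constant. -/
theorem recordsP_spec (I : Arrays) (cl : List ℕ) (h0 : Holds (I 0) 0 cl)
    (h1 : I 1 0 = cl.length) :
    Wp I recordsP 0 fun M' t => (∀ (i : ℕ) (h : i < cl.length), ∀ k < 6,
        M' 0 (6 * i + k) = I 2 (6 * (cl[i] + 1) + k)) ∧ t ≤ 2 + cl.length * 10 := by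
  rw [recordsP, zero_eq_mk 4]
  refine (Wp.for cl.length (fun i M => ∃ R y z, M = mk [R, sc i, sc y, sc z] ∧
    ∀ (j : ℕ) (h : j < cl.length), j < i → ∀ k < 6, R (6 * j + k) = I 2 (6 * (cl[j] + 1) + k))
    (fun _ => 9) ?_ ?_ ?_).mono ?_
  · rintro i hi _ ⟨R, y, z, rfl, -⟩; simp [h1]
  · exact ⟨0, 0, 0, by simp [mk_update], by simp⟩
  · rintro i hi _ ⟨R, y, z, rfl, hR⟩
    have h := h0 i hi
    simp only [zero_add] at h
    have e : 6 * (i + 1) - 6 = 6 * i := by omega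
    simp [mk_update, h, e]
    refine ⟨_, ⟨_, _, rfl⟩, fun j hj hji k hk => ?_⟩
    simp only [Function.update_apply]
    rcases eq_or_ne j i with rfl | hne
    · interval_cases k <;> simp
    · have : ∀ x < 6, 6 * j + k ≠ 6 * i + x := by omega
      have h6 : 6 * j + k ≠ 6 * i := by omega
      simp [this, h6]
      exact hR j hj (by omega) k hk
  · rintro M' t ⟨⟨R, y, z, rfl, hR⟩, ht⟩
    exact ⟨fun i h k hk => hR i h h k hk, by simpa using ht⟩

/-- The edges among the vertices of a list, according to an adjacency matrix. -/
def innerEdges (row adj : ℕ → ℕ) (l : List ℕ) (k : ℕ) : List (ℕ × ℕ) :=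
  (List.range k).flatMap fun i =>
    ((l.take i).filter fun v => adj (row (l.getD i 0) + v) ≠ 0).map (l.getD i 0, ·)

/-- The edges with the given indices, and the edges among the vertices of a list. -/
def bagEdgesP : Prog :=
  .for 1 (.inp 1 0) (
    .set 0 (.mem 3 0 + .mem 3 0 + 1) (.inp 0 (.inp 1 (.mem 1 0 + 1) + .inp 1 (.mem 1 0 + 1))) ;;
    .set 0 (.mem 3 0 + .mem 3 0 + 2) (.inp 0 (.inp 1 (.mem 1 0 + 1) + .inp 1 (.mem 1 0 + 1) + 1)) ;;
    .set 3 0 (.mem 3 0 + 1)) ;;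
  .for 1 (.inp 2 0) (.for 2 (.mem 1 0)
    (.ite (.inp 3 (.inp 4 (.inp 2 (.mem 1 0 + 1)) + .inp 2 (.mem 2 0 + 1)))
      (.set 0 (.mem 3 0 + .mem 3 0 + 1) (.inp 2 (.mem 1 0 + 1)) ;;
        .set 0 (.mem 3 0 + .mem 3 0 + 2) (.inp 2 (.mem 2 0 + 1)) ;;
        .set 3 0 (.mem 3 0 + 1)) .skip)) ;;
  .set 0 0 (.mem 3 0)

theorem arr_push_edge (x : ℕ) (l : List (ℕ × ℕ)) (k u v : ℕ) (hk : k = l.length) :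
    Function.update (Function.update (arr (x :: flat l)) (k + k + 1) u) (k + k + 2) v =
      arr (x :: flat (l ++ [(u, v)])) := by
  subst hk
  rw [arr_push (by simp), arr_push (by simp)]
  simp

/-- Edges among old vertices are not new at this node. They are recovered by testing all pairs in
`dl` in the adjacency matrix, which accounts for the quadratic term. -/
theorem bagEdgesP_spec (I : Arrays) (es : List (ℕ × ℕ)) (ow dl : List ℕ)
    (h0 : Holds (I 0) 0 (flat es)) (h1 : Holds (I 1) 0 (ow.length :: ow))
    (how : ∀ e ∈ ow, e < es.length) (h2 : Holds (I 2) 0 (dl.length :: dl)) :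
    Wp I bagEdgesP 0 fun M' t =>
      (∃ eb, eb = ow.map (fun e => es.getD e (0, 0)) ++ innerEdges (I 4) (I 3) dl dl.length ∧
        M' 0 = arr (eb.length :: flat eb)) ∧
      t ≤ 5 + ow.length * 5 + dl.length * (dl.length * 6 + 4) := by
  obtain ⟨h10, h11⟩ := holds_cons.1 h1
  obtain ⟨h20, h21⟩ := holds_cons.1 h2
  rw [bagEdgesP, zero_eq_mk 4]
  simp only [wp_seq, wp_set]
  refine (Wp.for_eq ow.length (fun i => mk [arr (0 :: flat ((ow.take i).map
    fun e => es.getD e (0, 0))), sc i, 0, sc i]) (fun _ => 4) ?_ ?_ ?_).mono ?_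
  · simp [h10]
  · simp [mk_update]
  · intro i hi
    have h := h11 i hi
    rw [zero_add, add_comm] at h
    have he := how _ (List.getElem_mem hi)
    obtain ⟨h3, h4⟩ := holds_flat h0 _ he
    rw [zero_add] at h3 h4
    simp only [wp_seq, wp_set]
    simp [mk_update, h, h3, h4, take_succ_eq _ _ hi, -List.take_append_getElem, -List.map_take]
    rw [arr_push_edge _ _ _ _ _ (by simp; omega)]
    simp [he]
  rintro M' t ⟨rfl, ht⟩
  set L := ow.map (fun e => es.getD e (0, 0)) with hL
  have hLl : L.length = ow.length := by simp [hL]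
  refine (Wp.for dl.length (fun i M => ∃ y, M = mk [arr (0 :: flat (L ++ innerEdges (I 4) (I 3) dl i)),
    sc i, sc y, sc (L ++ innerEdges (I 4) (I 3) dl i).length]) (fun i => 3 + dl.length * 6)
    ?_ ?_ ?_).mono ?_
  · rintro i hi _ ⟨y, rfl⟩; simp [h20]
  · refine ⟨0, ?_⟩
    simp [mk_update, innerEdges, hLl, -List.map_take]
    simp [hL]
  · rintro i hi _ ⟨y, rfl⟩
    have hgi : I 2 (i + 1) = dl[i] := by rw [add_comm]; simpa using h21 i hi
    set L' := L ++ innerEdges (I 4) (I 3) dl i with hL'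
    rw [wp_seq]
    refine (Wp.for_eq i (fun j => mk [arr (0 :: flat (L' ++ ((dl.take j).filter
      fun v => I 3 (I 4 dl[i] + v) ≠ 0).map (dl[i], ·))), sc i, sc j,
      sc (L' ++ ((dl.take j).filter fun v => I 3 (I 4 dl[i] + v) ≠ 0).map (dl[i], ·)).length])
      (fun _ => 5) ?_ ?_ ?_).mono ?_
    · simp
    · simp [mk_update]
    · intro j hj
      have hgj : I 2 (j + 1) = dl[j] := by rw [add_comm]; simpa using h21 j (by omega)
      by_cases hz : I 3 (I 4 dl[i] + dl[j]) = 0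
      · simp [mk_update, hgi, hgj, hz, take_succ_eq _ _ (hj.trans hi), -List.take_append_getElem]
      · simp only [wp_seq, wp_ite, wp_set]
        simp [mk_update, hgi, hgj, hz, take_succ_eq _ _ (hj.trans hi), -List.take_append_getElem]
        rw [← flat_append, arr_push_edge _ _ _ _ _ (by simp)]
        simp [add_assoc]
    · rintro M' t ⟨rfl, ht⟩
      rw [wp_set]
      simp at ht
      refine ⟨?_, i, ?_⟩
      · have : i * 6 ≤ dl.length * 6 := by omega
        omega
      · simp [mk_update, hL', innerEdges, List.range_succ, hi, ← add_assoc]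
  · rintro M' t' ⟨⟨y, rfl⟩, ht'⟩
    simp only [arr_cons_update, mk_update, mk_zero, List.length_cons, List.length_nil,
      Expr.eval_ofNat, Expr.eval_mem, mk_succ, sc_zero, Nat.zero_lt_succ, List.set_cons_zero]
    refine ⟨⟨_, rfl, rfl⟩, ?_⟩
    simp at ht ht'
    rw [show 3 + dl.length * 6 + 1 = dl.length * 6 + 4 by ring] at ht'
    omega

/-- `p * x`. -/
def scaleExpr : ℕ → Expr → Expr
  | 0, _ => 0
  | p + 1, x => scaleExpr p x + x

@[simp] theorem eval_scaleExpr (I M : Arrays) (p : ℕ) (x : Expr) :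
    Expr.eval I M (scaleExpr p x) = p * x.eval I M := by
  induction p with
  | zero => simp [scaleExpr]
  | succ p ih => simp [scaleExpr, ih, add_mul]

/-- A power of `p`. -/
def powP (p : ℕ) : Prog := .set 0 0 1 ;; .for 1 (.inp 0 0) (.set 0 0 (scaleExpr p (.mem 0 0)))

theorem powP_spec (I : Arrays) (p a : ℕ) (h0 : I 0 0 = a) :
    Wp I (powP p) 0 fun M' t => M' 0 = sc (p ^ a) ∧ t ≤ 3 + a * 3 := by
  rw [powP, zero_eq_mk 2]
  simp only [wp_seq, wp_set]
  refine (Wp.for_eq a (fun i => mk [sc (p ^ i), sc i]) (fun _ => 2) ?_ ?_ ?_).mono ?_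
  · simp [h0]
  · simp [mk_update]
  · intro i hi
    simp [mk_update, pow_succ, mul_comm]
  · rintro M' t ⟨rfl, ht⟩
    simp at ht
    exact ⟨rfl, by omega⟩

/-- A list of vertices, each followed by the colour `0`. -/
def initColoursP : Prog := .for 1 (.inp 1 0) (.set 0 (.mem 1 0 + .mem 1 0) (.inp 0 (.mem 1 0)))

theorem initColoursP_spec (I : Arrays) (l : List ℕ) (h0 : Holds (I 0) 0 l)
    (h1 : I 1 0 = l.length) :
    Wp I initColoursP 0 fun M' t =>
      (∀ (j : ℕ) (h : j < l.length), M' 0 (j + j) = l[j] ∧ M' 0 (j + j + 1) = 0) ∧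
      t ≤ 2 + l.length * 3 := by
  rw [initColoursP, zero_eq_mk 2]
  refine (Wp.for l.length (fun i M => ∃ R, M = mk [R, sc i] ∧ (∀ j, R (j + j + 1) = 0) ∧
    ∀ (j : ℕ) (h : j < l.length), j < i → R (j + j) = l[j]) (fun _ => 2) ?_ ?_ ?_).mono ?_
  · rintro i hi _ ⟨R, rfl, -⟩; simp [h1]
  · exact ⟨0, by simp [mk_update], by simp⟩
  · rintro i hi _ ⟨R, rfl, h, hR⟩
    have := h0 i hi
    simp only [zero_add] at this
    simp [mk_update, this]
    refine ⟨_, rfl, fun j => ?_, fun j hj hji => ?_⟩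
    · rw [Function.update_of_ne (by omega), h]
    · rcases eq_or_ne j i with rfl | hne
      · simp
      · rw [Function.update_of_ne (by omega), hR j hj (by omega)]
  · rintro M' t ⟨⟨R, rfl, h, hR⟩, ht⟩
    exact ⟨fun j hj => ⟨hR j hj hj, h j⟩, by simpa using ht⟩

/-- Increments a number that is given by its digits. -/
def incrementP (p : ℕ) : Prog :=
  .for 1 (.inp 1 0) (.set 0 (.mem 1 0 + .mem 1 0) (.inp 0 (.mem 1 0 + .mem 1 0)) ;;
    .ite (.mem 2 0) (.set 0 (.mem 1 0 + .mem 1 0 + 1) (.inp 0 (.mem 1 0 + .mem 1 0 + 1)))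
      (.ite (.lit p - (.inp 0 (.mem 1 0 + .mem 1 0 + 1) + 1))
        (.set 0 (.mem 1 0 + .mem 1 0 + 1) (.inp 0 (.mem 1 0 + .mem 1 0 + 1) + 1) ;; .set 2 0 1)
        (.set 0 (.mem 1 0 + .mem 1 0 + 1) 0)))

/-- The carry of `c + 1` reaches the digit `j` iff all lower digits wrap around, that is, iff `p ^ j
∣ c + 1`. -/
theorem digit_succ (p c j : ℕ) (hp : 1 ≤ p) : (c + 1) / p ^ j % p =
    if p ^ j ∣ c + 1 then (if c / p ^ j % p + 1 < p then c / p ^ j % p + 1 else 0)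
    else c / p ^ j % p := by
  rw [Nat.succ_div]
  split_ifs with h1 h2
  · rw [Nat.add_mod]
    rcases Nat.lt_or_ge 1 p with h | h
    · rw [Nat.mod_eq_of_lt h, Nat.mod_eq_of_lt h2]
    · omega
  · have := Nat.mod_lt (c / p ^ j) hp
    rw [Nat.add_mod]
    rcases Nat.lt_or_ge 1 p with h | h
    · rw [Nat.mod_eq_of_lt h, show c / p ^ j % p + 1 = p by omega, Nat.mod_self]
    · obtain rfl : p = 1 := by omega
      simp [Nat.mod_one]
  · simp

/-- A carry passes through the digit `j` iff it arrives there and the digit is `p - 1`. -/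
theorem pow_succ_dvd_iff (p c j : ℕ) (hp : 1 ≤ p) : p ^ (j + 1) ∣ c + 1 ↔
    p ^ j ∣ c + 1 ∧ ¬ c / p ^ j % p + 1 < p := by
  have hpos : 0 < p ^ j := by positivity
  by_cases h : p ^ j ∣ c + 1
  · obtain ⟨q, hq⟩ := h
    have hd := digit_succ p c j hp
    rw [if_pos ⟨q, hq⟩, hq, Nat.mul_div_cancel_left _ hpos] at hd
    have : p ^ (j + 1) ∣ c + 1 ↔ q % p = 0 := by
      rw [hq, pow_succ, Nat.mul_dvd_mul_iff_left hpos, Nat.dvd_iff_mod_eq_zero]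
    rw [this, hd]
    simp only [hq, dvd_mul_right, true_and]
    split_ifs with h2 <;> simp [h2]
  · simp only [h, false_and, iff_false]
    exact fun h' => h ((pow_dvd_pow p (Nat.le_succ j)).trans h')

theorem incrementP_spec (I : Arrays) (p c : ℕ) (hp : 1 ≤ p) (l : List ℕ)
    (h0 : ∀ (j : ℕ) (h : j < l.length), I 0 (j + j) = l[j] ∧ I 0 (j + j + 1) = c / p ^ j % p)
    (h1 : I 1 0 = l.length) :
    Wp I (incrementP p) 0 fun M' t => (∀ (j : ℕ) (h : j < l.length), M' 0 (j + j) = l[j] ∧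
        M' 0 (j + j + 1) = (c + 1) / p ^ j % p) ∧ t ≤ 2 + l.length * 7 := by
  rw [incrementP, zero_eq_mk 3]
  -- The flag `y` is zero as long as a carry is pending.
  refine (Wp.for l.length (fun i M => ∃ R y, M = mk [R, sc i, sc y] ∧ (y = 0 ↔ p ^ i ∣ c + 1) ∧
    (∀ (j : ℕ) (h : j < l.length), j < i → R (j + j) = l[j] ∧
      R (j + j + 1) = (c + 1) / p ^ j % p)) (fun _ => 6) ?_ ?_ ?_).mono ?_
  · rintro i hi _ ⟨R, y, rfl, -⟩; simp [h1]
  · exact ⟨0, 0, by simp [mk_update], by simp⟩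
  · rintro i hi _ ⟨R, y, rfl, hy, hR⟩
    obtain ⟨e1, e2⟩ := h0 i hi
    have hfin : ∀ R' : ℕ → ℕ, R' = Function.update (Function.update R (i + i) l[i]) (i + i + 1)
        ((c + 1) / p ^ i % p) → ∀ (j : ℕ) (h : j < l.length), j < i + 1 → R' (j + j) = l[j] ∧
        R' (j + j + 1) = (c + 1) / p ^ j % p := by
      rintro R' rfl j hj hji
      rcases eq_or_ne j i with rfl | hne
      · constructor
        · rw [Function.update_of_ne (by omega), Function.update_self]
        · rw [Function.update_self]
      · rw [Function.update_of_ne (by omega), Function.update_of_ne (by omega),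
          Function.update_of_ne (by omega), Function.update_of_ne (by omega)]
        exact hR j hj (by omega)
    have hd := digit_succ p c i hp
    have hdv := pow_succ_dvd_iff p c i hp
    have hmod := Nat.mod_lt (c / p ^ i) hp
    by_cases hy0 : y = 0
    · subst hy0
      have hdi := hy.1 rfl
      rw [if_pos hdi] at hd
      by_cases hlt : c / p ^ i % p + 1 < p
      · have : p - (c / p ^ i % p + 1) ≠ 0 := by omega
        simp [mk_update, e1, e2, this]
        rw [if_pos hlt] at hd
        refine ⟨_, 1, rfl, by simp [hdv, hlt], ?_⟩
        simpa [hd] using hfin _ rfl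
      · have : p - (c / p ^ i % p + 1) = 0 := by omega
        simp [mk_update, e1, e2, this]
        rw [if_neg hlt] at hd
        refine ⟨_, 0, by simp; rfl, by simp [hdv, hlt, hdi], ?_⟩
        simpa [hd] using hfin _ rfl
    · have hdi : ¬ p ^ i ∣ c + 1 := fun h => hy0 (hy.2 h)
      rw [if_neg hdi] at hd
      simp [mk_update, e1, e2, hy0]
      refine ⟨_, y, rfl, by simp [hdv, hdi, hy0], ?_⟩
      simpa [hd] using hfin _ rfl
  · rintro M' t ⟨⟨R, y, rfl, -, hR⟩, ht⟩
    exact ⟨fun j hj => hR j hj hj, by simpa using ht⟩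

/-! ## Renaming -/

/-- The complements of the two finite sets are countably infinite, so a bijection between the sets
extends. This is needed because invariance is stated for permutations of `ℕ`. -/
theorem exists_equiv_extending (s : Finset ℕ) (φ : ℕ → ℕ) (h : Set.InjOn φ s) :
    ∃ π : ℕ ≃ ℕ, ∀ v ∈ s, π v = φ v := by
  classical
  have h1 : (s : Set ℕ)ᶜ.Infinite := s.finite_toSet.infinite_compl
  have h2 : (φ '' s)ᶜ.Infinite := (s.finite_toSet.image φ).infinite_compl
  have := h1.to_subtype
  have := h2.to_subtype
  obtain ⟨e₂⟩ := nonempty_equiv_of_countable (α := ((s : Set ℕ)ᶜ : Set ℕ)) (β := ((φ '' s)ᶜ : Set ℕ))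
  let e₁ := Equiv.Set.imageOfInjOn φ s h
  refine ⟨(Equiv.Set.sumCompl (s : Set ℕ)).symm.trans
    ((e₁.sumCongr e₂).trans (Equiv.Set.sumCompl (φ '' (s : Set ℕ)))), fun v hv => ?_⟩
  have hv' : v ∈ (s : Set ℕ) := hv
  simp [Equiv.Set.sumCompl_symm_apply_of_mem hv', e₁]
  rfl

theorem IsPPartition.image {p : ℕ} {P : Fin p → Finset ℕ} {X : Finset ℕ} (h : IsPPartition P X)
    (π : ℕ ≃ ℕ) : IsPPartition (fun i => (P i).image π) (X.image π) := by
  refine ⟨fun i j hij => (Finset.disjoint_image π.injective).2 (h.1 hij), ?_⟩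
  rw [← h.2, dom, dom, Finset.biUnion_image]

theorem dom_image {p : ℕ} (P : Fin p → Finset ℕ) (π : ℕ ≃ ℕ) :
    dom (fun i => (P i).image π) = (dom P).image π := by
  rw [dom, dom, Finset.biUnion_image]

theorem FinGraph.rename_symm_rename (G : FinGraph) (π : ℕ ≃ ℕ) :
    (G.rename π).rename π.symm = G := by
  ext x
  · simp [FinGraph.rename]
  · simp [FinGraph.rename, Sym2.map_map]

theorem mem_dom {p : ℕ} {P : Fin p → Finset ℕ} {v : ℕ} : v ∈ dom P ↔ ∃ i, v ∈ P i := by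
  simp [dom]

/-! ## Optimal values -/

/-- The optimum of a set of values. -/
noncomputable def optOver : Opt → Set ℕ∞ → ℕ∞
  | .min, S => sInf S
  | .max, S => sSup S

/-- The better of two values. -/
noncomputable def better : Opt → ℕ∞ → ℕ∞ → ℕ∞
  | .min, x, y => min x y
  | .max, x, y => max x y

theorem optOver_insert (opt : Opt) (x : ℕ∞) (S : Set ℕ∞) :
    optOver opt (insert x S) = better opt (optOver opt S) x := by
  cases opt
  · exact sInf_insert.trans (min_comm _ _)
  · exact sSup_insert.trans (max_comm _ _)

/-- An optimum in a complete lattice may be taken class by class, whether or not a class is empty.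
-/
theorem optOver_biUnion {ι : Type*} (opt : Opt) (C : Set ι) (S : ι → Set ℕ∞) :
    optOver opt (⋃ c ∈ C, S c) = optOver opt ((fun c => optOver opt (S c)) '' C) := by
  cases opt
  · simp only [optOver, sInf_eq_iInf, iInf_iUnion, iInf_image]
  · simp only [optOver, sSup_iUnion, sSup_image]

section

variable {p : ℕ} (g : PartitionEval p) (opt : Opt)

theorem annOptValue_eq (G : FinGraph) (𝒳 : Fin p → Finset ℕ) : annOptValue g opt G 𝒳 =
    optOver opt (g.val G '' {P | IsPPartition P G.verts ∧ ∀ i, 𝒳 i ⊆ P i}) := by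
  cases opt
  · exact sInf_image.symm
  · exact sSup_image.symm

theorem optValue_eq (G : FinGraph) : optValue g opt G = annOptValue g opt G fun _ => ∅ := by
  cases opt <;> simp [optValue, annOptValue]

/-- Taking images under `π` and `π⁻¹` matches the admissible partitions of the two graphs. -/
theorem annOptValue_rename (G : FinGraph) (𝒳 : Fin p → Finset ℕ) (π : ℕ ≃ ℕ) :
    annOptValue g opt (G.rename π) (fun i => (𝒳 i).image π) = annOptValue g opt G 𝒳 := by
  rw [annOptValue_eq, annOptValue_eq]
  congr 1
  ext x
  constructor
  · rintro ⟨P, ⟨hP, hX⟩, rfl⟩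
    have hP' := hP.image π.symm
    rw [show (G.rename π).verts.image π.symm = G.verts from
      congrArg FinGraph.verts (G.rename_symm_rename π)] at hP'
    refine ⟨_, ⟨hP', fun i v hv => ?_⟩, ?_⟩
    · exact Finset.mem_image.2 ⟨π v, hX i (Finset.mem_image_of_mem _ hv), by simp⟩
    · have := g.iso _ _ hP' π
      rw [← this]
      congr 1
      funext i
      simp [Finset.image_image]
  · rintro ⟨P, ⟨hP, hX⟩, rfl⟩
    exact ⟨_, ⟨hP.image π, fun i => Finset.image_subset_image (hX i)⟩, g.iso _ _ hP π⟩

theorem colourClasses_congr {φ ψ : ℕ → Fin p} {X : Finset ℕ} (h : ∀ v ∈ X, φ v = ψ v) :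
    colourClasses φ X = colourClasses ψ X := by
  funext i
  exact Finset.filter_congr fun v hv => by rw [h v hv]

theorem colourClasses_isPPartition (φ : ℕ → Fin p) (X : Finset ℕ) :
    IsPPartition (colourClasses φ X) X := by
  refine ⟨fun i j hij => Finset.disjoint_left.2 fun v h1 h2 => hij ?_, ?_⟩
  · simp only [colourClasses, Finset.mem_filter] at h1 h2
    exact h1.2.symm.trans h2.2
  · ext v; simp [dom, colourClasses]

/-- Sort the partitions that extend the colouring of `D` by the colouring they induce on `A`. -/
theorem annOptValue_split (G : FinGraph) {D A : Finset ℕ} (hDA : D ⊆ A) (hA : A ⊆ G.verts)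
    (φ : ℕ → Fin p) : annOptValue g opt G (colourClasses φ D) =
      optOver opt ((fun ψ => annOptValue g opt G (colourClasses ψ A)) ''
        {ψ | ∀ v ∈ D, ψ v = φ v}) := by
  classical
  simp only [annOptValue_eq g opt G]
  rw [← optOver_biUnion]
  congr 1
  ext x
  simp only [Set.mem_image, Set.mem_ofPred_eq, Set.mem_iUnion, exists_prop]
  constructor
  · rintro ⟨P, ⟨hP, hX⟩, rfl⟩
    have huniq : ∀ v i j, v ∈ P i → v ∈ P j → i = j := fun v i j hi hj => by
      by_contra hij
      exact Finset.disjoint_left.1 (hP.1 hij) hi hj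
    -- The value outside all parts is irrelevant; it only makes `ψ` total.
    let ψ : ℕ → Fin p := fun v => if h : ∃ i, v ∈ P i then h.choose else φ v
    have hψ : ∀ v i, v ∈ P i → ψ v = i := fun v i hi => by
      have h : ∃ i, v ∈ P i := ⟨i, hi⟩
      simp only [ψ, dif_pos h]
      exact huniq v _ _ h.choose_spec hi
    refine ⟨ψ, fun v hv => hψ v _ (hX _ ?_), P, ⟨hP, fun i v hv => ?_⟩, rfl⟩
    · simp [colourClasses, hv]
    · simp only [colourClasses, Finset.mem_filter] at hv
      have hvG := hA hv.1
      rw [← hP.2, mem_dom] at hvG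
      obtain ⟨j, hj⟩ := hvG
      rw [← hv.2, hψ v j hj]
      exact hj
  · rintro ⟨ψ, hψ, P, ⟨hP, hX⟩, rfl⟩
    refine ⟨P, ⟨hP, fun i v hv => hX i ?_⟩, rfl⟩
    simp only [colourClasses, Finset.mem_filter] at hv ⊢
    exact ⟨hDA hv.1, (hψ v hv.1).trans hv.2⟩

end

/-! ## Colourings as numbers -/

theorem ofDigits_lt {p : ℕ} (l : List ℕ) (h : ∀ d ∈ l, d < p) :
    Nat.ofDigits p l < p ^ l.length := by
  induction l with
  | nil => simp
  | cons d l ih =>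
    have h1 := ih fun x hx => h x (by simp [hx])
    have h2 := h d (by simp)
    rw [Nat.ofDigits_cons, List.length_cons, pow_succ]
    calc d + p * Nat.ofDigits p l < p + p * Nat.ofDigits p l := by omega
      _ = p * (Nat.ofDigits p l + 1) := by ring
      _ ≤ p * p ^ l.length := Nat.mul_le_mul_left _ h1
      _ = _ := mul_comm _ _

theorem ofDigits_digit {p : ℕ} (l : List ℕ) (h : ∀ d ∈ l, d < p) (j : ℕ) (hj : j < l.length) :
    Nat.ofDigits p l / p ^ j % p = l[j] := by
  induction l generalizing j with
  | nil => simp at hj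
  | cons d l ih =>
    have h2 := h d (by simp)
    cases j with
    | zero => simp [Nat.ofDigits_cons, Nat.mod_eq_of_lt h2]
    | succ j =>
      rw [Nat.ofDigits_cons, pow_succ', ← Nat.div_div_eq_div_mul, Nat.add_mul_div_left _ _ (by omega),
        Nat.div_eq_of_lt h2, zero_add]
      simpa using ih (fun x hx => h x (by simp [hx])) j (by simpa using hj)

/-- The colouring of the vertices in a list with a given number. -/
def colour {p : ℕ} (hp : 1 ≤ p) (A : List ℕ) (c : ℕ) : ℕ → Fin p := fun v =>
  ⟨c / p ^ A.idxOf v % p, Nat.mod_lt _ hp⟩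

theorem colour_get {p : ℕ} (hp : 1 ≤ p) {A : List ℕ} (hA : A.Nodup) (c j : ℕ) (hj : j < A.length) :
    (colour hp A c A[j]).val = c / p ^ j % p := by
  simp [colour, hA.idxOf_getElem]

theorem colour_ofDigits {p : ℕ} (hp : 1 ≤ p) (A : List ℕ) (ψ : ℕ → Fin p) (v : ℕ) (hv : v ∈ A) :
    colour hp A (Nat.ofDigits p (A.map fun v => (ψ v).val)) v = ψ v := by
  ext
  have hj := List.idxOf_lt_length_iff.2 hv
  simp only [colour]
  rw [ofDigits_digit _ (by simp) _ (by simpa using hj)]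
  simp

/-- The least significant digits come first, and `δ` precedes `A'`. Hence the colouring of `δ` is
the residue of the number modulo `p ^ |δ|`, and `annOptValue_split` applies. -/
theorem table_entry {p : ℕ} (hp : 1 ≤ p) (g : PartitionEval p) (opt : Opt) (G : FinGraph)
    (δ A' : List ℕ) (hA : (δ ++ A').toFinset ⊆ G.verts)
    (φ : ℕ → Fin p) :
    annOptValue g opt G (colourClasses φ δ.toFinset) =
      optOver opt ((fun c => annOptValue g opt G
        (colourClasses (colour hp (δ ++ A') c) (δ ++ A').toFinset)) ''
        {c | c < p ^ (δ ++ A').length ∧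
          c % p ^ δ.length = Nat.ofDigits p (δ.map fun v => (φ v).val)}) := by
  rw [annOptValue_split g opt G (A := (δ ++ A').toFinset) (by intro v; simp; tauto) hA φ]
  congr 1
  ext x
  simp only [Set.mem_image, Set.mem_ofPred_eq]
  constructor
  · rintro ⟨ψ, hψ, rfl⟩
    refine ⟨Nat.ofDigits p ((δ ++ A').map fun v => (ψ v).val), ⟨?_, ?_⟩, ?_⟩
    · simpa using ofDigits_lt ((δ ++ A').map fun v => (ψ v).val) (by
        intro d hd; obtain ⟨v, -, rfl⟩ := List.mem_map.1 hd; exact (ψ v).2)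
    · have : (δ.map fun v => (φ v).val) = δ.map fun v => (ψ v).val :=
        List.map_congr_left fun v hv => by rw [hψ v (by simpa using hv)]
      rw [this, List.map_append, Nat.ofDigits_append, List.length_map, Nat.add_mul_mod_self_left,
        Nat.mod_eq_of_lt]
      simpa using ofDigits_lt (δ.map fun v => (ψ v).val) (by
        intro d hd; obtain ⟨v, -, rfl⟩ := List.mem_map.1 hd; exact (ψ v).2)
    · rw [colourClasses_congr fun v hv => colour_ofDigits hp _ ψ v (List.mem_toFinset.1 hv)]
  · rintro ⟨c, ⟨hc, hcδ⟩, rfl⟩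
    refine ⟨colour hp (δ ++ A') c, fun v hv => ?_, rfl⟩
    have hv' : v ∈ δ := by simpa using hv
    have hj := List.idxOf_lt_length_iff.2 hv'
    have h1 := ofDigits_digit (p := p) (δ.map fun v => (φ v).val) (by
        intro d hd; obtain ⟨v, -, rfl⟩ := List.mem_map.1 hd; exact (φ v).2) (δ.idxOf v)
        (by simpa using hj)
    rw [← hcδ] at h1
    simp only [List.getElem_map, List.getElem_idxOf] at h1
    ext
    rw [← h1]
    simp only [colour, List.idxOf_append, if_pos hv']
    -- The factor `p ^ j * p`, for `j` the index of `v`, shows that reduction modulo `p ^ |δ|`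
    -- leaves the digit `j` unchanged.
    have hpow : p ^ δ.length = p ^ (δ.idxOf v) * (p * p ^ (δ.length - δ.idxOf v - 1)) := by
      rw [← pow_succ', ← pow_add]; congr 1; omega
    rw [hpow, Nat.mod_mul_right_div_self, Nat.mod_mul_right_mod]

theorem listsPartition_map {p : ℕ} (A : List ℕ) (hA : A.Nodup) (φ : ℕ → Fin p) :
    ListsPartition (A.map fun v => (v, (φ v).val)) (colourClasses φ A.toFinset) := by
  refine ⟨hA.map fun a b h => (Prod.mk.inj h).1, fun v i => ?_⟩
  simp only [List.mem_map, Prod.mk.injEq, colourClasses, Finset.mem_filter, List.mem_toFinset]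
  constructor
  · rintro ⟨w, hw, rfl, rfl⟩
    exact ⟨(φ w).2, hw, rfl⟩
  · rintro ⟨h, hv, he⟩
    exact ⟨v, hv, rfl, by rw [he]⟩

/-! ## Encoded values -/

theorem encValue_top : encValue ⊤ = 0 := by simp [encValue]
theorem encValue_coe (n : ℕ) : encValue n = n + 1 := by simp [encValue]

/-- The code 0 of `∞` is the smallest number, hence the tests for zero; finite values compare like
their codes. -/
theorem encValue_better_min (x y : ℕ∞) : encValue (better .min x y) =
    if encValue y = 0 then encValue x else if encValue x = 0 then encValue y
    else if encValue y < encValue x then encValue y else encValue x := by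
  induction x with
  | top => simp [better, encValue_top]
  | coe x =>
    induction y with
    | top => simp [better, encValue_top]
    | coe y =>
      have : better .min (x : ℕ∞) y = ((min x y : ℕ) : ℕ∞) := by
        rcases le_total x y with h | h <;> simp [better, h]
      rw [this]
      simp only [encValue_coe, Nat.min_def]
      split_ifs <;> first | contradiction | omega

theorem encValue_better_max (x y : ℕ∞) : encValue (better .max x y) =
    if encValue x = 0 then encValue x else if encValue y = 0 then encValue y
    else if encValue x < encValue y then encValue y else encValue x := by
  induction x with
  | top => simp [better, encValue_top]
  | coe x =>
    induction y with
    | top => simp [better, encValue_top, eq_comm]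
    | coe y =>
      have : better .max (x : ℕ∞) y = ((max x y : ℕ) : ℕ∞) := by
        rcases le_total x y with h | h <;> simp [better, h]
      rw [this]
      simp only [encValue_coe, Nat.max_def]
      split_ifs <;> first | contradiction | omega

/-- Codes of finite values are shifted by one, so the sum of two codes is one too large. The
truncated subtraction is exact because of the equation `h`. -/
theorem encValue_offset {x y s : ℕ∞} {r : ℕ} (h : x + r = y + s) :
    encValue x = if encValue s = 0 then 0 else if encValue y = 0 then 0
      else encValue y + encValue s - 1 - r := by
  induction s with
  | top =>
    have : x = ⊤ := by
      by_contra hx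
      lift x to ℕ using hx
      rw [add_top] at h
      exact absurd h (by exact_mod_cast ENat.natCast_ne_top (x + r))
    simp [this, encValue_top]
  | coe s =>
    induction y with
    | top =>
      have : x = ⊤ := by
        by_contra hx
        lift x to ℕ using hx
        rw [top_add] at h
        exact absurd h (by exact_mod_cast ENat.natCast_ne_top (x + r))
      simp [this, encValue_top]
    | coe y =>
      induction x with
      | top =>
        rw [top_add] at h
        exact absurd h.symm (by exact_mod_cast ENat.natCast_ne_top (y + s))
      | coe x =>
        have h' : x + r = y + s := by exact_mod_cast h
        simp only [encValue_coe]
        split_ifs <;> omega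

/-! ## The graph of an overlay -/

/-- As `n ≤ S`, a cell determines its row and its column. -/
theorem adjList_mem {row : ℕ → ℕ} {n S : ℕ} (hrow : ∀ v < n, row v = v * S) (hS : n ≤ S)
    {l : List (ℕ × ℕ)} (hl : ∀ e ∈ l, e.1 < n ∧ e.2 < n) {u v : ℕ} (hu : u < n) (hv : v < n) :
    row u + v ∈ adjList row l ↔ s(u, v) ∈ toEdges l := by
  simp only [adjList, List.mem_flatMap, List.mem_cons, List.not_mem_nil, or_false, toEdges,
    List.mem_map, Sym2.eq_iff]
  have key : ∀ a b : ℕ, a < n → b < n → (row u + v = row a + b ↔ a = u ∧ b = v) := by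
    intro a b ha hb
    rw [hrow u hu, hrow a ha]
    constructor
    · intro h
      by_cases hau : a = u
      · subst hau; exact ⟨rfl, by omega⟩
      · exact absurd h (mul_add_ne (by omega) (by omega) (Ne.symm hau))
    · rintro ⟨rfl, rfl⟩; rfl
  constructor
  · rintro ⟨e, he, h⟩
    obtain ⟨h1, h2⟩ := hl e he
    rw [key _ _ h1 h2, key _ _ h2 h1] at h
    exact ⟨e, he, by tauto⟩
  · rintro ⟨e, he, h⟩
    obtain ⟨h1, h2⟩ := hl e he
    refine ⟨e, he, ?_⟩
    rw [key _ _ h1 h2, key _ _ h2 h1]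
    tauto

/-- The vertices that remain, and `q` new ones. -/
def overlayVerts (bag rem : List ℕ) (n q : ℕ) : List ℕ :=
  bag.filter (fun v => v ∉ rem) ++ (List.range q).map (n + ·)

/-- The edges that remain. -/
def keptEdges (eb : List (ℕ × ℕ)) (rem : List ℕ) (row : ℕ → ℕ) (del : List ℕ) : List (ℕ × ℕ) :=
  eb.filter fun e => e.1 ∉ rem ∧ e.2 ∉ rem ∧ row e.1 + e.2 ∉ del

/-- The list `rv` may mention vertices outside the boundary, which must not be deleted from `F`;
hence the filter. New vertices are named from `n` on, above all names in the bag. -/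
theorem overlay_verts {G F G' : BGraph} {n q : ℕ} {bag rv : List ℕ} (hbd : F.bd = G.bd)
    (hbag : ListsSet bag F.graph.verts) (hn : ∀ v ∈ F.graph.verts, v < n)
    (hv : G'.graph.verts = (G.bd \ rv.toFinset) ∪ Finset.Ico n (n + q)) :
    ListsSet (overlayVerts bag (rv.filter fun v => v ∈ G.bd) n q) (G'.overlay F).verts := by
  have hbag' : ∀ v, v ∈ bag ↔ v ∈ F.graph.verts := fun v => by rw [← hbag.2]; simp
  constructor
  · refine List.Nodup.append (hbag.1.filter _) (List.nodup_range.map fun a b h => by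
      simpa using h) ?_
    intro v h1 h2
    simp only [List.mem_filter, List.mem_map, List.mem_range] at h1 h2
    obtain ⟨j, -, rfl⟩ := h2
    have := hn _ ((hbag' _).1 h1.1)
    omega
  · ext v
    simp only [overlayVerts, List.mem_toFinset, List.mem_append, List.mem_filter, List.mem_map,
      List.mem_range, BGraph.overlay, hv, Finset.mem_union, Finset.mem_sdiff, Finset.mem_Ico,
      decide_eq_true_eq, hbag', hbd]
    have h2 : (∃ a < q, n + a = v) ↔ n ≤ v ∧ v < n + q :=
      ⟨by rintro ⟨a, ha, rfl⟩; omega, fun h => ⟨v - n, by omega, by omega⟩⟩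
    have h3 : v ∈ G.bd → v ∈ F.graph.verts := fun h => F.bd_sub (hbd ▸ h)
    rw [h2]
    tauto

/-- The propositional core of `overlay_edges`: `F` and `G` say that the pair is an edge of that
graph, `u` and `v` that its ends are in the boundary, `ru`, `rv` and `r` that an end or the edge is
listed for removal, and `a` that the edge is added. -/
theorem overlay_edges_aux {F G u v ru rv r a : Prop} (h : u → v → (F ↔ G)) :
    (F ∧ ¬ (u ∧ ru) ∧ ¬ (v ∧ rv) ∧ ¬ (r ∧ u ∧ v)) ∨ a ↔
      ((G ∧ (u ∧ ¬ ru) ∧ (v ∧ ¬ rv) ∧ ¬ r) ∨ a) ∨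
        (F ∧ ¬ (u ∧ v) ∧ (u → ¬ ru) ∧ (v → ¬ rv)) := by
  by_cases hu : u <;> by_cases hv : v <;> simp [hu, hv] at h ⊢ <;> tauto

/-- By compatibility, removals inside the boundary act on the edges of `F` as on those of `G[X]`.
Removals that leave the boundary have no effect and are filtered out. -/
theorem overlay_edges {G F G' : BGraph} {n q S : ℕ} {rv : List ℕ} {eb re ae : List (ℕ × ℕ)}
    {row : ℕ → ℕ} (hFG : F.Compatible G) (heb : ListsEdges eb F.graph.edges)
    (hn : ∀ v ∈ F.graph.verts, v < n) (hrow : ∀ v < n, row v = v * S) (hS : n ≤ S)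
    (hv : G'.graph.verts = (G.bd \ rv.toFinset) ∪ Finset.Ico n (n + q))
    (hnd : (toEdges ae).Nodup)
    (hdis : Disjoint ((G.graph.induce (G.bd \ rv.toFinset)).edges \ (toEdges re).toFinset)
      (toEdges ae).toFinset)
    (he : G'.graph.edges = (G.graph.induce (G.bd \ rv.toFinset)).edges \ (toEdges re).toFinset ∪
      (toEdges ae).toFinset) :
    ListsEdges (keptEdges eb (rv.filter fun v => v ∈ G.bd) row
      (adjList row (re.filter fun e => e.1 ∈ G.bd ∧ e.2 ∈ G.bd)) ++ ae) (G'.overlay F).edges := by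
  classical
  obtain ⟨hbd, hind⟩ := hFG
  have hbn : ∀ v ∈ G.bd, v < n := fun v h => hn v (F.bd_sub (hbd ▸ h))
  have heb' : ∀ x, x ∈ toEdges eb ↔ x ∈ F.graph.edges := fun x => by rw [← heb.2]; simp
  have hindE : ∀ u v, u ∈ G.bd → v ∈ G.bd → (s(u, v) ∈ F.graph.edges ↔ s(u, v) ∈ G.graph.edges) := by
    intro u v hu hv
    have := congrArg (fun H : FinGraph => s(u, v) ∈ H.edges) hind
    simpa [FinGraph.induce, hbd, hu, hv] using this
  set K := keptEdges eb (rv.filter fun v => v ∈ G.bd) row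
    (adjList row (re.filter fun e => e.1 ∈ G.bd ∧ e.2 ∈ G.bd)) with hK
  have hre : ∀ u v, s(u, v) ∈ toEdges (re.filter fun e => e.1 ∈ G.bd ∧ e.2 ∈ G.bd) ↔
      s(u, v) ∈ toEdges re ∧ u ∈ G.bd ∧ v ∈ G.bd := by
    intro u v
    simp only [toEdges, List.mem_map, List.mem_filter, decide_eq_true_eq]
    constructor
    · rintro ⟨e, ⟨h1, h2, h3⟩, h4⟩
      refine ⟨⟨e, h1, h4⟩, ?_⟩
      rw [Sym2.eq_iff] at h4
      rcases h4 with ⟨rfl, rfl⟩ | ⟨rfl, rfl⟩ <;> exact ⟨by assumption, by assumption⟩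
    · rintro ⟨⟨e, h1, h4⟩, h2, h3⟩
      refine ⟨e, ⟨h1, ?_⟩, h4⟩
      rw [Sym2.eq_iff] at h4
      rcases h4 with ⟨h5, h6⟩ | ⟨h5, h6⟩ <;> rw [h5, h6] <;> exact ⟨by assumption, by assumption⟩
  have hKmem : ∀ u v, s(u, v) ∈ toEdges K ↔ s(u, v) ∈ F.graph.edges ∧
      ¬ (u ∈ G.bd ∧ u ∈ rv) ∧ ¬ (v ∈ G.bd ∧ v ∈ rv) ∧
      ¬ (s(u, v) ∈ toEdges re ∧ u ∈ G.bd ∧ v ∈ G.bd) := by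
    intro u v
    have hlt : ∀ e ∈ re.filter (fun e => e.1 ∈ G.bd ∧ e.2 ∈ G.bd), e.1 < n ∧ e.2 < n := by
      intro e h
      simp only [List.mem_filter, decide_eq_true_eq] at h
      exact ⟨hbn _ h.2.1, hbn _ h.2.2⟩
    have hF : ∀ a b, (a, b) ∈ eb → a < n ∧ b < n := by
      intro a b h
      have := (heb' s(a, b)).1 (List.mem_map.2 ⟨_, h, rfl⟩)
      exact ⟨hn _ (F.graph.mem_verts _ this a (by simp)), hn _ (F.graph.mem_verts _ this b (by simp))⟩
    rw [← heb']
    generalize hr : (s(u, v) ∈ toEdges re) = r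
    simp only [toEdges, hK, keptEdges, List.mem_map, List.mem_filter, decide_eq_true_eq]
    constructor
    · rintro ⟨⟨a, b⟩, ⟨h1, h2, h3, h4⟩, h5⟩
      obtain ⟨ha, hb⟩ := hF a b h1
      rw [adjList_mem hrow hS hlt ha hb, hre] at h4
      refine ⟨⟨_, h1, h5⟩, ?_⟩
      have h6 := h5
      rw [Sym2.eq_iff] at h6
      change ¬ (s(a, b) ∈ toEdges re ∧ _) at h4
      dsimp only at h5 h2 h3
      rw [h5, hr] at h4
      clear hr
      rcases h6 with ⟨h6, h7⟩ | ⟨h6, h7⟩ <;> dsimp only at h6 h7 <;> subst h6 h7 <;> tauto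
    · rintro ⟨⟨⟨a, b⟩, h1, h5⟩, h2⟩
      obtain ⟨ha, hb⟩ := hF a b h1
      refine ⟨(a, b), ⟨h1, ?_⟩, h5⟩
      rw [adjList_mem hrow hS hlt ha hb, hre]
      have h6 := h5
      rw [Sym2.eq_iff] at h6
      change _ ∧ _ ∧ ¬ (s(a, b) ∈ toEdges re ∧ _)
      dsimp only at h5 ⊢
      rw [h5, hr]
      clear hr
      rcases h6 with ⟨h6, h7⟩ | ⟨h6, h7⟩ <;> dsimp only at h6 h7 <;> subst h6 h7 <;> tauto
  have happ : toEdges (K ++ ae) = toEdges K ++ toEdges ae := by simp [toEdges]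
  have hGe : ∀ u v, s(u, v) ∈ G'.graph.edges ↔ (s(u, v) ∈ G.graph.edges ∧ (u ∈ G.bd ∧ u ∉ rv) ∧
      (v ∈ G.bd ∧ v ∉ rv) ∧ s(u, v) ∉ toEdges re) ∨ s(u, v) ∈ toEdges ae := by
    intro u v
    rw [he]
    simp [FinGraph.induce]
    tauto
  have hends : ∀ u v, s(u, v) ∈ toEdges ae → u ∈ G'.graph.verts ∧ v ∈ G'.graph.verts := by
    intro u v h
    have := (hGe u v).2 (Or.inr h)
    exact ⟨G'.graph.mem_verts _ this u (by simp), G'.graph.mem_verts _ this v (by simp)⟩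
  have hFe : ∀ u v, s(u, v) ∈ F.graph.edges → u < n ∧ v < n := fun u v h =>
    ⟨hn _ (F.graph.mem_verts _ h u (by simp)), hn _ (F.graph.mem_verts _ h v (by simp))⟩
  constructor
  · rw [happ]
    refine List.Nodup.append ?_ hnd ?_
    · refine heb.1.sublist ?_
      exact List.Sublist.map _ List.filter_sublist
    -- An edge of `F` that is also added has its ends in the boundary, as new vertices are not below
    -- `n`. It would then be a kept edge of `G[X]`, and these are disjoint from the added ones.
    · intro x h1 h2
      induction x with
      | h u v =>
      obtain ⟨h3, h4, h5, h6⟩ := (hKmem u v).1 h1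
      obtain ⟨h7, h8⟩ := hends u v h2
      obtain ⟨h9, h10⟩ := hFe u v h3
      rw [hv] at h7 h8
      simp only [Finset.mem_union, Finset.mem_sdiff, Finset.mem_Ico, List.mem_toFinset] at h7 h8
      have h7' := h7.resolve_right (by omega)
      have h8' := h8.resolve_right (by omega)
      have h11 := (hindE u v h7'.1 h8'.1).1 h3
      refine Finset.disjoint_left.1 hdis ?_ (List.mem_toFinset.2 h2)
      simp [FinGraph.induce]
      tauto
  · ext x
    induction x with
    | h u v =>
    rw [happ]
    simp only [List.mem_toFinset, List.mem_append, hKmem, BGraph.overlay, Finset.mem_union,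
      Finset.mem_filter, hGe, hbd]
    have hm : (∃ w ∈ s(u, v), w ∉ G.bd) ↔ ¬ (u ∈ G.bd ∧ v ∈ G.bd) := by
      simp only [Sym2.mem_iff]
      constructor
      · rintro ⟨w, rfl | rfl, h⟩ <;> tauto
      · intro h
        by_cases hu : u ∈ G.bd
        · exact ⟨v, Or.inr rfl, fun h' => h ⟨hu, h'⟩⟩
        · exact ⟨u, Or.inl rfl, hu⟩
    have hall : (∀ w ∈ s(u, v), w ∈ G.bd → w ∈ G'.graph.verts) ↔
        (u ∈ G.bd → u ∉ rv) ∧ (v ∈ G.bd → v ∉ rv) := by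
      have : ∀ w ∈ G.bd, w ∈ G'.graph.verts ↔ w ∉ rv := by
        intro w hw
        have := hbn w hw
        rw [hv]
        simp [hw]
        omega
      simp only [Sym2.mem_iff, forall_eq_or_imp, forall_eq]
      constructor
      · rintro ⟨h1, h2⟩
        exact ⟨fun h => (this u h).1 (h1 h), fun h => (this v h).1 (h2 h)⟩
      · rintro ⟨h1, h2⟩
        exact ⟨fun h => (this u h).2 (h1 h), fun h => (this v h).2 (h2 h)⟩
    rw [hm, hall]
    exact overlay_edges_aux (hindE u v)

/-- The boundary of `F` disappears from the second operand and is counted in the bound for `G'`. -/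
theorem overlay_verts_card {G F G' : BGraph} {k : ℕ} (hbd : F.bd = G.bd)
    (h : G'.graph.verts.card ≤ G.bd.card + k) :
    (G'.overlay F).verts.card ≤ F.graph.verts.card + k := by
  have h1 := Finset.card_union_le G'.graph.verts (F.graph.verts \ F.bd)
  have h2 := Finset.card_sdiff_add_card_eq_card F.bd_sub
  rw [hbd] at h1 h2
  simp only [BGraph.overlay, hbd]
  omega

/-- The overlay takes from `F` only edges that leave the boundary. The others form `F[X] = G[X]`,
which the bound for `G'` counts. -/
theorem overlay_edges_card {G F G' : BGraph} {k : ℕ} (hFG : F.Compatible G)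
    (h : G'.graph.edges.card ≤ (G.graph.induce G.bd).edges.card + k) :
    (G'.overlay F).edges.card ≤ F.graph.edges.card + k := by
  classical
  rw [← hFG.2] at h
  have h1 := Finset.card_union_le G'.graph.edges (F.graph.edges.filter fun e =>
    (∃ v ∈ e, v ∉ F.bd) ∧ ∀ v ∈ e, v ∈ F.bd → v ∈ G'.graph.verts)
  have h2 : (F.graph.edges.filter fun e =>
      (∃ v ∈ e, v ∉ F.bd) ∧ ∀ v ∈ e, v ∈ F.bd → v ∈ G'.graph.verts).card +
      (F.graph.induce F.bd).edges.card ≤ F.graph.edges.card := by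
    rw [← Finset.card_union_of_disjoint]
    · exact Finset.card_le_card (Finset.union_subset (Finset.filter_subset _ _)
        (Finset.filter_subset _ _))
    · rw [Finset.disjoint_left]
      intro e h1 h2
      simp only [FinGraph.induce, Finset.mem_filter] at h1 h2
      obtain ⟨v, hv, hvn⟩ := h1.2.1
      exact hvn (h2.2 v hv)
  simp only [BGraph.overlay]
  convert (show _ ≤ _ from _) using 2
  omega

theorem FinGraph.mem_induce_edges {G : FinGraph} {S : Finset ℕ} {e : Sym2 ℕ} :
    e ∈ (G.induce S).edges ↔ e ∈ G.edges ∧ ∀ v ∈ e, v ∈ S := by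
  simp [FinGraph.induce]

theorem FinGraph.mem_rename_edges {G : FinGraph} {π : ℕ ≃ ℕ} {e : Sym2 ℕ} :
    e ∈ (G.rename π).edges ↔ ∃ e' ∈ G.edges, Sym2.map π e' = e := Finset.mem_image

theorem FinGraph.rename_del (G : FinGraph) (S : Finset ℕ) (π : ℕ ≃ ℕ) :
    (G.rename π).del (S.image π) = (G.del S).rename π := by
  classical
  have hm : ∀ v, π v ∈ (G.verts.image π) \ S.image π ↔ v ∈ G.verts \ S := fun v => by simp
  ext x
  · obtain ⟨v, rfl⟩ := π.surjective x
    simp [FinGraph.rename, FinGraph.del, FinGraph.induce]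
  · rw [FinGraph.del, FinGraph.mem_induce_edges, FinGraph.mem_rename_edges,
      FinGraph.mem_rename_edges]
    constructor
    · rintro ⟨⟨e, he, rfl⟩, h2⟩
      refine ⟨e, FinGraph.mem_induce_edges.2 ⟨he, fun v hv => ?_⟩, rfl⟩
      exact (hm v).1 (h2 _ (Sym2.mem_map.2 ⟨v, hv, rfl⟩))
    · rintro ⟨e, he, rfl⟩
      obtain ⟨he, h2⟩ := FinGraph.mem_induce_edges.1 he
      refine ⟨⟨e, he, rfl⟩, fun w hw => ?_⟩
      obtain ⟨v, hv, rfl⟩ := Sym2.mem_map.1 hw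
      exact (hm v).2 (h2 v hv)

/-- The program solves the annotated problem in the given time. -/
def Solves {p : ℕ} (g : PartitionEval p) (opt : Opt) (H : GraphClass) (f : ℕ → ℕ)
    (c d : ℕ) (P : Prog) : Prop :=
  ∀ (n : ℕ) (G : FinGraph) (𝒳 : Fin p → Finset ℕ) (es as : List (ℕ × ℕ)),
    G.verts = Finset.range n → IsPPartition 𝒳 (dom 𝒳) → dom 𝒳 ⊆ G.verts →
    G.del (dom 𝒳) ∈ H.mem → ListsEdges es G.edges → ListsPartition as 𝒳 →
    P.ComputesWithin (encAnnotated n es as) (encValue (annOptValue g opt G 𝒳))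
      (f (dom 𝒳).card * (n + 1) ^ c * (G.edges.card + 1) ^ d)

section

variable {p : ℕ} {g : PartitionEval p} {opt : Opt} {H : GraphClass} {f : ℕ → ℕ} {c d : ℕ}
  {S : Prog}

theorem listsEdges_card {l : List (ℕ × ℕ)} {E : Finset (Sym2 ℕ)} (h : ListsEdges l E) :
    E.card = l.length := by
  rw [← h.2, List.toFinset_card_of_nodup h.1, toEdges, List.length_map]

theorem listsSet_card {l : List ℕ} {E : Finset ℕ} (h : ListsSet l E) : E.card = l.length := by
  rw [← h.2, List.toFinset_card_of_nodup h.1]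

/-- The solver expects the vertices `0, 1, …`. The position in `vl` extends to a permutation of `ℕ`,
which preserves the value and the membership in `H`. -/
theorem Solves.renamed (hS : Solves g opt H f c d S) {Γ : FinGraph} {𝒳 : Fin p → Finset ℕ}
    {vl : List ℕ} {el an : List (ℕ × ℕ)} {nn : ℕ → ℕ} (hV : ListsSet vl Γ.verts)
    (hE : ListsEdges el Γ.edges) (hA : ListsPartition an 𝒳) (h𝒳 : IsPPartition 𝒳 (dom 𝒳))
    (hd : dom 𝒳 ⊆ Γ.verts) (hH : Γ.del (dom 𝒳) ∈ H.mem)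
    (hnn : ∀ (j : ℕ) (h : j < vl.length), nn vl[j] = j) :
    S.ComputesWithin (encAnnotated vl.length (el.map fun e => (nn e.1, nn e.2))
      (an.map fun e => (nn e.1, e.2))) (encValue (annOptValue g opt Γ 𝒳))
      (f (dom 𝒳).card * (vl.length + 1) ^ c * (el.length + 1) ^ d) := by
  have hmem : ∀ v, v ∈ Γ.verts ↔ v ∈ vl := fun v => by rw [← hV.2]; simp
  obtain ⟨π, hπ⟩ := exists_equiv_extending Γ.verts nn (by
    intro a ha b hb hab
    obtain ⟨i, hi, rfl⟩ := List.getElem_of_mem ((hmem a).1 ha)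
    obtain ⟨j, hj, rfl⟩ := List.getElem_of_mem ((hmem b).1 hb)
    rw [hnn, hnn] at hab
    subst hab; rfl)
  have hverts : (Γ.rename π).verts = Finset.range vl.length := by
    ext w
    simp only [FinGraph.rename, Finset.mem_image, Finset.mem_range]
    constructor
    · rintro ⟨v, hv, rfl⟩
      rw [hπ v hv]
      obtain ⟨i, hi, rfl⟩ := List.getElem_of_mem ((hmem v).1 hv)
      rwa [hnn]
    · intro hw
      have := (hmem _).2 (List.getElem_mem hw)
      exact ⟨_, this, by rw [hπ _ this, hnn]⟩
  have hel : ∀ e ∈ el, e.1 ∈ Γ.verts ∧ e.2 ∈ Γ.verts := by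
    intro e he
    have : s(e.1, e.2) ∈ Γ.edges := by
      rw [← hE.2]; exact List.mem_toFinset.2 (List.mem_map.2 ⟨e, he, rfl⟩)
    exact ⟨Γ.mem_verts _ this _ (by simp), Γ.mem_verts _ this _ (by simp)⟩
  have hes : el.map (fun e => (nn e.1, nn e.2)) = el.map fun e => (π e.1, π e.2) :=
    List.map_congr_left fun e he => by rw [hπ _ (hel e he).1, hπ _ (hel e he).2]
  have hedges : ListsEdges (el.map fun e => (nn e.1, nn e.2)) (Γ.rename π).edges := by
    have : toEdges (el.map fun e => (nn e.1, nn e.2)) = (toEdges el).map (Sym2.map π) := by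
      rw [hes]; simp [toEdges]
    refine ⟨?_, ?_⟩
    · rw [this]
      exact hE.1.map (Sym2.map.injective π.injective)
    · rw [this]
      change _ = Γ.edges.image _
      rw [← hE.2]
      ext x; simp
  have han : ∀ v i, (v, i) ∈ an → v ∈ Γ.verts := by
    intro v i h
    obtain ⟨hi, hv⟩ := (hA.2 v i).1 h
    exact hd (mem_dom.2 ⟨_, hv⟩)
  have has : ListsPartition (an.map fun e => (nn e.1, e.2)) (fun i => (𝒳 i).image π) := by
    have : an.map (fun e => (nn e.1, e.2)) = an.map fun e => (π e.1, e.2) :=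
      List.map_congr_left fun e he => by rw [hπ _ (han e.1 e.2 he)]
    rw [this]
    refine ⟨hA.1.map fun a b h => ?_, fun v i => ?_⟩
    · have h1 := Prod.mk.inj h
      exact Prod.ext (π.injective h1.1) h1.2
    · simp only [List.mem_map, Prod.mk.injEq, Prod.exists, Finset.mem_image]
      constructor
      · rintro ⟨a, b, hab, rfl, rfl⟩
        obtain ⟨hi, hv⟩ := (hA.2 a b).1 hab
        exact ⟨hi, a, hv, rfl⟩
      · rintro ⟨hi, a, ha, rfl⟩
        exact ⟨a, i, (hA.2 a i).2 ⟨hi, ha⟩, rfl, rfl⟩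
  have := hS vl.length (Γ.rename π) (fun i => (𝒳 i).image π) _ _ hverts
    (by rw [dom_image]; exact h𝒳.image π)
    (by rw [dom_image]; exact Finset.image_subset_image hd)
    (by rw [dom_image, FinGraph.rename_del]; exact H.iso _ hH π) hedges has
  rwa [annOptValue_rename, dom_image, Finset.card_image_of_injective _ π.injective,
    listsEdges_card hedges, List.length_map] at this

end

/-! ## Evaluation of the output of a reduction -/

theorem holds_append {a : ℕ → ℕ} {o : ℕ} {l l' : List ℕ} :
    Holds a o (l ++ l') ↔ Holds a o l ∧ Holds a (o + l.length) l' := by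
  constructor
  · intro h
    refine ⟨fun i hi => ?_, fun i hi => ?_⟩
    · rw [h i (by simp; omega), List.getElem_append_left hi]
    · rw [add_assoc, h _ (by simp; omega), List.getElem_append_right (by omega)]
      simp
  · rintro ⟨h1, h2⟩ i hi
    rcases Nat.lt_or_ge i l.length with h | h
    · rw [h1 i h, List.getElem_append_left h]
    · have := h2 (i - l.length) (by simp at hi; omega)
      rw [List.getElem_append_right h, ← this]
      congr 1; omega

/-- The marks of the pairs both of whose members pass a test. -/
def markPairsP : Prog :=
  .for 1 (.inp 1 0) (.set 2 0 (.inp 0 (.mem 1 0 + .mem 1 0)) ;;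
    .set 3 0 (.inp 0 (.mem 1 0 + .mem 1 0 + 1)) ;;
    .ite (.inp 2 (.mem 2 0)) (.ite (.inp 2 (.mem 3 0))
      (.set 0 (.inp 3 (.mem 2 0) + .mem 3 0) 1 ;; .set 0 (.inp 3 (.mem 3 0) + .mem 2 0) 1)
      .skip) .skip)

theorem markPairsP_spec (I : Arrays) (es : List (ℕ × ℕ)) (q : ℕ × ℕ → Prop) [DecidablePred q]
    (h0 : Holds (I 0) 0 (flat es)) (h1 : I 1 0 = es.length)
    (hq : ∀ e ∈ es, q e ↔ I 2 e.1 ≠ 0 ∧ I 2 e.2 ≠ 0) :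
    Wp I markPairsP 0 fun M' t =>
      M' 0 = marks (adjList (I 3) (es.filter (q ·))) ∧ t ≤ 2 + es.length * 8 := by
  rw [markPairsP, zero_eq_mk 4]
  refine (Wp.for es.length (fun i M => ∃ y z, M = mk [marks (adjList (I 3)
    ((es.take i).filter (q ·))), sc i, sc y, sc z]) (fun _ => 7) ?_ ?_ ?_).mono ?_
  · rintro i hi _ ⟨y, z, rfl⟩; simp [h1]
  · exact ⟨0, 0, by simp [mk_update, adjList]⟩
  · rintro i hi _ ⟨y, z, rfl⟩
    obtain ⟨h3, h4⟩ := holds_flat h0 i hi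
    rw [zero_add] at h3 h4
    have hqi := hq _ (List.getElem_mem hi)
    by_cases hu : I 2 (es[i]).1 = 0
    · have : ¬ q es[i] := by rw [hqi]; simp [hu]
      simp [mk_update, h3, h4, take_succ_eq _ _ hi, -List.take_append_getElem, hu, this]
      exact ⟨_, _, rfl⟩
    · by_cases hv : I 2 (es[i]).2 = 0
      · have : ¬ q es[i] := by rw [hqi]; simp [hv]
        simp [mk_update, h3, h4, take_succ_eq _ _ hi, -List.take_append_getElem, hu, hv, this]
        exact ⟨_, _, rfl⟩
      · have : q es[i] := by rw [hqi]; simp [hu, hv]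
        simp [mk_update, h3, h4, take_succ_eq _ _ hi, -List.take_append_getElem, hu, hv, this,
          marks_push, adjList]
        exact ⟨_, _, rfl⟩
  · rintro M' t ⟨⟨y, z, rfl⟩, ht⟩
    exact ⟨by simp, by simpa using ht⟩

/-- The index of every member of a list. -/
def inverseP : Prog := .for 1 (.inp 1 0) (.set 0 (.inp 0 (.mem 1 0)) (.mem 1 0))

theorem inverseP_spec (I : Arrays) (l : List ℕ) (hl : l.Nodup) (h0 : Holds (I 0) 0 l)
    (h1 : I 1 0 = l.length) :
    Wp I inverseP 0 fun M' t => (∀ (j : ℕ) (h : j < l.length), M' 0 l[j] = j) ∧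
      t ≤ 2 + l.length * 3 := by
  rw [inverseP, zero_eq_mk 2]
  refine (Wp.for l.length (fun i M => ∃ R, M = mk [R, sc i] ∧
    ∀ (j : ℕ) (h : j < l.length), j < i → R l[j] = j) (fun _ => 2) ?_ ?_ ?_).mono ?_
  · rintro i hi _ ⟨R, rfl, -⟩; simp [h1]
  · exact ⟨0, by simp [mk_update], by simp⟩
  · rintro i hi _ ⟨R, rfl, hR⟩
    have := h0 i hi
    simp only [zero_add] at this
    simp [mk_update, this]
    refine ⟨_, rfl, fun j hj hji => ?_⟩
    rcases eq_or_ne j i with rfl | hne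
    · simp
    · rw [Function.update_of_ne, hR j hj (by omega)]
      exact fun h => hne ((hl.getElem_inj_iff).1 h)
  · rintro M' t ⟨⟨R, rfl, hR⟩, ht⟩
    exact ⟨fun j hj => hR j hj hj, by simpa using ht⟩

/-- An interval. -/
def rangeP : Prog := .for 1 (.inp 1 0) (.set 0 (.mem 1 0) (.inp 0 0 + .mem 1 0))

theorem rangeP_spec (I : Arrays) (n q : ℕ) (h0 : I 0 0 = n) (h1 : I 1 0 = q) :
    Wp I rangeP 0 fun M' t => M' 0 = arr ((List.range q).map (n + ·)) ∧ t ≤ 2 + q * 3 := by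
  rw [rangeP, zero_eq_mk 2]
  refine (Wp.for_eq q (fun i => mk [arr ((List.range i).map (n + ·)), sc i])
    (fun _ => 2) ?_ ?_ ?_).mono ?_
  · simp [h1]
  · simp [mk_update]
  · intro i hi
    simp [mk_update, h0, List.range_succ, arr_push]
  · rintro M' t ⟨rfl, ht⟩
    exact ⟨rfl, by simpa using ht⟩

/-- The edges without a marked end that are not marked themselves. -/
def keptEdgesP : Prog :=
  .for 1 (.inp 1 0) (.set 3 0 (.inp 0 (.mem 1 0 + .mem 1 0)) ;;
    .set 4 0 (.inp 0 (.mem 1 0 + .mem 1 0 + 1)) ;;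
    .ite (.inp 2 (.mem 3 0) + .inp 2 (.mem 4 0) + .inp 3 (.inp 4 (.mem 3 0) + .mem 4 0)) .skip
      (.set 0 (.mem 2 0 + .mem 2 0 + 1) (.mem 3 0) ;;
        .set 0 (.mem 2 0 + .mem 2 0 + 2) (.mem 4 0) ;; .set 2 0 (.mem 2 0 + 1))) ;;
  .set 0 0 (.mem 2 0)

theorem keptEdgesP_spec (I : Arrays) (eb : List (ℕ × ℕ)) (rem del : List ℕ)
    (h0 : Holds (I 0) 0 (flat eb)) (h1 : I 1 0 = eb.length) (h2 : I 2 = marks rem)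
    (h3 : I 3 = marks del) :
    Wp I keptEdgesP 0 fun M' t => M' 0 = arr ((keptEdges eb rem (I 4) del).length ::
      flat (keptEdges eb rem (I 4) del)) ∧ t ≤ 3 + eb.length * 8 := by
  rw [keptEdgesP, zero_eq_mk 5]
  simp only [wp_seq, wp_set]
  refine (Wp.for eb.length (fun i M => ∃ y z, M = mk [arr (0 :: flat (keptEdges (eb.take i) rem
    (I 4) del)), sc i, sc (keptEdges (eb.take i) rem (I 4) del).length, sc y, sc z])
    (fun _ => 7) ?_ ?_ ?_).mono ?_
  · rintro i hi _ ⟨y, z, rfl⟩; simp [h1]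
  · exact ⟨0, 0, by simp [mk_update, keptEdges]⟩
  · rintro i hi _ ⟨y, z, rfl⟩
    obtain ⟨h5, h6⟩ := holds_flat h0 i hi
    rw [zero_add] at h5 h6
    have hz : (marks rem (eb[i]).1 = 0 ∧ marks rem (eb[i]).2 = 0) ∧
        marks del (I 4 (eb[i]).1 + (eb[i]).2) = 0 ↔
        ((eb[i]).1 ∉ rem ∧ (eb[i]).2 ∉ rem ∧ I 4 (eb[i]).1 + (eb[i]).2 ∉ del) := by
      simp only [marks_eq_zero]; tauto
    by_cases hq : (eb[i]).1 ∉ rem ∧ (eb[i]).2 ∉ rem ∧ I 4 (eb[i]).1 + (eb[i]).2 ∉ del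
    · have hk : keptEdges (eb.take (i + 1)) rem (I 4) del =
          keptEdges (eb.take i) rem (I 4) del ++ [eb[i]] := by
        simp only [keptEdges, take_succ_eq _ _ hi, List.filter_append]
        simp [hq]
      simp only [wp_seq, wp_ite, wp_set]
      rw [hk]
      have hz' := hz.2 hq
      simp [mk_update, h5, h6, h2, h3, hz']
      rw [arr_push_edge _ _ _ _ _ rfl]
      simp
      exact ⟨_, _, rfl⟩
    · have hk : keptEdges (eb.take (i + 1)) rem (I 4) del =
          keptEdges (eb.take i) rem (I 4) del := by
        simp only [keptEdges, take_succ_eq _ _ hi, List.filter_append]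
        rw [List.filter_singleton]
        simp only [hq, decide_false]
        simp
      simp only [wp_seq, wp_ite, wp_set]
      rw [hk]
      have hz' := fun h => hq (hz.1 h)
      have : ¬ ((marks rem (eb[i]).1 = 0 ∧ marks rem (eb[i]).2 = 0) ∧
        marks del (I 4 (eb[i]).1 + (eb[i]).2) = 0) := hz'
      simp [mk_update, h5, h6, h2, h3]
      rw [if_neg this]
      exact ⟨_, _, rfl⟩
  · rintro M' t ⟨⟨y, z, rfl⟩, ht⟩
    simp at ht
    simp [arr_cons_update]
    omega

/-- The edges in two lists, with new names. -/
def renameEdgesP : Prog :=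
  .for 1 (.inp 1 0) (.set 0 (.mem 1 0 + .mem 1 0) (.inp 4 (.inp 0 (.mem 1 0 + .mem 1 0))) ;;
    .set 0 (.mem 1 0 + .mem 1 0 + 1) (.inp 4 (.inp 0 (.mem 1 0 + .mem 1 0 + 1)))) ;;
  .for 1 (.inp 3 0) (
    .set 0 (.inp 1 0 + .inp 1 0 + (.mem 1 0 + .mem 1 0)) (.inp 4 (.inp 2 (.mem 1 0 + .mem 1 0))) ;;
    .set 0 (.inp 1 0 + .inp 1 0 + (.mem 1 0 + .mem 1 0) + 1)
      (.inp 4 (.inp 2 (.mem 1 0 + .mem 1 0 + 1))))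

theorem arr_push_pair (l : List (ℕ × ℕ)) (k u v : ℕ) (hk : k = l.length + l.length) :
    Function.update (Function.update (arr (flat l)) k u) (k + 1) v = arr (flat (l ++ [(u, v)])) := by
  subst hk
  rw [arr_push (by simp), arr_push (by simp)]
  simp

theorem renameEdgesP_spec (I : Arrays) (l l' : List (ℕ × ℕ)) (h0 : Holds (I 0) 0 (flat l))
    (h1 : I 1 0 = l.length) (h2 : Holds (I 2) 0 (flat l')) (h3 : I 3 0 = l'.length) :
    Wp I renameEdgesP 0 fun M' t =>
      M' 0 = arr (flat ((l ++ l').map fun e => (I 4 e.1, I 4 e.2))) ∧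
      t ≤ 4 + (l.length + l'.length) * 4 := by
  rw [renameEdgesP, zero_eq_mk 2]
  simp only [wp_seq, List.map_append]
  refine (Wp.for_eq l.length (fun i => mk [arr (flat ((l.take i).map fun e => (I 4 e.1, I 4 e.2))),
    sc i]) (fun _ => 3) ?_ ?_ ?_).mono ?_
  · simp [h1]
  · simp [mk_update]
  · intro i hi
    obtain ⟨h5, h6⟩ := holds_flat h0 i hi
    rw [zero_add] at h5 h6
    simp [mk_update, h5, h6, take_succ_eq _ _ hi, -List.take_append_getElem, -List.map_take]
    rw [arr_push_pair _ _ _ _ (by simp; omega)]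
    simp
  rintro M' t ⟨rfl, ht⟩
  refine (Wp.for_eq l'.length (fun i => mk [arr (flat (l.map (fun e => (I 4 e.1, I 4 e.2)) ++
    (l'.take i).map fun e => (I 4 e.1, I 4 e.2))), sc i]) (fun _ => 3) ?_ ?_ ?_).mono ?_
  · simp [h3]
  · simp [mk_update]
  · intro i hi
    obtain ⟨h5, h6⟩ := holds_flat h2 i hi
    rw [zero_add] at h5 h6
    simp only [wp_seq, wp_set]
    simp [mk_update, h5, h6, take_succ_eq _ _ hi, -List.take_append_getElem, -List.map_take, h1]
    rw [← flat_append, arr_push_pair _ _ _ _ (by simp; omega)]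
    simp
  · rintro M' t' ⟨rfl, ht'⟩
    simp at ht ht' ⊢
    omega

/-- A list of annotated vertices, with new names. -/
def renameAnnotatedP : Prog :=
  .for 1 (.inp 1 0) (.set 0 (.mem 1 0 + .mem 1 0) (.inp 2 (.inp 0 (.mem 1 0 + .mem 1 0))) ;;
    .set 0 (.mem 1 0 + .mem 1 0 + 1) (.inp 0 (.mem 1 0 + .mem 1 0 + 1)))

theorem renameAnnotatedP_spec (I : Arrays) (l : List (ℕ × ℕ)) (h0 : Holds (I 0) 0 (flat l))
    (h1 : I 1 0 = l.length) :
    Wp I renameAnnotatedP 0 fun M' t =>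
      M' 0 = arr (flat (l.map fun e => (I 2 e.1, e.2))) ∧ t ≤ 2 + l.length * 4 := by
  rw [renameAnnotatedP, zero_eq_mk 2]
  refine (Wp.for_eq l.length (fun i => mk [arr (flat ((l.take i).map fun e => (I 2 e.1, e.2))),
    sc i]) (fun _ => 3) ?_ ?_ ?_).mono ?_
  · simp [h1]
  · simp [mk_update]
  · intro i hi
    obtain ⟨h5, h6⟩ := holds_flat h0 i hi
    rw [zero_add] at h5 h6
    simp [mk_update, h5, h6, take_succ_eq _ _ hi, -List.take_append_getElem, -List.map_take]
    rw [arr_push_pair _ _ _ _ (by simp; omega)]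
    simp
  · rintro M' t ⟨rfl, ht⟩
    exact ⟨by simp, by simpa using ht⟩

theorem Prog.ComputesWithin.wp {P : Prog} {ls : List (List ℕ)} {out time : ℕ}
    (h : P.ComputesWithin ls out time) :
    Wp (mk (ls.map arr)) P 0 fun M' t => M' 0 0 = out ∧ t ≤ time := by
  obtain ⟨M, t, he, ho, ht⟩ := h
  rw [load_eq_mk] at he
  exact ⟨M, t, he, ho, by omega⟩

/-- The value of an instance, from the output of a reduction (input array `0`), the bag, its edges,
the marks of the boundary, the multiples of the row length and the number of vertices. -/
def evalP (S : Prog) : Prog :=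
  .call (filterP (.inp 2 (.mem 3 0))) [.inp 0 7, .inp 0 3, .inp 3 0] 1 ;;
  .call marksP [.mem 1 1, .mem 1 0] 2 ;;
  .call markPairsP [.inp 0 (.inp 0 3 + 7), .inp 0 4, .inp 3 0, .inp 4 0] 3 ;;
  .call (filterP (1 - .inp 2 (.mem 3 0))) [.inp 1 1, .inp 1 0, .mem 2 0] 4 ;;
  .call rangeP [.inp 5 0, .inp 0 2] 5 ;;
  .call catP [.mem 4 1, .mem 4 0, .mem 5 0, .inp 0 2] 6 ;;
  .call inverseP [.mem 6 1, .mem 6 0] 7 ;;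
  .call keptEdgesP [.inp 2 1, .inp 2 0, .mem 2 0, .mem 3 0, .inp 4 0] 8 ;;
  .set 9 0 (.mem 6 0) ;; .set 9 1 (.mem 8 0 + .inp 0 5) ;; .set 9 2 (.inp 0 6) ;;
  .call renameEdgesP [.mem 8 1, .mem 8 0, .inp 0 (.inp 0 3 + 7 + .inp 0 4 + .inp 0 4), .inp 0 5,
    .mem 7 0] 10 ;;
  .call renameAnnotatedP [.inp 0 (.inp 0 3 + 7 + .inp 0 4 + .inp 0 4 + .inp 0 5 + .inp 0 5),
    .inp 0 6, .mem 7 0] 11 ;;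
  .call S [.mem 9 0, .mem 10 0, .mem 11 0] 12 ;;
  .ite (.inp 0 1) (.ite (.mem 12 0)
    (.set 0 0 (.mem 12 0 + .inp 0 1 - 1 - .inp 0 0)) .skip) .skip

theorem holds_shift {a : ℕ → ℕ} {o : ℕ} {l : List ℕ} (h : Holds a o l) :
    Holds (fun i => a (o + i)) 0 l := holds_iff_offset.1 h

theorem arr_three (x y z : ℕ) : Function.update (Function.update (sc x) 1 y) 2 z = arr [x, y, z] := by
  rw [sc, arr_push (by simp), arr_push (by simp)]; rfl

section

variable {p : ℕ} {g : PartitionEval p} {opt : Opt} {H : GraphClass} {f : ℕ → ℕ} {c d : ℕ}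
  {S : Prog}

set_option maxHeartbeats 1000000 in
-- The overlay is assembled as a list of surviving and new vertices, numbered by their positions,
-- with the edges renamed accordingly. It exceeds `F` by at most `K (|B| + 1)` vertices and edges,
-- which bounds the time of the solver.
theorem evalP_spec (hS : Solves g opt H f c d S) (hf : Monotone f) {K n Sz : ℕ} (I : Arrays)
    {G F G' : BGraph} {A : Finset ℕ} {𝒜 𝒜' : Fin p → Finset ℕ} {sneg : ℕ} {spos : ℕ∞}
    {l bag : List ℕ} {eb : List (ℕ × ℕ)}
    (hl : Holds (I 0) 0 l) (hout : IsNiceOutput l G n G' 𝒜' sneg spos)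
    (hred : IsNiceReduction H g opt K G A 𝒜 G' 𝒜' sneg spos)
    (hFG : F.Compatible G) (hglue : G.Glueable F) (hn : ∀ v ∈ F.graph.verts, v < n)
    (hbag : ListsSet bag F.graph.verts) (h1 : Holds (I 1) 0 (bag.length :: bag))
    (heb : ListsEdges eb F.graph.edges) (h2 : Holds (I 2) 0 (eb.length :: flat eb))
    (h3 : ∀ v, I 3 v ≠ 0 ↔ v ∈ G.bd) (h4 : ∀ v < n, I 4 v = v * Sz) (hSz : n ≤ Sz)
    (h5 : I 5 0 = n) (hH : ((F.glue G).induce F.graph.verts).del A ∈ H.mem) :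
    Wp I (evalP S) 0 fun M' t => M' 0 0 = encValue (annOptValue g opt (G.glue F) 𝒜) ∧
      t ≤ 60 * (l.length + bag.length + eb.length + K * ((G.bd \ A).card + 1) + 1) +
        f (A.card + K) * (bag.length + K * ((G.bd \ A).card + 1) + 1) ^ c *
          (eb.length + K * ((G.bd \ A).card + 1) + 1) ^ d := by
  obtain ⟨q, rv, re, ae, an, rfl, hverts, ⟨haend, hdis, hedges⟩, han⟩ := hout
  have hlen : ([sneg, encValue spos, q, rv.length, re.length, ae.length, an.length] ++
      rv ++ flat re ++ flat ae ++ flat an).length = 7 + rv.length + 2 * re.length +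
      2 * ae.length + 2 * an.length := by simp; ring
  rw [hlen]
  obtain ⟨hl, hlan⟩ := holds_append.1 hl
  obtain ⟨hl, hlae⟩ := holds_append.1 hl
  obtain ⟨hl, hlre⟩ := holds_append.1 hl
  obtain ⟨hl, hlrv⟩ := holds_append.1 hl
  have l0 := hl 0 (by simp)
  have l1 := hl 1 (by simp)
  have l2 := hl 2 (by simp)
  have l3 := hl 3 (by simp)
  have l4 := hl 4 (by simp)
  have l5 := hl 5 (by simp)
  have l6 := hl 6 (by simp)
  simp only [zero_add, List.getElem_cons_zero, List.getElem_cons_succ] at l0 l1 l2 l3 l4 l5 l6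
  obtain ⟨hb0, hb1⟩ := holds_cons.1 h1
  obtain ⟨he0, he1⟩ := holds_cons.1 h2
  simp only [zero_add] at hb1 he1
  have hFbd : F.bd = G.bd := hFG.1
  -- New vertices are named from `n` on, so a vertex shared with `F` lies in the old boundary, where
  -- general position applies.
  have hglue' : G'.Glueable F := by
    intro v hv
    obtain ⟨hv1, hv2⟩ := Finset.mem_inter.1 hv
    have hvn := hn v hv2
    have hv3 := hv1
    rw [hverts] at hv3
    simp only [Finset.mem_union, Finset.mem_sdiff, Finset.mem_Ico] at hv3
    have hvX := (hv3.resolve_right (by omega)).1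
    have := hred.general_position (Finset.mem_inter.2 ⟨hv1, G.bd_sub hvX⟩)
    rw [hFbd]; exact this
  have hlv := overlay_verts hFbd hbag hn hverts
  have hle := overlay_edges hFG heb hn h4 hSz hverts haend hdis hedges
  set rem := rv.filter fun v => v ∈ G.bd with hrem
  set del := adjList (I 4) (re.filter fun e => e.1 ∈ G.bd ∧ e.2 ∈ G.bd) with hdel
  have hval := encValue_offset (hred.value F hFG hglue hglue')
  have hcv := overlay_verts_card hFbd hred.verts_card
  have hce := overlay_edges_card hFG hred.edges_card
  rw [listsSet_card hlv, listsSet_card hbag] at hcv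
  rw [listsEdges_card hle, listsEdges_card heb] at hce
  have hqlen : (overlayVerts bag rem n q).length =
      (bag.filter fun v => v ∉ rem).length + q := by simp [overlayVerts]
  have hklen : (keptEdges eb rem (I 4) del).length ≤ eb.length := List.length_filter_le _ _
  have hremlen : rem.length ≤ rv.length := List.length_filter_le _ _
  rw [evalP, zero_eq_mk 13]
  simp only [wp_seq, wp_call, passArgs_eq, List.map_cons, List.map_nil, deref_inp, deref_mem]
  refine (filterP_spec _ rv _ (fun v => v ∈ G.bd) ?_ ?_ ?_).mono ?_
  · simp; exact holds_shift hlrv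
  · simp [l3]
  · intro M _; simp only [mk_zero, mk_succ, Expr.eval_inp, Expr.eval_mem, Expr.eval_ofNat]
    simpa using not_congr (h3 (M 3 0))
  rintro M1 t1 ⟨e1, ht1⟩
  rw [← hrem] at e1
  refine (marksP_spec _ rem ?_ ?_).mono ?_
  · simp [mk_update, e1]; exact holds_shift (holds_arr_cons _ _)
  · simp [mk_update, e1]
  rintro M2 t2 ⟨e2, ht2⟩
  refine (markPairsP_spec _ re (fun e => e.1 ∈ G.bd ∧ e.2 ∈ G.bd) ?_ ?_ ?_).mono ?_
  · simp [l3]; refine holds_shift ?_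
    convert hlre using 1; simp
  · simp [l4]
  · intro e _; simp [← h3]
  rintro M3 t3 ⟨e3, ht3⟩
  simp only [mk_zero, mk_succ, zero_add, Expr.eval_ofNat] at e3
  rw [show (fun i => I 4 i) = I 4 from rfl, ← hdel] at e3
  refine (filterP_spec _ bag _ (fun v => v ∉ rem) ?_ ?_ ?_).mono ?_
  · simp; exact holds_shift hb1
  · simp [hb0]
  · intro M _
    simp [mk_update, e2]
    by_cases h : M 3 0 ∈ rem <;> simp [marks, h]
  rintro M4 t4 ⟨e4, ht4⟩
  refine (rangeP_spec _ n q ?_ ?_).mono ?_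
  · simp [h5]
  · simp [l2]
  rintro M5 t5 ⟨e5, ht5⟩
  refine (catP_spec _ (bag.filter fun v => v ∉ rem) ((List.range q).map (n + ·)) ?_ ?_ ?_ ?_).mono ?_
  · simp [mk_update, e4]; exact holds_shift (holds_arr_cons _ _)
  · simp [mk_update, e4]
  · simp [mk_update, e5]; exact holds_arr _
  · simp [l2]
  rintro M6 t6 ⟨e6, ht6⟩
  rw [show (bag.filter fun v => v ∉ rem) ++ (List.range q).map (n + ·) = overlayVerts bag rem n q
    from rfl] at e6 ht6
  refine (inverseP_spec _ (overlayVerts bag rem n q) hlv.1 ?_ ?_).mono ?_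
  · simp [mk_update, e6]; exact holds_shift (holds_arr_cons _ _)
  · simp [mk_update, e6]
  rintro M7 t7 ⟨e7, ht7⟩
  refine (keptEdgesP_spec _ eb rem del ?_ ?_ ?_ ?_).mono ?_
  · simp; exact holds_shift he1
  · simp [he0]
  · simp [mk_update, e2]
  · simp [mk_update, e3]
  rintro M8 t8 ⟨e8, ht8⟩
  simp only [mk_zero, mk_succ, zero_add, Expr.eval_ofNat] at e8
  rw [show (fun i => I 4 i) = I 4 from rfl] at e8
  simp only [wp_set]
  refine (renameEdgesP_spec _ (keptEdges eb rem (I 4) del) ae ?_ ?_ ?_ ?_).mono ?_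
  · simp [mk_update, e8]; exact holds_shift (holds_arr_cons _ _)
  · simp [mk_update, e8]
  · simp [l3, l4]; refine holds_shift ?_
    convert hlae using 1; simp; ring
  · simp [l5]
  rintro M9 t9 ⟨e9, ht9⟩
  refine (renameAnnotatedP_spec _ an ?_ ?_).mono ?_
  · simp [l3, l4, l5]; refine holds_shift ?_
    convert hlan using 1; simp; ring
  · simp [l6]
  rintro M10 t10 ⟨e10, ht10⟩
  have hsol := (hS.renamed hlv hle han hred.partition
    (hred.dom_sub.trans Finset.subset_union_left) (hred.modulator F hFG hglue hglue' hH) e7).wp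
  simp only [encAnnotated, List.map_cons, List.map_nil, List.length_map] at hsol
  simp [mk_update] at e9 e10
  have hargs : mk [arr [(overlayVerts bag rem n q).length,
      (keptEdges eb rem (I 4) del ++ ae).length, an.length], M9 0, M10 0] =
      mk [arr [(overlayVerts bag rem n q).length,
      (keptEdges eb rem (I 4) del ++ ae).length, an.length],
      arr (flat ((keptEdges eb rem (I 4) del ++ ae).map fun e => (M7 0 e.1, M7 0 e.2))),
      arr (flat (an.map fun e => (M7 0 e.1, e.2)))] := by
    rw [e9, e10]; simp
  rw [← hargs] at hsol
  have hst := fun x y z => arr_three x y z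
  simp [mk_update, e6, e8, l5, l6, hst]
  simp only [List.length_append] at hsol
  refine hsol.mono ?_
  rintro M11 t11 ⟨e11, ht11⟩
  have htime : f (dom 𝒜').card * ((overlayVerts bag rem n q).length + 1) ^ c *
      ((keptEdges eb rem (I 4) del).length + ae.length + 1) ^ d ≤
      f (A.card + K) * (bag.length + K * ((G.bd \ A).card + 1) + 1) ^ c *
          (eb.length + K * ((G.bd \ A).card + 1) + 1) ^ d := by
    rw [List.length_append] at hce
    gcongr
    · exact hf hred.dom_card
  have hfilter := List.length_filter_le (fun v => decide (v ∉ rem)) bag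
  rw [List.length_append] at hce
  rw [hqlen] at hcv ht6 ht7
  have ht11' := ht11.trans htime
  have hfin : t1 + t2 + t3 + t4 + t5 + t6 + t7 + t8 + t9 + t10 + t11 + 20 ≤
      60 * (7 + rv.length + 2 * re.length + 2 * ae.length + 2 * an.length + bag.length +
        eb.length + K * ((G.bd \ A).card + 1) + 1) +
        f (A.card + K) * (bag.length + K * ((G.bd \ A).card + 1) + 1) ^ c *
          (eb.length + K * ((G.bd \ A).card + 1) + 1) ^ d := by
    generalize f (A.card + K) * (bag.length + K * ((G.bd \ A).card + 1) + 1) ^ c *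
          (eb.length + K * ((G.bd \ A).card + 1) + 1) ^ d = T at ht11' ⊢
    generalize K * ((G.bd \ A).card + 1) = κ at hcv hce ⊢
    clear htime ht11 hsol
    omega
  generalize 60 * (7 + rv.length + 2 * re.length + 2 * ae.length + 2 * an.length + bag.length +
        eb.length + K * ((G.bd \ A).card + 1) + 1) +
        f (A.card + K) * (bag.length + K * ((G.bd \ A).card + 1) + 1) ^ c *
          (eb.length + K * ((G.bd \ A).card + 1) + 1) ^ d = T at hfin ⊢
  clear ht1 ht2 ht3 ht4 ht5 ht6 ht7 ht8 ht9 ht10 ht11 ht11' htime hcv hce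
  -- If the offset or the value is infinite, the output cell keeps its initial 0, the code of `∞`.
  by_cases hs : encValue spos = 0
  · rw [if_pos hs] at hval
    simp [l1, hs, hval]
    clear * - hfin
    omega
  · rw [if_neg hs] at hval
    by_cases hR : encValue (annOptValue g opt (G'.overlay F) 𝒜') = 0
    · rw [if_pos hR] at hval
      simp [l1, hs, hval, e11, hR, mk_update]
      clear * - hfin
      omega
    · rw [if_neg hR] at hval
      simp [l1, l0, hs, hval, e11, hR, mk_update]
      clear * - hfin
      omega

end

/-! ### ## The table of a boundary -/

/-- The program computes nice reductions, with the constant `K`. -/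
def Reduces {p : ℕ} (g : PartitionEval p) (opt : Opt) (H : GraphClass) (K : ℕ) (P : Prog) : Prop :=
  ∀ (G : BGraph) (parts : List BGraph) (A : Finset ℕ)
    (𝒜 : Fin p → Finset ℕ) (b : ℕ) (I : Arrays),
    G.IsBoxSum parts → A ⊆ G.bd → (∀ Gi ∈ parts, (Gi.bd \ A).card ≤ 1) →
    IsPPartition 𝒜 A → HoldsNiceInput g opt I G parts A 𝒜 b →
    ∃ (M : Arrays) (t : ℕ) (l : List ℕ) (G' : BGraph) (𝒜' : Fin p → Finset ℕ)
      (sneg : ℕ) (spos : ℕ∞),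
      Exec I P 0 M t ∧ Holds (M 0) 0 l ∧ IsNiceOutput l G b G' 𝒜' sneg spos ∧
      l.length + t ≤ K * (A.card + 1) * (parts.length + 1) ∧
      IsNiceReduction H g opt K G A 𝒜 G' 𝒜' sneg spos

/-- Reduces an instance and evaluates the result. -/
def entryP (R S : Prog) : Prog :=
  .call R [.inp 0 0, .inp 1 0, .inp 2 0, .inp 3 0, .inp 4 0, .inp 5 0, .inp 6 0, .inp 7 0, .inp 8 0,
    .inp 3 0, .inp 4 0] 1 ;;
  .call (evalP S) [.mem 1 0, .inp 9 0, .inp 10 0, .inp 11 0, .inp 3 0, .inp 0 3] 0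

/-- A bound for the time that `entryP` takes. -/
def entryTime (K : ℕ) (f : ℕ → ℕ) (c d a b k n m : ℕ) : ℕ :=
  61 * (K * (a + 1) * (k + 1)) + 60 * (n + m + K * (b + 1) + 1) + 2 +
    f (a + K) * (n + K * (b + 1) + 1) ^ c * (m + K * (b + 1) + 1) ^ d

section

variable {p : ℕ} {g : PartitionEval p} {opt : Opt} {H : GraphClass} {f : ℕ → ℕ} {c d K : ℕ}
  {R S : Prog}

/-- Arrays 3 and 4 are passed twice: in the application the parts are induced subgraphs with the
vertex names of the whole graph, so one matrix serves for all. -/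
theorem entryP_spec (hR : Reduces g opt H K R) (hS : Solves g opt H f c d S) (hf : Monotone f)
    {n Sz : ℕ} (I : Arrays) {G F : BGraph} {parts : List BGraph} {A : Finset ℕ}
    {𝒜 : Fin p → Finset ℕ} {bag : List ℕ} {eb : List (ℕ × ℕ)}
    (hbox : G.IsBoxSum parts) (hA : A ⊆ G.bd) (hone : ∀ Gi ∈ parts, (Gi.bd \ A).card ≤ 1)
    (h𝒜 : IsPPartition 𝒜 A)
    (hin : HoldsNiceInput g opt (mk [I 0, I 1, I 2, I 3, I 4, I 5, I 6, I 7, I 8, I 3, I 4])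
      G parts A 𝒜 n)
    (hFG : F.Compatible G) (hglue : G.Glueable F) (hn : ∀ v ∈ F.graph.verts, v < n)
    (hbag : ListsSet bag F.graph.verts) (h9 : Holds (I 9) 0 (bag.length :: bag))
    (heb : ListsEdges eb F.graph.edges) (h10 : Holds (I 10) 0 (eb.length :: flat eb))
    (h11 : ∀ v, I 11 v ≠ 0 ↔ v ∈ G.bd) (h3 : ∀ v < n, I 3 v = v * Sz) (hSz : n ≤ Sz)
    (h0 : I 0 3 = n) (hH : ((F.glue G).induce F.graph.verts).del A ∈ H.mem) :
    Wp I (entryP R S) 0 fun M' t => M' 0 0 = encValue (annOptValue g opt (G.glue F) 𝒜) ∧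
      t ≤ entryTime K f c d A.card (G.bd \ A).card parts.length bag.length eb.length := by
  obtain ⟨M1, t1, l, G', 𝒜', sneg, spos, he, hl, hout, ht1, hred⟩ :=
    hR G parts A 𝒜 n _ hbox hA hone h𝒜 hin
  rw [entryP, zero_eq_mk 2]
  simp only [wp_seq, wp_call, passArgs_eq, List.map_cons, List.map_nil, deref_inp, deref_mem,
    Expr.eval_ofNat, zero_add]
  rw [← zero_eq_mk 2]
  refine ⟨M1, t1, he, ?_⟩
  refine (evalP_spec hS hf _ (l := l) (Sz := Sz) ?_ hout hred hFG hglue hn hbag ?_ heb ?_ ?_ ?_ hSz ?_ hH).mono ?_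
  · simpa using hl
  · simpa using h9
  · simpa using h10
  · simpa using h11
  · simpa using h3
  · simpa using h0
  rintro M2 t2 ⟨e2, ht2⟩
  refine ⟨by simpa using e2, ?_⟩
  rw [entryTime]
  generalize K * (A.card + 1) * (parts.length + 1) = x at *
  generalize K * ((G.bd \ A).card + 1) = y at *
  generalize f (A.card + K) * (bag.length + y + 1) ^ c * (eb.length + y + 1) ^ d = z at *
  omega

/-- Replaces an entry of a table by the better of it and a new value. -/
def combineP : Opt → Prog
  | .min => .ite (.mem 3 0) (.ite (.mem 0 (.mem 4 0)) (.ite (.mem 0 (.mem 4 0) - .mem 3 0)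
      (.set 0 (.mem 4 0) (.mem 3 0)) .skip) (.set 0 (.mem 4 0) (.mem 3 0))) .skip
  | .max => .ite (.mem 0 (.mem 4 0)) (.ite (.mem 3 0) (.ite (.mem 3 0 - .mem 0 (.mem 4 0))
      (.set 0 (.mem 4 0) (.mem 3 0)) .skip) (.set 0 (.mem 4 0) 0)) .skip

theorem combineP_spec (I : Arrays) (T C V : ℕ → ℕ) (i q : ℕ) (x y : ℕ∞) (hx : T q = encValue x)
    (hy : V 0 = encValue y) :
    Wp I (combineP opt) (mk [T, sc i, C, V, sc q]) fun M' t =>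
      M' = mk [Function.update T q (encValue (better opt x y)), sc i, C, V, sc q] ∧ t ≤ 4 := by
  have hself : ∀ z, z = encValue x → Function.update T q z = T := by
    rintro z rfl; rw [← hx, Function.update_eq_self]
  cases opt
  · rw [encValue_better_min, combineP]
    by_cases h1 : encValue y = 0
    · simp [hx, hy, h1, hself]
    by_cases h2 : encValue x = 0
    · simp [hx, hy, h1, h2, mk_update]
    by_cases h3 : encValue y < encValue x
    · have : encValue x - encValue y ≠ 0 := by omega
      simp [hx, hy, h1, h2, h3, this, mk_update]
    · have : encValue x - encValue y = 0 := by omega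
      simp [hx, hy, h1, h2, h3, this, hself]
  · rw [encValue_better_max, combineP]
    by_cases h1 : encValue x = 0
    · simp [hx, hy, h1, hself]
    by_cases h2 : encValue y = 0
    · simp [hx, hy, h1, h2, mk_update]
    by_cases h3 : encValue x < encValue y
    · have : encValue y - encValue x ≠ 0 := by omega
      simp [hx, hy, h1, h2, h3, this, mk_update]
    · have : encValue y - encValue x = 0 := by omega
      simp [hx, hy, h1, h2, h3, this, hself]

/-- Fills a table with the optimum of no values. -/
def fillP : Opt → Prog
  | .min => .skip
  | .max => .for 1 (.inp 12 0) (.set 0 (.mem 1 0) 1)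

/-- The optimum of no values is `∞` for `min`, whose code is the initial 0, and `0` for `max`, whose
code is 1. -/
theorem fillP_spec (I : Arrays) (C : ℕ → ℕ) (q : ℕ) (hq : I 12 0 = q) :
    Wp I (fillP opt) (mk [0, 0, C, 0, 0]) fun M' t => ∃ T i, M' = mk [T, sc i, C, 0, 0] ∧
      (∀ j < q, T j = encValue (optOver opt ∅)) ∧ t ≤ 2 + q * 3 := by
  cases opt
  · simp only [fillP, wp_skip]
    exact ⟨0, 0, by simp, by simp [optOver, encValue_top], by omega⟩
  · rw [fillP]
    refine (Wp.for q (fun i M => ∃ T, M = mk [T, sc i, C, 0, 0] ∧ ∀ j < i, T j = 1)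
      (fun _ => 2) ?_ ?_ ?_).mono ?_
    · rintro i hi _ ⟨T, rfl, -⟩; simp [hq]
    · exact ⟨0, by simp [mk_update], by simp⟩
    · rintro i hi _ ⟨T, rfl, hT⟩
      simp [mk_update]
      refine ⟨_, rfl, fun j hj => ?_⟩
      rcases eq_or_ne j i with rfl | hne
      · simp
      · rw [Function.update_of_ne hne]; exact hT j (by omega)
    · rintro M' t ⟨⟨T, rfl, hT⟩, ht⟩
      refine ⟨T, q, rfl, fun j hj => ?_, by simpa using ht⟩
      rw [hT j hj]; simp [optOver, encValue]

/-- The table of the values of the partitions of a boundary: input `12` has its size, and input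
`13` the number of colourings of the annotated set. -/
def loopP (p : ℕ) (opt : Opt) (R S : Prog) : Prog :=
  .call initColoursP [.inp 1 0, .inp 0 0] 2 ;; fillP opt ;;
  .for 1 (.inp 13 0) (
    .call (entryP R S) [.inp 0 0, .mem 2 0, .inp 2 0, .inp 3 0, .inp 4 0, .inp 5 0, .inp 6 0,
      .inp 7 0, .inp 8 0, .inp 9 0, .inp 10 0, .inp 11 0] 3 ;;
    combineP opt ;; .set 4 0 (.mem 4 0 + 1) ;; .ite (.inp 12 0 - .mem 4 0) .skip (.set 4 0 0) ;;
    .call (incrementP p) [.mem 2 0, .inp 0 0] 2)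

/-- Only the colouring `i` is new, and it counts for the entry `i % q` alone. -/
theorem optOver_image_step (val : ℕ → ℕ∞) (q i : ℕ) (j : ℕ) :
    optOver opt (val '' {c | c < i + 1 ∧ c % q = j}) =
      if i % q = j then better opt (optOver opt (val '' {c | c < i ∧ c % q = j})) (val i)
      else optOver opt (val '' {c | c < i ∧ c % q = j}) := by
  split_ifs with h
  · rw [← optOver_insert, ← Set.image_insert_eq]
    congr 2
    ext c
    simp only [Set.mem_ofPred_eq, Set.mem_insert_iff]
    constructor
    · rintro ⟨h1, h2⟩
      rcases Nat.lt_succ_iff_lt_or_eq.1 h1 with h3 | h3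
      · exact Or.inr ⟨h3, h2⟩
      · exact Or.inl h3
    · rintro (rfl | ⟨h1, h2⟩)
      · exact ⟨by omega, h⟩
      · exact ⟨by omega, h2⟩
  · congr 2
    ext c
    simp only [Set.mem_ofPred_eq]
    constructor
    · rintro ⟨h1, h2⟩
      refine ⟨lt_of_le_of_ne (by omega) ?_, h2⟩
      rintro rfl
      exact h h2
    · rintro ⟨h1, h2⟩; exact ⟨by omega, h2⟩

/-- All colourings of `A` are enumerated by a counter in base `p`. Each value improves the entry of
its residue class. -/
theorem loopP_run (hp : 1 ≤ p) (I : Arrays) (A : List ℕ) (q E : ℕ) (hq : 0 < q) (val : ℕ → ℕ∞)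
    (h0 : I 0 0 = A.length) (h1 : Holds (I 1) 0 A) (h12 : I 12 0 = q) (h13 : I 13 0 = p ^ A.length)
    (hval : ∀ c < p ^ A.length, ∀ C : ℕ → ℕ, (∀ (j : ℕ) (h : j < A.length), C (j + j) = A[j] ∧
      C (j + j + 1) = c / p ^ j % p) →
      Wp (mk [I 0, C, I 2, I 3, I 4, I 5, I 6, I 7, I 8, I 9, I 10, I 11]) (entryP R S) 0
        fun M' t => M' 0 0 = encValue (val c) ∧ t ≤ E) :
    Wp I (loopP p opt R S) 0 fun M' t =>
      (∀ j < q, M' 0 j = encValue (optOver opt (val '' {c | c < p ^ A.length ∧ c % q = j}))) ∧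
      t ≤ 7 + A.length * 3 + q * 3 + p ^ A.length * (E + A.length * 7 + 14) := by
  rw [loopP, zero_eq_mk 5]
  simp only [wp_seq, wp_call, passArgs_eq, List.map_cons, List.map_nil, deref_inp, deref_mem,
    Expr.eval_ofNat, zero_add]
  refine (initColoursP_spec _ A ?_ ?_).mono ?_
  · simpa using h1
  · simpa using h0
  rintro M1 t1 ⟨e1, ht1⟩
  simp only [mk_update, List.replicate, List.length_cons, List.length_nil, Nat.reduceAdd,
    Nat.reduceLT, List.set_cons_succ, List.set_cons_zero]
  refine (fillP_spec I (M1 0) q h12).mono ?_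
  rintro _ t2 ⟨T, i, rfl, hT, ht2⟩
  refine (Wp.for (p ^ A.length) (fun i M => ∃ T C V, M = mk [T, sc i, C, V, sc (i % q)] ∧
    (∀ (j : ℕ) (h : j < A.length), C (j + j) = A[j] ∧ C (j + j + 1) = i / p ^ j % p) ∧
    ∀ j < q, T j = encValue (optOver opt (val '' {c | c < i ∧ c % q = j})))
    (fun _ => E + A.length * 7 + 13) ?_ ?_ ?_).mono ?_
  · rintro i hi _ ⟨T, C, V, rfl, -⟩; simp [h13]
  · refine ⟨T, M1 0, 0, by simp [mk_update], ?_, ?_⟩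
    · intro j hj; simpa using e1 j hj
    · intro j hj; simpa using hT j hj
  · rintro i hi _ ⟨T, C, V, rfl, hC, hT⟩
    simp only [wp_seq, wp_call, passArgs_eq, List.map_cons, List.map_nil, deref_inp, deref_mem,
      Expr.eval_ofNat, zero_add, mk_zero, mk_succ]
    refine (hval i hi C hC).mono ?_
    rintro M3 t3 ⟨e3, ht3⟩
    simp only [mk_update, List.length_cons, List.length_nil, Nat.reduceAdd,
      Nat.reduceLT, List.set_cons_succ, List.set_cons_zero]
    refine (combineP_spec I T C (M3 0) i (i % q) _ _ (hT _ (Nat.mod_lt _ hq)) e3).mono ?_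
    rintro _ t4 ⟨rfl, ht4⟩
    -- The residue is maintained by wrapping around at `q`, since the machine has no division.
    have hmod : (if q - (i % q + 1) = 0 then 0 else i % q + 1) = (i + 1) % q := by
      have hm := Nat.mod_lt i hq
      have hd := Nat.div_add_mod i q
      split_ifs with h
      · have : i + 1 = q * (i / q + 1) := by rw [mul_add]; omega
        rw [this, Nat.mul_mod_right]
      · have : i + 1 = q * (i / q) + (i % q + 1) := by omega
        conv_rhs => rw [this, Nat.mul_add_mod, Nat.mod_eq_of_lt (by omega)]
    have hstep : ∀ C' : ℕ → ℕ, (∀ (j : ℕ) (h : j < A.length), C' (j + j) = A[j] ∧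
        C' (j + j + 1) = (i + 1) / p ^ j % p) → ∃ T' C V, mk [Function.update T (i % q)
        (encValue (better opt (optOver opt (val '' {c | c < i ∧ c % q = i % q})) (val i))),
        sc (i + 1), C', M3 0, sc ((i + 1) % q)] = mk [T', sc (i + 1), C, V, sc ((i + 1) % q)] ∧
        (∀ (j : ℕ) (h : j < A.length), C (j + j) = A[j] ∧ C (j + j + 1) = (i + 1) / p ^ j % p) ∧
        ∀ j < q, T' j = encValue (optOver opt (val '' {c | c < i + 1 ∧ c % q = j})) := by
      refine fun C' hC' => ⟨Function.update T (i % q) _, C', M3 0, rfl, hC', fun j hj => ?_⟩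
      rw [optOver_image_step]
      rcases eq_or_ne j (i % q) with rfl | hne
      · rw [Function.update_self, if_pos rfl]
      · rw [Function.update_of_ne hne, if_neg hne.symm, hT j hj]
    simp only [wp_set, wp_ite, mk_update, List.length_cons, List.length_nil, Nat.reduceAdd,
      Nat.reduceLT, List.set_cons_succ, List.set_cons_zero, Expr.eval_add, Expr.eval_sub,
      Expr.eval_mem, Expr.eval_inp, Expr.eval_ofNat, mk_zero, mk_succ, sc_zero, h12, update_sc,
      wp_skip]
    by_cases hz : q - (i % q + 1) = 0
    · rw [if_pos hz] at hmod ⊢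
      refine (incrementP_spec _ p i hp A ?_ ?_).mono ?_
      · simpa using hC
      · simpa using h0
      rintro M5 t5 ⟨e5, ht5⟩
      refine ⟨by omega, ?_⟩
      have := hstep _ e5
      rw [← hmod] at this ⊢
      exact this
    · rw [if_neg hz] at hmod ⊢
      refine (incrementP_spec _ p i hp A ?_ ?_).mono ?_
      · simpa using hC
      · simpa using h0
      rintro M5 t5 ⟨e5, ht5⟩
      refine ⟨by omega, ?_⟩
      have := hstep _ e5
      rw [← hmod] at this ⊢
      exact this
  · rintro M' t ⟨⟨T, C, V, rfl, -, hT⟩, ht⟩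
    refine ⟨fun j hj => hT j hj, ?_⟩
    simp at ht
    rw [show E + A.length * 7 + 13 + 1 = E + A.length * 7 + 14 by ring] at ht
    omega

/-- The residue classes in `loopP_run` are the extensions of the colourings of `δ`, by
`table_entry`. -/
theorem loopP_spec (hp : 1 ≤ p) (hR : Reduces g opt H K R) (hS : Solves g opt H f c d S)
    (hf : Monotone f) {n Sz : ℕ} (I : Arrays) {G F : BGraph} {parts : List BGraph}
    {δ A' B bag : List ℕ} {eb : List (ℕ × ℕ)}
    (hbox : G.IsBoxSum parts) (hAB : (δ ++ A' ++ B).Nodup) (hbd : G.bd = (δ ++ A' ++ B).toFinset)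
    (hone : ∀ Gi ∈ parts, (Gi.bd \ (δ ++ A').toFinset).card ≤ 1)
    (hGn : ∀ v ∈ G.graph.verts, v < n) (h0 : Holds (I 0) 0 [(δ ++ A').length, B.length, parts.length, n])
    (h1 : Holds (I 1) 0 (δ ++ A')) (h2 : Holds (I 2) 0 B) (hadj : HoldsAdj (I 3) 0 (I 4) G.graph)
    (hparts : ∀ (i : ℕ) (h : i < parts.length), ∃ (xs ys : List ℕ) (px py pt pr : ℕ),
      ListsSet xs (parts[i]).bd ∧ ListsSet ys ((parts[i]).graph.verts \ (parts[i]).bd) ∧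
      Holds (I 5) (6 * i) [xs.length, px, ys.length, py, pt, pr] ∧
      Holds (I 6) px xs ∧ Holds (I 7) py ys ∧
      HoldsTable g opt (I 8) pt (parts[i]).graph xs ∧
      HoldsAdj (I 3) pr (I 4) (parts[i]).graph)
    (hFG : F.Compatible G) (hglue : G.Glueable F) (hn : ∀ v ∈ F.graph.verts, v < n)
    (hbag : ListsSet bag F.graph.verts) (h9 : Holds (I 9) 0 (bag.length :: bag))
    (heb : ListsEdges eb F.graph.edges) (h10 : Holds (I 10) 0 (eb.length :: flat eb))
    (h11 : ∀ v, I 11 v ≠ 0 ↔ v ∈ G.bd) (h3 : ∀ v < n, I 3 v = v * Sz) (hSz : n ≤ Sz)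
    (h12 : I 12 0 = p ^ δ.length) (h13 : I 13 0 = p ^ (δ ++ A').length)
    (hH : ((F.glue G).induce F.graph.verts).del (δ ++ A').toFinset ∈ H.mem) :
    Wp I (loopP p opt R S) 0 fun M' t => HoldsTable g opt (M' 0) 0 (G.glue F) δ ∧
      t ≤ 7 + p ^ (δ ++ A').length * (entryTime K f c d (δ ++ A').length B.length parts.length
        bag.length eb.length + (δ ++ A').length * 10 + 17) := by
  have hAnd : (δ ++ A').Nodup := (List.nodup_append'.1 hAB).1
  have hBnd : B.Nodup := (List.nodup_append'.1 hAB).2.1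
  have hdis := (List.nodup_append'.1 hAB).2.2
  have hsub : (δ ++ A').toFinset ⊆ G.bd := by
    rw [hbd, List.toFinset_append (l := δ ++ A') (l' := B)]; exact Finset.subset_union_left
  have hB : G.bd \ (δ ++ A').toFinset = B.toFinset := by
    rw [hbd]
    ext v
    simp only [Finset.mem_sdiff, List.mem_toFinset, List.mem_append (t := B)]
    constructor
    · rintro ⟨h | h, h'⟩
      · exact absurd h h'
      · exact h
    · exact fun h => ⟨Or.inr h, fun h' => hdis h' h⟩
  have hle : p ^ δ.length ≤ p ^ (δ ++ A').length := Nat.pow_le_pow_right hp (by simp)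
  have hpos : 0 < p ^ δ.length := by positivity
  refine (loopP_run hp I (δ ++ A') (p ^ δ.length) (entryTime K f c d (δ ++ A').length B.length
    parts.length bag.length eb.length) hpos (fun e => annOptValue g opt (G.glue F)
    (colourClasses (colour hp (δ ++ A') e) (δ ++ A').toFinset)) ?_ h1 h12 h13 ?_).mono ?_
  · have := h0 0 (by simp); simpa using this
  · intro e he C hC
    -- Vertices and digits alternate in the counter, so its array already encodes the partition of
    -- the annotated set.
    have hfl : Holds C 0 (flat ((δ ++ A').map fun v => (v, (colour hp (δ ++ A') e v).val))) := by
      intro i hi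
      simp only [flat_length, List.length_map] at hi
      rcases Nat.even_or_odd' i with ⟨j, rfl | rfl⟩
      · have hj : j < (δ ++ A').length := by omega
        have := (flat_get ((δ ++ A').map fun v => (v, (colour hp (δ ++ A') e v).val)) j (by
          simpa using hj)).1
        simp only [zero_add, two_mul, this, (hC j hj).1, List.getElem_map]
      · have hj : j < (δ ++ A').length := by omega
        have := (flat_get ((δ ++ A').map fun v => (v, (colour hp (δ ++ A') e v).val)) j (by
          simpa using hj)).2
        simp only [zero_add, two_mul, this, (hC j hj).2, List.getElem_map, colour_get hp hAnd]
    have := entryP_spec hR hS hf (n := n) (Sz := Sz)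
      (mk [I 0, C, I 2, I 3, I 4, I 5, I 6, I 7, I 8, I 9, I 10, I 11]) hbox hsub hone
      (colourClasses_isPPartition (colour hp (δ ++ A') e) _) ⟨hGn, ⟨_, B,
        listsPartition_map (δ ++ A') hAnd _, ⟨hBnd, hB.symm⟩, ?_, hfl, h2⟩, hadj, hparts⟩ hFG hglue hn
      hbag h9 heb h10 h11 h3 hSz ?_ hH
    · rwa [hB, List.toFinset_card_of_nodup hAnd, List.toFinset_card_of_nodup hBnd] at this
    · simpa using h0
    · have := h0 3 (by simp); simpa using this
  · rintro M' t ⟨hT, ht⟩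
    constructor
    · intro φ
      rw [table_entry hp g opt (G.glue F) δ A' (by
        exact hsub.trans (G.bd_sub.trans Finset.subset_union_left)) φ, zero_add]
      refine hT _ ?_
      simpa using ofDigits_lt (δ.map fun v => (φ v).val) (by
        intro d hd; obtain ⟨v, -, rfl⟩ := List.mem_map.1 hd; exact (φ v).2)
    · refine ht.trans ?_
      have h2 : (δ ++ A').length ≤ p ^ (δ ++ A').length * (δ ++ A').length :=
        Nat.le_mul_of_pos_left _ (by omega)
      have : p ^ (δ ++ A').length * (entryTime K f c d (δ ++ A').length B.length parts.length
        bag.length eb.length + (δ ++ A').length * 10 + 17) = p ^ (δ ++ A').length * (entryTime K f c d (δ ++ A').length B.length parts.length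
        bag.length eb.length + (δ ++ A').length * 7 + 14) + 3 * (p ^ (δ ++ A').length * (δ ++ A').length)
        + 3 * p ^ (δ ++ A').length := by ring
      omega

end

/-! ### ## Rooted decompositions -/

/-- A rooted `1`-`H`-tree decomposition of a graph on `0, …, n-1`, given by lists: every parent
precedes its children, and `top v` is the first node whose bag contains `v`. -/
structure RootedDec (H : GraphClass) (G : FinGraph) where
  n : ℕ
  N : ℕ
  k : ℕ
  par : ℕ → ℕ
  as : ℕ → List ℕ
  bs : ℕ → List ℕ
  top : ℕ → ℕ
  verts : G.verts = Finset.range n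
  N_pos : 0 < N
  par_lt : ∀ t < N, t ≠ 0 → par t < t
  bag_lt : ∀ t < N, ∀ v ∈ as t ++ bs t, v < n
  bag_nil : ∀ t, N ≤ t → as t ++ bs t = []
  nodup : ∀ t < N, (as t ++ bs t).Nodup
  edge : ∀ e ∈ G.edges, ∃ t < N, ∀ v ∈ e, v ∈ as t ++ bs t
  climb : ∀ t < N, ∀ s < t, ∀ v ∈ as t ++ bs t, v ∈ as s ++ bs s →
    v ∈ as (par t) ++ bs (par t)
  mem_class : ∀ t < N, G.induce (bs t).toFinset ∈ H.mem
  adhesion_up : ∀ t < N, t ≠ 0 →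
    ((as t ++ bs t).toFinset ∩ (bs (par t)).toFinset).card ≤ 1
  adhesion_down : ∀ t < N, t ≠ 0 →
    ((as (par t) ++ bs (par t)).toFinset ∩ (bs t).toFinset).card ≤ 1
  width : ∀ t < N, (as t).length ≤ k
  top_lt : ∀ v < n, top v < N
  top_mem : ∀ v < n, v ∈ as (top v) ++ bs (top v)
  top_le : ∀ t < N, ∀ v ∈ as t ++ bs t, top v ≤ t

namespace RootedDec

open scoped Classical

variable {H : GraphClass} {G : FinGraph} (D : RootedDec H G)

/-- The vertices of a bag. -/
def bag (t : ℕ) : List ℕ := D.as t ++ D.bs t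

/-- `u` is a descendant of `t`. -/
def Desc (t u : ℕ) : Prop := Relation.ReflTransGen (fun a b => a ≠ 0 ∧ D.par a = b) u t

theorem Desc.le {t u : ℕ} (h : D.Desc t u) (hu : u < D.N) : t ≤ u := by
  induction h using Relation.ReflTransGen.head_induction_on with
  | refl => exact le_rfl
  | head h' _ ih =>
    obtain ⟨h0, rfl⟩ := h'
    have := D.par_lt _ hu h0
    exact (ih (by omega)).trans (by omega)

theorem Desc.trans {s t u : ℕ} (h : D.Desc s t) (h' : D.Desc t u) : D.Desc s u :=
  Relation.ReflTransGen.trans h' h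

theorem desc_iff {t u : ℕ} : D.Desc t u ↔ u = t ∨ ∃ c, c ≠ 0 ∧ D.par c = t ∧ D.Desc c u := by
  constructor
  · intro h
    rcases Relation.ReflTransGen.cases_tail h with h | ⟨c, h1, h2, h3⟩
    · exact Or.inl h.symm
    · exact Or.inr ⟨c, h2, h3, h1⟩
  · rintro (rfl | ⟨c, h2, h3, h1⟩)
    · exact .refl
    · exact .tail h1 ⟨h2, h3⟩

theorem desc_root {u : ℕ} (hu : u < D.N) : D.Desc 0 u := by
  induction u using Nat.strong_induction_on with
  | _ u ih =>
    rcases eq_or_ne u 0 with rfl | h0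
    · exact .refl
    · have := D.par_lt u hu h0
      exact .head ⟨h0, rfl⟩ (ih _ this (by omega))

theorem child_lt {c t u : ℕ} (h0 : c ≠ 0) (hp : D.par c = t) (h : D.Desc c u) (hu : u < D.N) :
    t < c ∧ c < D.N := by
  have := h.le D hu
  have h1 := D.par_lt c (by omega) h0
  omega

/-- The ancestors of `u` form a chain. If one of the two children were a proper ancestor of the
other, it would be an ancestor of `t`, although it comes after `t`. -/
theorem children_disjoint {c c' t u : ℕ} (h0 : c ≠ 0) (hp : D.par c = t) (h0' : c' ≠ 0)
    (hp' : D.par c' = t) (h : D.Desc c u) (h' : D.Desc c' u) (hu : u < D.N) : c = c' := by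
  have l1 := D.child_lt h0 hp h hu
  have l2 := D.child_lt h0' hp' h' hu
  have key : ∀ c c', c ≠ 0 → D.par c = t → t < c' → c < D.N → t < D.N → D.Desc c' c → c = c' := by
    intro c c' h0 hp hl hc ht h
    rcases Relation.ReflTransGen.cases_head h with h | ⟨x, ⟨-, rfl⟩, h2⟩
    · exact h
    · rw [hp] at h2
      have := Desc.le D h2 ht
      omega
  rcases Relation.ReflTransGen.total_of_right_unique (fun a b b' hb hb' => hb.2.symm.trans hb'.2)
    h h' with h2 | h2
  · exact key c c' h0 hp l2.1 l1.2 (by omega) h2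
  · exact (key c' c h0' hp' l1.1 l2.2 (by omega) h2).symm

/-- `v` is an end of an edge. -/
def NonIsolated (G : FinGraph) (v : ℕ) : Prop := ∃ e ∈ G.edges, v ∈ e

/-- By `climb` the vertex stays in the bags on the way up until its first node is reached. -/
theorem desc_top {s v : ℕ} (hs : s < D.N) (hv : v ∈ D.bag s) : D.Desc (D.top v) s := by
  induction s using Nat.strong_induction_on with
  | _ s ih =>
    have hle := D.top_le s hs v hv
    rcases eq_or_lt_of_le hle with h | h
    · rw [h]; exact .refl
    · have hp := D.par_lt s hs (by omega)
      have hc := D.climb s hs _ h v hv (D.top_mem v (D.bag_lt s hs v hv))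
      exact .head ⟨by omega, rfl⟩ (ih _ hp (by omega) hc)

/-- The vertices that appear first in the bag of `t`. -/
def own (t : ℕ) : List ℕ := (List.range D.n).filter fun v => D.top v = t

/-- The boundary of the part below `t`. -/
noncomputable def bdry (t : ℕ) : List ℕ :=
  (D.bag t).filter fun v => D.top v < t ∧ NonIsolated G v

/-- The indices of the children of `t`, minus one. -/
def children (t : ℕ) : List ℕ := (List.range (D.N - 1)).filter fun j => D.par (j + 1) = t

/-- The annotated vertices that appear first in the bag of `t`. -/
def ownA (t : ℕ) : List ℕ := (D.as t).filter fun v => D.top v = t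

/-- The vertices in `B` at the node `t`. -/
noncomputable def ownB (t : ℕ) : List ℕ := (D.bs t).filter fun v => D.top v = t ∧
  v ∈ (D.children t).flatMap fun j => D.bdry (j + 1)

/-- The vertices below `t`. -/
noncomputable def below (t : ℕ) : Finset ℕ := (Finset.range D.n).filter fun v => D.Desc t (D.top v)

/-- The vertices of the part below `t`. -/
noncomputable def partVerts (t : ℕ) : Finset ℕ := D.below t ∪ (D.bdry t).toFinset

theorem mem_children {j t : ℕ} : j ∈ D.children t ↔ j + 1 < D.N ∧ D.par (j + 1) = t := by
  simp only [children, List.mem_filter, List.mem_range, decide_eq_true_eq]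
  exact and_congr_left fun _ => by omega

theorem mem_own {v t : ℕ} : v ∈ D.own t ↔ v < D.n ∧ D.top v = t := by
  simp [own]

theorem mem_below {v t : ℕ} : v ∈ D.below t ↔ v < D.n ∧ D.Desc t (D.top v) := by simp [below]

theorem mem_bdry {v t : ℕ} : v ∈ D.bdry t ↔ v ∈ D.bag t ∧ D.top v < t ∧ NonIsolated G v := by
  simp [bdry]

theorem mem_partVerts {v t : ℕ} : v ∈ D.partVerts t ↔ v ∈ D.below t ∨ v ∈ D.bdry t := by
  simp [partVerts]

theorem below_lt {v t : ℕ} (h : v ∈ D.below t) : t ≤ D.top v :=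
  ((D.mem_below.1 h).2).le D (D.top_lt v (D.mem_below.1 h).1)

/-- The boundary at the node `t`. -/
noncomputable def cut (t : ℕ) : List ℕ := D.bdry t ++ D.ownA t ++ D.ownB t

/-- The vertices at the node `t`. -/
noncomputable def piece (t : ℕ) : List ℕ := D.bdry t ++ D.own t

/-- A boundary vertex of a child has appeared before the child, so `climb` moves it up to `t`. -/
theorem bdry_child_bag {j t v : ℕ} (hj : j ∈ D.children t) (hv : v ∈ D.bdry (j + 1)) :
    v ∈ D.bag t ∧ D.top v ≤ t := by
  obtain ⟨h1, h2⟩ := D.mem_children.1 hj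
  obtain ⟨h3, h4, -⟩ := D.mem_bdry.1 hv
  have := D.par_lt _ h1 (by omega)
  have h5 := D.climb _ h1 _ h4 v h3 (D.top_mem v (D.bag_lt _ h1 v h3))
  rw [h2] at h5
  exact ⟨h5, D.top_le t (by omega) v h5⟩

/-- An old vertex is non-isolated and thus on the boundary of `t`. A new one is in `ownA` or, since
it lies on the boundary of a child, in `ownB`. -/
theorem bdry_child_cut {j t v : ℕ} (hj : j ∈ D.children t) (hv : v ∈ D.bdry (j + 1)) :
    v ∈ D.cut t := by
  obtain ⟨h1, h2⟩ := D.bdry_child_bag hj hv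
  obtain ⟨-, -, h3⟩ := D.mem_bdry.1 hv
  have h4 : ∃ j ∈ D.children t, v ∈ D.bdry (j + 1) := ⟨j, hj, hv⟩
  rcases lt_or_eq_of_le h2 with h | h
  · simp [cut, D.mem_bdry, h1, h, h3]
  · rcases List.mem_append.1 h1 with h5 | h5
    · simp [cut, ownA, h5, h]
    · simp only [cut, ownB, List.mem_append, List.mem_filter, List.mem_flatMap]
      exact Or.inr ⟨h5, by simpa [h] using h4⟩

theorem cut_top {t v : ℕ} (hv : v ∈ D.cut t) : D.top v ≤ t := by
  simp only [cut, ownA, ownB, List.mem_append, List.mem_filter, D.mem_bdry] at hv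
  rcases hv with (h | h) | h
  · exact h.2.1.le
  · simp at h; exact h.2.le
  · simp at h; exact h.2.1.le

theorem bdry_top {t v : ℕ} (hv : v ∈ D.bdry t) : D.top v < t := (D.mem_bdry.1 hv).2.1

theorem cut_bag {t v : ℕ} (hv : v ∈ D.cut t) : v ∈ D.bag t := by
  simp only [cut, ownA, ownB, List.mem_append, List.mem_filter, D.mem_bdry] at hv
  rcases hv with (h | h) | h
  · exact h.1
  · exact List.mem_append_left _ h.1
  · exact List.mem_append_right _ h.1

theorem cut_piece {t v : ℕ} (ht : t < D.N) (hv : v ∈ D.cut t) : v ∈ D.piece t := by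
  have hb := D.cut_bag hv
  rcases List.mem_append.1 hv with h | h
  · rcases List.mem_append.1 h with h | h
    · exact List.mem_append_left _ h
    · exact List.mem_append_right _ (D.mem_own.2 ⟨D.bag_lt t ht v hb, by simpa using (List.mem_filter.1 h).2⟩)
  · refine List.mem_append_right _ (D.mem_own.2 ⟨D.bag_lt t ht v hb, ?_⟩)
    have := (List.mem_filter.1 h).2
    simp at this; exact this.1

theorem piece_top {t v : ℕ} (hv : v ∈ D.piece t) : D.top v ≤ t := by
  rcases List.mem_append.1 hv with h | h
  · exact (D.bdry_top h).le
  · exact (D.mem_own.1 h).2.le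

theorem piece_bag {t v : ℕ} (hv : v ∈ D.piece t) : v ∈ D.bag t := by
  rcases List.mem_append.1 hv with h | h
  · exact (D.mem_bdry.1 h).1
  · obtain ⟨h1, rfl⟩ := D.mem_own.1 h
    exact D.top_mem v h1

/-- The piece omits only isolated vertices of the bag, so no edge is lost. -/
theorem mem_piece_iff {t v : ℕ} (ht : t < D.N) (h : NonIsolated G v) : v ∈ D.piece t ↔ v ∈ D.bag t := by
  refine ⟨D.piece_bag, fun hb => ?_⟩
  rcases lt_or_eq_of_le (D.top_le t ht v hb) with h1 | h1
  · exact List.mem_append_left _ (D.mem_bdry.2 ⟨hb, h1, h⟩)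
  · exact List.mem_append_right _ (D.mem_own.2 ⟨D.bag_lt t ht v hb, h1⟩)

/-- Climb from `s` towards `c`: either the first node of `u` is met, or `u` is still in the bag of
`c` and lies on its boundary. -/
theorem mem_partVerts_of_bag {c s u : ℕ} (hs : s < D.N) (hd : D.Desc c s) (hu : u ∈ D.bag s)
    (hni : NonIsolated G u) : u ∈ D.partVerts c := by
  induction s using Nat.strong_induction_on with
  | _ s ih =>
    rw [D.mem_partVerts]
    have hn := D.bag_lt s hs u hu
    rcases eq_or_lt_of_le (D.top_le s hs u hu) with h | h
    · exact Or.inl (D.mem_below.2 ⟨hn, h ▸ hd⟩)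
    · rcases Relation.ReflTransGen.cases_head hd with rfl | ⟨x, ⟨h0, rfl⟩, h2⟩
      · exact Or.inr (D.mem_bdry.2 ⟨hu, h, hni⟩)
      · have hp := D.par_lt s hs h0
        have hc := D.climb s hs _ h u hu (D.top_mem u hn)
        exact D.mem_partVerts.1 (ih _ hp (by omega) h2 hc)

theorem edge_lt {u v : ℕ} (he : s(u, v) ∈ G.edges) : u < D.n ∧ v < D.n := by
  have h := G.mem_verts _ he
  rw [D.verts] at h
  exact ⟨by simpa using h u (by simp), by simpa using h v (by simp)⟩

/-- Both ends climb together from a common bag until the later of their first nodes. -/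
theorem edge_bag {u v : ℕ} (he : s(u, v) ∈ G.edges) (huv : D.top u ≤ D.top v) :
    u ∈ D.bag (D.top v) := by
  obtain ⟨t, ht, hb⟩ := D.edge _ he
  have hu := hb u (by simp)
  have hv := hb v (by simp)
  induction t using Nat.strong_induction_on with
  | _ t ih =>
    rcases eq_or_lt_of_le (D.top_le t ht v hv) with h | h
    · rw [h]; exact hu
    · have hp := D.par_lt t ht (by omega)
      have hu' := D.climb t ht (D.top u) (by omega) u hu (D.top_mem u (D.edge_lt he).1)
      have hv' := D.climb t ht _ h v hv (D.top_mem v (D.edge_lt he).2)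
      refine ih _ hp (by omega) ?_ hu' hv'
      intro w hw
      rcases Sym2.mem_iff.1 hw with rfl | rfl
      · exact hu'
      · exact hv'

/-- A neighbour of a vertex below `c` is in the part below `c`. -/
theorem neighbour_partVerts {c u v : ℕ} (he : s(u, v) ∈ G.edges) (hv : v ∈ D.below c) :
    u ∈ D.partVerts c := by
  obtain ⟨hun, hvn⟩ := D.edge_lt he
  have hd := (D.mem_below.1 hv).2
  rcases le_total (D.top u) (D.top v) with h | h
  · exact D.mem_partVerts_of_bag (D.top_lt v hvn) hd (D.edge_bag he h) ⟨_, he, by simp⟩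
  · have hb := D.edge_bag (u := v) (v := u) (by rwa [Sym2.eq_swap]) h
    exact D.mem_partVerts.2 (Or.inl (D.mem_below.2 ⟨hun, (hd.trans D (D.desc_top (D.top_lt u hun) hb))⟩))

end RootedDec

/-! ### ## Induced subgraphs, hereditary classes and box sums -/

theorem FinGraph.induce_induce (G : FinGraph) {S T : Finset ℕ} (h : T ⊆ S) :
    (G.induce S).induce T = G.induce T := by
  ext x
  · simp only [induce, Finset.mem_inter]
    exact ⟨fun h' => ⟨h'.1.1, h'.2⟩, fun h' => ⟨⟨h'.1, h h'.2⟩, h'.2⟩⟩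
  · simp only [mem_induce_edges]
    exact ⟨fun h' => ⟨h'.1.1, h'.2⟩, fun h' => ⟨⟨h'.1, fun v hv => h (h'.2 v hv)⟩, h'.2⟩⟩

theorem FinGraph.induce_verts (G : FinGraph) {S : Finset ℕ} (h : S ⊆ G.verts) :
    (G.induce S).verts = S := Finset.inter_eq_right.2 h

/-- A union of induced subgraphs is induced if it contains all edges. -/
theorem FinGraph.induce_union_induce (G : FinGraph) {S T : Finset ℕ}
    (h : ∀ u v, s(u, v) ∈ G.edges → u ∈ S ∪ T → v ∈ S ∪ T → (u ∈ S ∧ v ∈ S) ∨ (u ∈ T ∧ v ∈ T)) :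
    (G.induce S).union (G.induce T) = G.induce (S ∪ T) := by
  ext x
  · simp only [union, induce, Finset.mem_union, Finset.mem_inter]; tauto
  · simp only [union, Finset.mem_union, mem_induce_edges]
    constructor
    · rintro (⟨h1, h2⟩ | ⟨h1, h2⟩)
      · exact ⟨h1, fun v hv => Or.inl (h2 v hv)⟩
      · exact ⟨h1, fun v hv => Or.inr (h2 v hv)⟩
    · rintro ⟨h1, h2⟩
      induction x with
      | _ u v =>
        rcases h u v h1 (Finset.mem_union.2 (h2 u (by simp))) (Finset.mem_union.2 (h2 v (by simp)))
          with ⟨ha, hb⟩ | ⟨ha, hb⟩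
        · refine Or.inl ⟨h1, fun w hw => ?_⟩
          rcases Sym2.mem_iff.1 hw with rfl | rfl <;> assumption
        · refine Or.inr ⟨h1, fun w hw => ?_⟩
          rcases Sym2.mem_iff.1 hw with rfl | rfl <;> assumption

/-- The vertices of `S \ T` are deleted one at a time. -/
theorem GraphClass.Hereditary.induce_mem {H : GraphClass} (hH : H.Hereditary) {G : FinGraph}
    {S T : Finset ℕ} (hS : G.induce S ∈ H.mem) (hT : T ⊆ S) : G.induce T ∈ H.mem := by
  have key : ∀ U : Finset ℕ, G.induce (S \ U) ∈ H.mem := by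
    intro U
    induction U using Finset.induction_on with
    | empty => simpa using hS
    | insert v U _ ih =>
      have := hH _ ih v
      have e : (G.induce (S \ U)).del {v} = G.induce (S \ insert v U) := by
        ext x
        · simp only [FinGraph.del, FinGraph.induce, Finset.mem_inter, Finset.mem_sdiff,
            Finset.mem_insert, Finset.mem_singleton]
          tauto
        · simp only [FinGraph.del, FinGraph.mem_induce_edges, Finset.mem_sdiff, Finset.mem_insert,
            Finset.mem_singleton]
          constructor
          · rintro ⟨⟨h1, h2⟩, h3⟩
            exact ⟨h1, fun w hw => ⟨(h2 w hw).1, fun h => h.elim (h3 w hw).2 (h2 w hw).2⟩⟩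
          · rintro ⟨h1, h2⟩
            refine ⟨⟨h1, fun w hw => ⟨(h2 w hw).1, fun h => (h2 w hw).2 (Or.inr h)⟩⟩,
              fun w hw => ⟨?_, fun h => (h2 w hw).2 (Or.inl h)⟩⟩
            simp only [FinGraph.induce, Finset.mem_inter, Finset.mem_sdiff]
            exact ⟨G.mem_verts _ h1 w hw, (h2 w hw).1, fun h => (h2 w hw).2 (Or.inr h)⟩
      rwa [e] at this
  have := key (S \ T)
  rwa [Finset.sdiff_sdiff_eq_self hT] at this

theorem BGraph.foldr_box (G₀ : BGraph) (parts : List BGraph) :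
    (∀ v, v ∈ (parts.foldr box G₀).graph.verts ↔ v ∈ G₀.graph.verts ∨ ∃ P ∈ parts, v ∈ P.graph.verts) ∧
    (∀ e, e ∈ (parts.foldr box G₀).graph.edges ↔ e ∈ G₀.graph.edges ∨ ∃ P ∈ parts, e ∈ P.graph.edges) ∧
    (∀ v, v ∈ (parts.foldr box G₀).bd ↔ v ∈ G₀.bd ∨ ∃ P ∈ parts, v ∈ P.bd) := by
  induction parts with
  | nil => simp
  | cons P l ih =>
    obtain ⟨h1, h2, h3⟩ := ih
    refine ⟨fun v => ?_, fun v => ?_, fun v => ?_⟩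
    · simp only [List.foldr_cons, box, glue, FinGraph.union, Finset.mem_union, h1, List.mem_cons,
        exists_eq_or_imp]
      tauto
    · simp only [List.foldr_cons, box, glue, FinGraph.union, Finset.mem_union, h2, List.mem_cons,
        exists_eq_or_imp]
      tauto
    · simp only [List.foldr_cons, box, Finset.mem_union, h3, List.mem_cons, exists_eq_or_imp]
      tauto

/-! ### ## The part at a node as a gluing -/

namespace RootedDec

open scoped Classical

variable {H : GraphClass} {G : FinGraph} (D : RootedDec H G)

theorem bag_lt' {t v : ℕ} (h : v ∈ D.bag t) : v < D.n := by
  rcases lt_or_ge t D.N with ht | ht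
  · exact D.bag_lt t ht v h
  · rw [bag, D.bag_nil t ht] at h; simp at h

theorem partVerts_sub (t : ℕ) : D.partVerts t ⊆ G.verts := by
  intro v hv
  rw [D.verts, Finset.mem_range]
  rcases D.mem_partVerts.1 hv with h | h
  · exact (D.mem_below.1 h).1
  · exact D.bag_lt' (D.mem_bdry.1 h).1

theorem piece_sub (t : ℕ) : (D.piece t).toFinset ⊆ G.verts := by
  intro v hv
  rw [D.verts, Finset.mem_range]
  exact D.bag_lt' (D.piece_bag (List.mem_toFinset.1 hv))

theorem cut_sub (t : ℕ) : (D.cut t).toFinset ⊆ G.verts := by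
  intro v hv
  rw [D.verts, Finset.mem_range]
  exact D.bag_lt' (D.cut_bag (List.mem_toFinset.1 hv))

/-- The part of the graph at and below the node `t`. -/
noncomputable def part (t : ℕ) : BGraph where
  graph := G.induce (D.partVerts t)
  bd := (D.bdry t).toFinset
  bd_sub := by
    rw [G.induce_verts (D.partVerts_sub t)]; exact Finset.subset_union_right

noncomputable def innerVerts (t : ℕ) : Finset ℕ :=
  (D.cut t).toFinset ∪ (D.children t).toFinset.biUnion fun j => D.partVerts (j + 1)

theorem mem_innerVerts {t v : ℕ} : v ∈ D.innerVerts t ↔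
    v ∈ D.cut t ∨ ∃ j ∈ D.children t, v ∈ D.partVerts (j + 1) := by simp [innerVerts]

theorem innerVerts_sub (t : ℕ) : D.innerVerts t ⊆ G.verts :=
  Finset.union_subset (D.cut_sub t) (Finset.biUnion_subset.2 fun j _ => D.partVerts_sub (j + 1))

/-- The parts below the node `t` with the boundary at `t`. -/
noncomputable def inner (t : ℕ) : BGraph where
  graph := G.induce (D.innerVerts t)
  bd := (D.cut t).toFinset
  bd_sub := by
    rw [G.induce_verts (D.innerVerts_sub t)]; exact Finset.subset_union_left

/-- The graph at the node `t`. -/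
noncomputable def outer (t : ℕ) (ht : t < D.N) : BGraph where
  graph := G.induce (D.piece t).toFinset
  bd := (D.cut t).toFinset
  bd_sub := by
    rw [G.induce_verts (D.piece_sub t)]
    exact fun v hv => List.mem_toFinset.2 (D.cut_piece ht (List.mem_toFinset.1 hv))

/-- The parts of the children. -/
noncomputable def parts (t : ℕ) : List BGraph := (D.children t).map fun j => D.part (j + 1)

theorem top_gt_of_below {j t v : ℕ} (hj : j ∈ D.children t) (hv : v ∈ D.below (j + 1)) :
    t < D.top v := by
  obtain ⟨h1, h2⟩ := D.mem_children.1 hj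
  have := D.below_lt hv
  have := D.par_lt _ h1 (by omega)
  omega

theorem partVerts_cases {j t v : ℕ} (hj : j ∈ D.children t) (hv : v ∈ D.partVerts (j + 1))
    (hle : D.top v ≤ t) : v ∈ D.bdry (j + 1) := by
  rcases D.mem_partVerts.1 hv with h | h
  · have := D.top_gt_of_below hj h; omega
  · exact h

theorem children_nodup (t : ℕ) : (D.children t).Nodup := List.nodup_range.filter _

/-- Parts of different children meet only in their boundaries because their subtrees are disjoint.
An edge with an end below a child is in the part of that child by `neighbour_partVerts`; any other
edge joins vertices of the cut. -/
theorem inner_isBoxSum (t : ℕ) : (D.inner t).IsBoxSum (D.parts t) := by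
  have hcore : (D.inner t).core.graph = G.induce (D.cut t).toFinset :=
    G.induce_induce Finset.subset_union_left
  refine ⟨List.pairwise_cons.2 ⟨?_, ?_⟩, ?_⟩
  · intro P hP
    obtain ⟨j, hj, rfl⟩ := List.mem_map.1 hP
    intro v hv
    rw [hcore, G.induce_verts (D.cut_sub t)] at hv
    obtain ⟨h1, h2⟩ := Finset.mem_inter.1 hv
    refine Finset.mem_inter.2 ⟨h1, List.mem_toFinset.2 ?_⟩
    have h2 : v ∈ D.partVerts (j + 1) := by
      rwa [part, G.induce_verts (D.partVerts_sub _)] at h2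
    exact D.partVerts_cases hj h2 (D.cut_top (List.mem_toFinset.1 h1))
  · refine List.pairwise_map.2 ((D.children_nodup t).imp_of_mem ?_)
    intro i j hi hj hne v hv
    simp only [part, G.induce_verts (D.partVerts_sub _)] at hv ⊢
    obtain ⟨h1, h2⟩ := Finset.mem_inter.1 hv
    simp only [Finset.mem_inter, List.mem_toFinset]
    -- A vertex below both children would identify them. A vertex on the boundary of one child
    -- appears at `t` or earlier, too early to be below the other.
    rcases D.mem_partVerts.1 h1 with h3 | h3 <;> rcases D.mem_partVerts.1 h2 with h4 | h4
    · obtain ⟨hvn, h5⟩ := D.mem_below.1 h3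
      obtain ⟨-, h6⟩ := D.mem_below.1 h4
      have := D.children_disjoint (by omega) (D.mem_children.1 hi).2 (by omega)
        (D.mem_children.1 hj).2 h5 h6 (D.top_lt v hvn)
      omega
    · have := D.top_gt_of_below hi h3
      have := (D.bdry_child_bag hj h4).2
      omega
    · have := D.top_gt_of_below hj h4
      have := (D.bdry_child_bag hi h3).2
      omega
    · exact ⟨h3, h4⟩
  · obtain ⟨e1, e2, e3⟩ := BGraph.foldr_box (D.inner t).core (D.parts t)
    have hpv : ∀ j, (D.part j).graph.verts = D.partVerts j := fun j => G.induce_verts (D.partVerts_sub j)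
    ext x
    · rw [e1, hcore, G.induce_verts (D.cut_sub t)]
      simp only [inner, G.induce_verts (D.innerVerts_sub t), D.mem_innerVerts, parts, List.mem_map,
        List.mem_toFinset, exists_exists_and_eq_and, hpv]
    · rw [e2, hcore]
      simp only [inner, parts, List.mem_map, exists_exists_and_eq_and, part,
        FinGraph.mem_induce_edges]
      constructor
      · rintro ⟨h1, h2⟩
        induction x with
        | _ u v =>
        by_cases hc : ∃ w ∈ s(u, v), ∃ j ∈ D.children t, w ∈ D.below (j + 1)
        · obtain ⟨w, hw, j, hj, hwb⟩ := hc
          refine Or.inr ⟨j, hj, h1, fun x hx => ?_⟩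
          by_cases hxw : x = w
          · subst hxw; exact D.mem_partVerts.2 (Or.inl hwb)
          · have : s(u, v) = s(x, w) := ((Sym2.mem_and_mem_iff hxw).1 ⟨hx, hw⟩)
            exact D.neighbour_partVerts (this ▸ h1) hwb
        · push Not at hc
          refine Or.inl ⟨h1, fun x hx => List.mem_toFinset.2 ?_⟩
          rcases D.mem_innerVerts.1 (h2 x hx) with h | ⟨j, hj, h⟩
          · exact h
          · rcases D.mem_partVerts.1 h with h | h
            · exact absurd h (hc x hx j hj)
            · exact D.bdry_child_cut hj h
      · rintro (⟨h1, h2⟩ | ⟨j, hj, h1, h2⟩)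
        · exact ⟨h1, fun v hv => D.mem_innerVerts.2 (Or.inl (List.mem_toFinset.1 (h2 v hv)))⟩
        · exact ⟨h1, fun v hv => D.mem_innerVerts.2 (Or.inr ⟨j, hj, h2 v hv⟩)⟩
    · rw [e3]
      simp only [inner, BGraph.core, parts, List.mem_map, exists_exists_and_eq_and, part,
        List.mem_toFinset]
      exact ⟨Or.inl, fun h => h.elim id fun ⟨j, hj, h⟩ => D.bdry_child_cut hj h⟩

theorem outer_compatible {t : ℕ} (ht : t < D.N) : (D.outer t ht).Compatible (D.inner t) := by
  refine ⟨rfl, ?_⟩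
  simp only [outer, inner]
  rw [G.induce_induce, G.induce_induce]
  · exact Finset.subset_union_left
  · exact fun v hv => List.mem_toFinset.2 (D.cut_piece ht (List.mem_toFinset.1 hv))

/-- Vertices of the piece appear at `t` or earlier, so in the part of a child they lie on its
boundary. -/
theorem inner_glueable {t : ℕ} (ht : t < D.N) : (D.inner t).Glueable (D.outer t ht) := by
  intro v hv
  simp only [outer, inner, G.induce_verts (D.innerVerts_sub t), G.induce_verts (D.piece_sub t),
    Finset.mem_inter, List.mem_toFinset, D.mem_innerVerts] at hv ⊢
  have : v ∈ D.cut t := by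
    rcases hv with ⟨h | ⟨j, hj, h⟩, h2⟩
    · exact h
    · exact D.bdry_child_cut hj (D.partVerts_cases hj h (D.piece_top h2))
  exact ⟨this, this⟩

theorem innerVerts_union {t : ℕ} (ht : t < D.N) :
    D.innerVerts t ∪ (D.piece t).toFinset = D.partVerts t := by
  ext v
  simp only [Finset.mem_union, D.mem_innerVerts, List.mem_toFinset]
  constructor
  · have hp : v ∈ D.piece t → v ∈ D.partVerts t := by
      intro h
      rw [D.mem_partVerts]
      rcases List.mem_append.1 h with h | h
      · exact Or.inr h
      · obtain ⟨h1, rfl⟩ := D.mem_own.1 h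
        exact Or.inl (D.mem_below.2 ⟨h1, .refl⟩)
    rintro ((h | ⟨j, hj, h⟩) | h)
    · exact hp (D.cut_piece ht h)
    · rcases D.mem_partVerts.1 h with h | h
      · obtain ⟨h1, h2⟩ := D.mem_below.1 h
        exact D.mem_partVerts.2 (Or.inl (D.mem_below.2 ⟨h1, .tail h2 ⟨by omega, (D.mem_children.1 hj).2⟩⟩))
      · exact hp (D.cut_piece ht (D.bdry_child_cut hj h))
    · exact hp h
  · intro h
    rcases D.mem_partVerts.1 h with h | h
    · obtain ⟨h1, h2⟩ := D.mem_below.1 h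
      rcases D.desc_iff.1 h2 with h3 | ⟨c, h0, hc, h3⟩
      · exact Or.inr (List.mem_append_right _ (D.mem_own.2 ⟨h1, h3⟩))
      · obtain ⟨h4, h5⟩ := D.child_lt h0 hc h3 (D.top_lt v h1)
        obtain ⟨j, rfl⟩ := Nat.exists_eq_succ_of_ne_zero h0
        exact Or.inl (Or.inr ⟨j, D.mem_children.2 ⟨h5, hc⟩, D.mem_partVerts.2 (Or.inl (D.mem_below.2 ⟨h1, h3⟩))⟩)
    · exact Or.inr (List.mem_append_left _ h)

/-- A vertex of `inner t` outside the piece is below a child, so its neighbours are in `inner t`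
too. Hence no edge joins the two sides away from the cut, and the union is induced. -/
theorem inner_glue_outer {t : ℕ} (ht : t < D.N) :
    (D.inner t).glue (D.outer t ht) = (D.part t).graph := by
  have key : ∀ u v, s(u, v) ∈ G.edges → u ∈ D.innerVerts t → u ∉ D.piece t →
      u ∈ D.innerVerts t ∧ v ∈ D.innerVerts t := by
    intro u v he hu hup
    refine ⟨hu, ?_⟩
    rcases D.mem_innerVerts.1 hu with h | ⟨j, hj, h⟩
    · exact absurd (D.cut_piece ht h) hup
    · rcases D.mem_partVerts.1 h with h | h
      · exact D.mem_innerVerts.2 (Or.inr ⟨j, hj, D.neighbour_partVerts (by rwa [Sym2.eq_swap]) h⟩)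
      · exact absurd (D.cut_piece ht (D.bdry_child_cut hj h)) hup
  simp only [BGraph.glue, inner, outer, part]
  rw [G.induce_union_induce, D.innerVerts_union ht]
  intro u v he hu hv
  simp only [Finset.mem_union, List.mem_toFinset] at hu hv ⊢
  by_cases hup : u ∈ D.piece t
  · by_cases hvp : v ∈ D.piece t
    · exact Or.inr ⟨hup, hvp⟩
    · exact Or.inl (key v u (by rwa [Sym2.eq_swap]) (hv.resolve_right hvp) hvp).symm
  · exact Or.inl (key u v he (hu.resolve_right hup) hup)

/-- Only new vertices of `β(t)` remain, and `H` is hereditary. -/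
theorem piece_del_mem (hH : H.Hereditary) {t : ℕ} (ht : t < D.N) :
    (G.induce (D.piece t).toFinset).del (D.bdry t ++ D.ownA t).toFinset ∈ H.mem := by
  rw [FinGraph.del, G.induce_verts (D.piece_sub t), G.induce_induce Finset.sdiff_subset]
  refine hH.induce_mem (D.mem_class t ht) fun v hv => ?_
  simp only [Finset.mem_sdiff, List.mem_toFinset, List.mem_append, not_or] at hv
  obtain ⟨h1, h2, h3⟩ := hv
  have h4 := D.mem_own.1 ((List.mem_append.1 h1).resolve_left h2)
  refine List.mem_toFinset.2 ((List.mem_append.1 (D.piece_bag h1)).resolve_left fun h => h3 ?_)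
  exact List.mem_filter.2 ⟨h, by simpa using h4.2⟩

/-- The premise of the modulator condition of a nice reduction at this node. -/
theorem outer_del_mem (hH : H.Hereditary) {t : ℕ} (ht : t < D.N) :
    (((D.outer t ht).glue (D.inner t)).induce (D.outer t ht).graph.verts).del
      (D.bdry t ++ D.ownA t).toFinset ∈ H.mem := by
  have e : (D.outer t ht).glue (D.inner t) = (D.part t).graph := by
    rw [← D.inner_glue_outer ht]
    ext x <;> simp [BGraph.glue, FinGraph.union, or_comm]
  rw [e]
  simp only [outer, G.induce_verts (D.piece_sub t), part]
  rw [G.induce_induce]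
  · exact D.piece_del_mem hH ht
  · rw [← D.innerVerts_union ht]; exact Finset.subset_union_right

/-- A boundary vertex of a child that is not in `A` lies in `β(t)`, and adhesion permits one. -/
theorem parts_bd_card {t : ℕ} :
    ∀ P ∈ D.parts t, (P.bd \ (D.bdry t ++ D.ownA t).toFinset).card ≤ 1 := by
  intro P hP
  obtain ⟨j, hj, rfl⟩ := List.mem_map.1 hP
  obtain ⟨h1, h2⟩ := D.mem_children.1 hj
  refine le_trans (Finset.card_le_card fun v hv => ?_) (D.adhesion_up _ h1 (by omega))
  simp only [Finset.mem_sdiff, part, List.mem_toFinset] at hv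
  have hc := D.bdry_child_cut hj hv.1
  rw [cut, List.mem_append] at hc
  have hB := hc.resolve_left hv.2
  rw [h2]
  exact Finset.mem_inter.2 ⟨List.mem_toFinset.2 (D.mem_bdry.1 hv.1).1,
    List.mem_toFinset.2 (List.mem_filter.1 hB).1⟩

theorem cut_nodup {t : ℕ} (ht : t < D.N) : (D.cut t).Nodup := by
  have h := D.nodup t ht
  obtain ⟨ha, hb, hab⟩ := List.nodup_append'.1 h
  have h1 : (D.bdry t).Nodup := h.filter _
  refine List.nodup_append'.2 ⟨List.nodup_append'.2 ⟨h1, ha.filter _, ?_⟩, hb.filter _, ?_⟩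
  · intro v hv hv'
    have := D.bdry_top hv
    have := (List.mem_filter.1 hv').2
    simp at this; omega
  · intro v hv hv'
    have h2 := (List.mem_filter.1 hv').2
    simp at h2
    rcases List.mem_append.1 hv with h3 | h3
    · have := D.bdry_top h3; omega
    · exact hab (List.mem_filter.1 h3).1 (List.mem_filter.1 hv').1

theorem own_nodup (t : ℕ) : (D.own t).Nodup := List.nodup_range.filter _

theorem piece_nodup {t : ℕ} (ht : t < D.N) : (D.piece t).Nodup := by
  refine List.nodup_append'.2 ⟨(D.nodup t ht).filter _, D.own_nodup t, ?_⟩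
  intro v hv hv'
  have := D.bdry_top hv
  have := (D.mem_own.1 hv').2
  omega

end RootedDec

/-! ### ## The edges of a piece -/

theorem innerEdges_succ (row adj : ℕ → ℕ) (l : List ℕ) (k : ℕ) :
    innerEdges row adj l (k + 1) = innerEdges row adj l k ++
      ((l.take k).filter fun v => adj (row (l.getD k 0) + v) ≠ 0).map (l.getD k 0, ·) := by
  simp [innerEdges, List.range_succ]

theorem innerEdges_length_le (row adj : ℕ → ℕ) (l : List ℕ) (k : ℕ) :
    (innerEdges row adj l k).length ≤ k * l.length := by
  induction k with
  | zero => simp [innerEdges]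
  | succ k ih =>
    rw [innerEdges_succ, List.length_append, List.length_map, add_mul, one_mul]
    refine Nat.add_le_add ih ((List.length_filter_le _ _).trans ?_)
    simp

theorem toEdges_append (l l' : List (ℕ × ℕ)) : toEdges (l ++ l') = toEdges l ++ toEdges l' := by
  simp [toEdges]

/-- An edge is produced exactly once, when its later end in the list is treated. -/
theorem innerEdges_spec {row adj : ℕ → ℕ} {G : FinGraph} {l : List ℕ} (hl : l.Nodup)
    (hadj : ∀ u ∈ l, ∀ v ∈ l, adj (row u + v) ≠ 0 ↔ s(u, v) ∈ G.edges) (k : ℕ) (hk : k ≤ l.length) :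
    (toEdges (innerEdges row adj l k)).Nodup ∧
      ∀ e, e ∈ toEdges (innerEdges row adj l k) ↔ e ∈ G.edges ∧ ∀ w ∈ e, w ∈ l.take k := by
  induction k with
  | zero =>
    refine ⟨by simp [innerEdges, toEdges], fun e => ?_⟩
    induction e with
    | _ u v =>
      simp only [innerEdges, toEdges, List.range_zero, List.flatMap_nil, List.map_nil,
        List.not_mem_nil, List.take_zero, false_iff, not_and]
      exact fun _ h => h u (by simp)
  | succ k ih =>
    obtain ⟨h1, h2⟩ := ih (by omega)
    have hx : l.getD k 0 = l[k] := by simp [show k < l.length by omega]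
    rw [innerEdges_succ, toEdges_append, take_succ_eq _ _ (by omega), hx]
    have hxk : l[k] ∉ l.take k := by
      have := (List.nodup_append'.1 ((take_succ_eq l k (by omega)) ▸ hl.sublist (List.take_sublist _ _))).2.2
      exact fun h => this h (by simp)
    have hnew : ∀ e, e ∈ toEdges (((l.take k).filter fun v => adj (row l[k] + v) ≠ 0).map (l[k], ·)) ↔
        ∃ v ∈ l.take k, s(l[k], v) ∈ G.edges ∧ e = s(l[k], v) := by
      intro e
      simp only [toEdges, List.map_map, List.mem_map, List.mem_filter, Function.comp,
        decide_eq_true_eq]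
      constructor
      · rintro ⟨v, ⟨hv, ha⟩, rfl⟩
        exact ⟨v, hv, (hadj _ (List.getElem_mem _) _ (List.mem_of_mem_take hv)).1 ha, rfl⟩
      · rintro ⟨v, hv, ha, rfl⟩
        exact ⟨v, ⟨hv, (hadj _ (List.getElem_mem _) _ (List.mem_of_mem_take hv)).2 ha⟩, rfl⟩
    constructor
    · refine List.nodup_append'.2 ⟨h1, ?_, ?_⟩
      · rw [toEdges, List.map_map]
        refine List.Nodup.map_on ?_ ((hl.sublist (List.take_sublist _ _)).filter _)
        intro x _ y _ hxy
        exact Sym2.congr_right.1 hxy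
      · intro e he he'
        obtain ⟨v, -, -, rfl⟩ := (hnew e).1 he'
        exact hxk (((h2 _).1 he).2 _ (by simp))
    · intro e
      rw [List.mem_append, h2, hnew]
      constructor
      · rintro (⟨ha, hb⟩ | ⟨v, hv, ha, rfl⟩)
        · exact ⟨ha, fun w hw => List.mem_append_left _ (hb w hw)⟩
        · refine ⟨ha, fun w hw => ?_⟩
          rcases Sym2.mem_iff.1 hw with rfl | rfl
          · exact List.mem_append_right _ (by simp)
          · exact List.mem_append_left _ hv
      · rintro ⟨ha, hb⟩
        by_cases hxe : l[k] ∈ e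
        · obtain ⟨v, rfl⟩ := hxe
          refine Or.inr ⟨v, ?_, ha, rfl⟩
          have := hb v (by simp)
          rw [List.mem_append, List.mem_singleton] at this
          refine this.resolve_right ?_
          rintro rfl
          exact G.not_diag _ ha (by simp)
        · refine Or.inl ⟨ha, fun w hw => ?_⟩
          have := hb w hw
          rw [List.mem_append, List.mem_singleton] at this
          refine this.resolve_right ?_
          rintro rfl
          exact hxe hw

namespace RootedDec

open scoped Classical

variable {H : GraphClass} {G : FinGraph} (D : RootedDec H G)

/-- The indices of the edges that appear first in the bag of `t`. -/
def ownEdges (es : List (ℕ × ℕ)) (t : ℕ) : List ℕ :=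
  (List.range es.length).filter fun i => max (D.top (es.getD i (0, 0)).1) (D.top (es.getD i (0, 0)).2) = t

/-- The edges of the graph at the node `t`. -/
noncomputable def pieceEdges (row adj : ℕ → ℕ) (es : List (ℕ × ℕ)) (t : ℕ) : List (ℕ × ℕ) :=
  (D.ownEdges es t).map (fun i => es.getD i (0, 0)) ++
    innerEdges row adj (D.bdry t) (D.bdry t).length

/-- All vertices of the piece have `top` at most `t`. If both ends of an edge are strictly earlier,
the edge lies inside the boundary; otherwise it is new at `t`. -/
theorem listsEdges_pieceEdges {row adj : ℕ → ℕ} {es : List (ℕ × ℕ)} (hes : ListsEdges es G.edges)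
    (hadj : ∀ u < D.n, ∀ v < D.n, adj (row u + v) ≠ 0 ↔ s(u, v) ∈ G.edges) {t : ℕ} (ht : t < D.N) :
    ListsEdges (D.pieceEdges row adj es t) (G.induce (D.piece t).toFinset).edges := by
  have hmemE : ∀ e, e ∈ G.edges ↔ ∃ i, ∃ h : i < es.length, e = s(es[i].1, es[i].2) := by
    intro e
    rw [← hes.2, List.mem_toFinset, toEdges, List.mem_map]
    constructor
    · rintro ⟨x, hx, rfl⟩
      obtain ⟨i, h, rfl⟩ := List.mem_iff_getElem.1 hx
      exact ⟨i, h, rfl⟩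
    · rintro ⟨i, h, rfl⟩
      exact ⟨_, List.getElem_mem h, rfl⟩
  have hbn : (D.bdry t).Nodup := (D.nodup t ht).filter _
  obtain ⟨hin, him⟩ := innerEdges_spec (row := row) (adj := adj) (G := G) hbn (fun u hu v hv =>
    hadj u (D.bag_lt' (D.mem_bdry.1 hu).1) v (D.bag_lt' (D.mem_bdry.1 hv).1)) _ le_rfl
  rw [List.take_length] at him
  have hown : ∀ e, e ∈ toEdges ((D.ownEdges es t).map fun i => es.getD i (0, 0)) ↔
      ∃ i, ∃ h : i < es.length, max (D.top es[i].1) (D.top es[i].2) = t ∧ e = s(es[i].1, es[i].2) := by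
    intro e
    simp only [toEdges, List.map_map, List.mem_map, ownEdges, List.mem_filter, List.mem_range,
      Function.comp, decide_eq_true_eq]
    constructor
    · rintro ⟨i, ⟨h, h1⟩, rfl⟩
      simp only [List.getD_eq_getElem _ _ h] at h1 ⊢
      exact ⟨i, h, h1, rfl⟩
    · rintro ⟨i, h, h1, rfl⟩
      refine ⟨i, ⟨h, ?_⟩, ?_⟩
      · simpa only [List.getD_eq_getElem _ _ h] using h1
      · simp only [List.getD_eq_getElem _ _ h]
  refine ⟨?_, ?_⟩
  · rw [pieceEdges, toEdges_append]
    refine List.nodup_append'.2 ⟨?_, hin, ?_⟩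
    · rw [toEdges, List.map_map]
      refine List.Nodup.map_on ?_ (List.nodup_range.filter _)
      intro i hi j hj hij
      have hi := List.mem_range.1 (List.mem_filter.1 hi).1
      have hj := List.mem_range.1 (List.mem_filter.1 hj).1
      simp only [Function.comp, List.getD_eq_getElem _ _ hi, List.getD_eq_getElem _ _ hj] at hij
      refine (List.Nodup.getElem_inj_iff hes.1 (hi := by simpa [toEdges] using hi)
        (hj := by simpa [toEdges] using hj)).1 ?_
      simpa [toEdges] using hij
    · intro e he he'
      obtain ⟨i, h, h1, rfl⟩ := (hown e).1 he
      have h2 := D.bdry_top (((him _).1 he').2 es[i].1 (by simp))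
      have h3 := D.bdry_top (((him _).1 he').2 es[i].2 (by simp))
      omega
  · ext e
    rw [pieceEdges, toEdges_append, List.mem_toFinset, List.mem_append, hown, him,
      FinGraph.mem_induce_edges]
    constructor
    · rintro (⟨i, h, h1, rfl⟩ | ⟨h1, h2⟩)
      · have he := (hmemE _).2 ⟨i, h, rfl⟩
        have key : ∀ u v, s(u, v) ∈ G.edges → D.top u ≤ D.top v → D.top v = t →
            u ∈ D.piece t ∧ v ∈ D.piece t := by
          rintro u v he hle rfl
          exact ⟨(D.mem_piece_iff ht ⟨_, he, by simp⟩).2 (D.edge_bag he hle),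
            (D.mem_piece_iff ht ⟨_, he, by simp⟩).2 (D.top_mem v (D.edge_lt he).2)⟩
        have : es[i].1 ∈ D.piece t ∧ es[i].2 ∈ D.piece t := by
          rcases le_total (D.top es[i].1) (D.top es[i].2) with hle | hle
          · exact key _ _ he hle (by omega)
          · exact (key _ _ (by rwa [Sym2.eq_swap]) hle (by omega)).symm
        refine ⟨he, fun w hw => List.mem_toFinset.2 ?_⟩
        rcases Sym2.mem_iff.1 hw with rfl | rfl
        exacts [this.1, this.2]
      · exact ⟨h1, fun w hw => List.mem_toFinset.2 (List.mem_append_left _ (h2 w hw))⟩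
    · rintro ⟨h1, h2⟩
      obtain ⟨i, h, rfl⟩ := (hmemE _).1 h1
      have h3 := List.mem_toFinset.1 (h2 es[i].1 (by simp))
      have h4 := List.mem_toFinset.1 (h2 es[i].2 (by simp))
      by_cases hm : max (D.top es[i].1) (D.top es[i].2) = t
      · exact Or.inl ⟨i, h, hm, rfl⟩
      · have l3 := D.piece_top h3
        have l4 := D.piece_top h4
        refine Or.inr ⟨h1, fun w hw => ?_⟩
        rcases Sym2.mem_iff.1 hw with rfl | rfl
        · exact (List.mem_append.1 h3).resolve_right fun h => by have := (D.mem_own.1 h).2; omega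
        · exact (List.mem_append.1 h4).resolve_right fun h => by have := (D.mem_own.1 h).2; omega

/-! ## Sizes -/

theorem own_card (t : ℕ) : (D.own t).length =
    ((Finset.range D.n).filter fun v => D.top v = t).card := by
  rw [own, ← List.toFinset_card_of_nodup (List.nodup_range.filter _)]
  congr 1
  ext v; simp

/-- The fibres of `top` partition the vertices. -/
theorem sum_own : ∑ t ∈ Finset.range D.N, (D.own t).length = D.n := by
  simp only [own_card]
  rw [← Finset.card_eq_sum_card_fiberwise (f := D.top)]
  · simp
  · intro v hv
    simpa using D.top_lt v (by simpa using hv)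

theorem sum_ownEdges {es : List (ℕ × ℕ)} (hes : ListsEdges es G.edges) :
    ∑ t ∈ Finset.range D.N, (D.ownEdges es t).length = es.length := by
  have : ∀ t, (D.ownEdges es t).length = ((Finset.range es.length).filter fun i =>
      max (D.top (es.getD i (0, 0)).1) (D.top (es.getD i (0, 0)).2) = t).card := by
    intro t
    rw [ownEdges, ← List.toFinset_card_of_nodup (List.nodup_range.filter _)]
    congr 1
    ext v; simp
  simp only [this]
  rw [← Finset.card_eq_sum_card_fiberwise
    (f := fun i => max (D.top (es.getD i (0, 0)).1) (D.top (es.getD i (0, 0)).2))]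
  · simp
  · intro i hi
    have hi : i < es.length := by simpa using hi
    have he : s(es[i].1, es[i].2) ∈ G.edges := by
      rw [← hes.2, List.mem_toFinset]; exact List.mem_map.2 ⟨_, List.getElem_mem hi, rfl⟩
    have := D.edge_lt he
    simp only [List.getD_eq_getElem _ _ hi, Finset.coe_range, Set.mem_Iio]
    exact max_lt (D.top_lt _ this.1) (D.top_lt _ this.2)

theorem sum_children : ∑ t ∈ Finset.range D.N, (D.children t).length = D.N - 1 := by
  have : ∀ t, (D.children t).length = ((Finset.range (D.N - 1)).filter fun j => D.par (j + 1) = t).card := by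
    intro t
    rw [children, ← List.toFinset_card_of_nodup (List.nodup_range.filter _)]
    congr 1
    ext v; simp
  simp only [this]
  rw [← Finset.card_eq_sum_card_fiberwise (f := fun j => D.par (j + 1))]
  · simp
  · intro j hj
    have hj : j < D.N - 1 := by simpa using hj
    have := D.par_lt (j + 1) (by omega) (by omega)
    simp only [Finset.coe_range, Set.mem_Iio]
    omega

theorem bdry_zero : D.bdry 0 = [] := by
  rw [List.eq_nil_iff_forall_not_mem]
  intro v hv
  have := D.bdry_top hv
  omega

theorem part_zero : (D.part 0).graph = G := by
  have : D.partVerts 0 = G.verts := by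
    refine (D.partVerts_sub 0).antisymm fun v hv => ?_
    rw [D.verts, Finset.mem_range] at hv
    exact D.mem_partVerts.2 (Or.inl (D.mem_below.2 ⟨hv, D.desc_root (D.top_lt v hv)⟩))
  show G.induce (D.partVerts 0) = G
  rw [this]
  ext x
  · simp [FinGraph.induce]
  · rw [FinGraph.mem_induce_edges]
    exact ⟨fun h => h.1, fun h => ⟨h, G.mem_verts x h⟩⟩

/-- Few vertices of a bag that are not annotated have appeared before. -/
theorem old_card {t : ℕ} (ht : t < D.N) :
    ((D.bs t).filter fun v => D.top v < t).length ≤ 1 := by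
  have hnd := (List.nodup_append'.1 (D.nodup t ht)).2.1
  rcases eq_or_ne t 0 with rfl | h0
  · simp
  · rw [← List.toFinset_card_of_nodup (hnd.filter _)]
    refine le_trans (Finset.card_le_card fun v hv => ?_) (D.adhesion_down t ht h0)
    simp only [List.mem_toFinset, List.mem_filter, decide_eq_true_eq] at hv
    have hb : v ∈ D.as t ++ D.bs t := List.mem_append_right _ hv.1
    refine Finset.mem_inter.2 ⟨List.mem_toFinset.2 ?_, List.mem_toFinset.2 hv.1⟩
    exact D.climb t ht _ hv.2 v hb (D.top_mem v (D.bag_lt t ht v hb))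

theorem filter_or_length {α : Type*} (l : List α) (q r : α → Bool) (h : ∀ x ∈ l, q x → r x → False) :
    (l.filter q).length + (l.filter r).length ≤ l.length := by
  induction l with
  | nil => simp
  | cons x l ih =>
    have := ih fun y hy => h y (by simp [hy])
    have hx := h x (by simp)
    cases hq : q x <;> cases hr : r x <;> simp [hq, hr] at hx ⊢ <;> omega

theorem filter_imp_length {α : Type*} (l : List α) (q r : α → Bool) (h : ∀ x ∈ l, q x → r x) :
    (l.filter q).length ≤ (l.filter r).length := by
  induction l with
  | nil => simp
  | cons x l ih =>
    have := ih fun y hy => h y (by simp [hy])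
    have hx := h x (by simp)
    cases hq : q x <;> cases hr : r x <;> simp [hq, hr] at hx ⊢ <;> omega

/-- The set `α(t)` contributes at most `k` vertices, old or new, and `β(t)` at most one old vertex.
-/
theorem annotated_length {t : ℕ} (ht : t < D.N) : (D.bdry t ++ D.ownA t).length ≤ D.k + 1 := by
  have h1 := D.old_card ht
  have h2 := D.width t ht
  have h3 := filter_or_length (D.as t) (fun v => decide (D.top v < t ∧ NonIsolated G v))
    (fun v => decide (D.top v = t)) (by intro v _; simp; intro a _ b; omega)
  have h4 := filter_imp_length (D.bs t) (fun v => decide (D.top v < t ∧ NonIsolated G v))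
    (fun v => decide (D.top v < t)) (by intro v _; simp; intro a _; omega)
  rw [bdry, ownA, bag, List.filter_append, List.length_append, List.length_append]
  omega

/-- All vertices of `β(t)` but at most one are new. -/
theorem bag_length {t : ℕ} (ht : t < D.N) : (D.bag t).length ≤ (D.own t).length + (D.k + 1) := by
  have h1 := D.old_card ht
  have h2 := D.width t ht
  have h5 : ((D.bs t).filter fun v => ¬ D.top v < t).length ≤ (D.own t).length := by
    have hnd := (List.nodup_append'.1 (D.nodup t ht)).2.1
    rw [← List.toFinset_card_of_nodup (hnd.filter _), ← List.toFinset_card_of_nodup (D.own_nodup t)]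
    refine Finset.card_le_card fun v hv => ?_
    simp only [List.mem_toFinset, List.mem_filter, decide_eq_true_eq] at hv
    have hb : v ∈ D.bag t := List.mem_append_right _ hv.1
    have := D.top_le t ht v hb
    exact List.mem_toFinset.2 (D.mem_own.2 ⟨D.bag_lt' hb, by omega⟩)
  have h6 : (D.bs t).length = ((D.bs t).filter fun v => D.top v < t).length +
      ((D.bs t).filter fun v => ¬ D.top v < t).length := by
    rw [List.length_eq_length_filter_add (fun v => decide (D.top v < t))]
    simp only [decide_not]
  rw [bag, List.length_append]
  omega

theorem piece_length {t : ℕ} (ht : t < D.N) : (D.piece t).length ≤ (D.bag t).length := by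
  rw [← List.toFinset_card_of_nodup (D.piece_nodup ht),
    ← List.toFinset_card_of_nodup (show (D.bag t).Nodup from D.nodup t ht)]
  exact Finset.card_le_card fun v hv => List.mem_toFinset.2 (D.piece_bag (List.mem_toFinset.1 hv))

/-- Each vertex of `B` is charged to a child whose bag contains it; by adhesion a child is charged
at most once. -/
theorem ownB_length {t : ℕ} (ht : t < D.N) : (D.ownB t).length ≤ (D.children t).length := by
  have hnd := (List.nodup_append'.1 (D.nodup t ht)).2.1
  rw [← List.toFinset_card_of_nodup (show (D.ownB t).Nodup from hnd.filter _)]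
  have hsub : (D.ownB t).toFinset ⊆ (D.children t).toFinset.biUnion fun j =>
      (D.as (j + 1) ++ D.bs (j + 1)).toFinset ∩ (D.bs t).toFinset := by
    intro v hv
    obtain ⟨h1, h2⟩ := List.mem_filter.1 (List.mem_toFinset.1 hv)
    simp only [decide_eq_true_eq, List.mem_flatMap] at h2
    obtain ⟨-, j, hj, h3⟩ := h2
    exact Finset.mem_biUnion.2 ⟨j, List.mem_toFinset.2 hj, Finset.mem_inter.2
      ⟨List.mem_toFinset.2 (D.mem_bdry.1 h3).1, List.mem_toFinset.2 h1⟩⟩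
  refine (Finset.card_le_card hsub).trans (Finset.card_biUnion_le.trans ?_)
  rw [← List.toFinset_card_of_nodup (D.children_nodup t), ← mul_one (Finset.card _),
    ← smul_eq_mul]
  refine Finset.sum_le_card_nsmul _ _ _ fun j hj => ?_
  obtain ⟨h1, h2⟩ := D.mem_children.1 (List.mem_toFinset.1 hj)
  have := D.adhesion_up (j + 1) h1 (by omega)
  rwa [h2] at this

/-- An edge has two ends. This is why isolated vertices are excluded from the boundaries: otherwise
their sizes could not be bounded by the number of edges. -/
theorem nonIsolated_length {l : List ℕ} (hl : l.Nodup) (h : ∀ v ∈ l, NonIsolated G v) :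
    l.length ≤ 2 * G.edges.card := by
  rw [← List.toFinset_card_of_nodup hl]
  have : l.toFinset ⊆ G.edges.biUnion fun e => e.toFinset := by
    intro v hv
    obtain ⟨e, he, hve⟩ := h v (List.mem_toFinset.1 hv)
    exact Finset.mem_biUnion.2 ⟨e, he, by simpa using hve⟩
  refine (Finset.card_le_card this).trans (Finset.card_biUnion_le.trans ?_)
  rw [mul_comm, ← smul_eq_mul]
  refine Finset.sum_le_card_nsmul _ _ _ fun e _ => ?_
  rw [Sym2.card_toFinset]; split_ifs <;> omega

theorem bdry_length {t : ℕ} (ht : t < D.N) : (D.bdry t).length ≤ 2 * G.edges.card :=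
  nonIsolated_length ((D.nodup t ht).filter _) fun _ hv => (D.mem_bdry.1 hv).2.2

theorem ownB_length' {t : ℕ} (ht : t < D.N) : (D.ownB t).length ≤ 2 * G.edges.card := by
  refine nonIsolated_length ((List.nodup_append'.1 (D.nodup t ht)).2.1.filter _) fun v hv => ?_
  have h2 := (List.mem_filter.1 hv).2
  simp only [decide_eq_true_eq, List.mem_flatMap] at h2
  obtain ⟨-, j, -, h3⟩ := h2
  exact (D.mem_bdry.1 h3).2.2

theorem pieceEdges_length {row adj : ℕ → ℕ} {es : List (ℕ × ℕ)} {t : ℕ} :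
    (D.ownEdges es t).length ≤ (D.pieceEdges row adj es t).length ∧
    (D.pieceEdges row adj es t).length ≤ (D.ownEdges es t).length + (D.bdry t).length * (D.bdry t).length := by
  have := innerEdges_length_le row adj (D.bdry t) (D.bdry t).length
  rw [pieceEdges, List.length_append, List.length_map]
  omega

end RootedDec

/-! ### ## Preorder: the vertices below a node form an interval -/

/-- The intervals of the children, in increasing order, tile the interval that is left for them. -/
theorem exists_child_interval {par S : ℕ → ℕ} {s : ℕ} (b y : ℕ) (h : y < childSum par S 0 b s) :
    ∃ c < b, c ≠ 0 ∧ par c = s ∧ childSum par S 0 c s ≤ y ∧ y < childSum par S 0 c s + S c := by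
  induction b with
  | zero => simp [childSum] at h
  | succ b ih =>
    rw [childSum_succ] at h
    rcases lt_or_ge y (childSum par S 0 b s) with h1 | h1
    · obtain ⟨c, hc, h2⟩ := ih h1
      exact ⟨c, by omega, h2⟩
    · split_ifs at h with hb
      · exact ⟨b, by omega, hb.1, hb.2, h1, h⟩
      · omega

theorem childSum_mono {par S : ℕ → ℕ} {a b s : ℕ} (h : a ≤ b) :
    childSum par S 0 a s ≤ childSum par S 0 b s :=
  Finset.sum_le_sum_of_subset (Finset.filter_subset_filter _ (Finset.Ico_subset_Ico_right h))

namespace RootedDec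

open scoped Classical

variable {H : GraphClass} {G : FinGraph} (D : RootedDec H G)

/-- `sub t` is the number of vertices below `t`, and `start t` their first place in preorder. -/
structure IsPreorder (sub start : ℕ → ℕ) : Prop where
  sub_eq : ∀ t < D.N, sub t = (D.own t).length + childSum D.par sub 0 D.N t
  start_zero : start 0 = 0
  start_eq : ∀ t < D.N, t ≠ 0 → start t = start (D.par t) + (D.own (D.par t)).length +
    childSum D.par sub 0 t (D.par t)

namespace IsPreorder

variable {D} {sub start : ℕ → ℕ} (h : D.IsPreorder sub start)
include h

/-- Climb from `s` to `t`; the interval of a child lies in that of its parent by the two recursions.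
-/
theorem interval_subset {t s : ℕ} (hd : D.Desc t s) (hs : s < D.N) :
    start t ≤ start s ∧ start s + sub s ≤ start t + sub t := by
  induction hd using Relation.ReflTransGen.head_induction_on with
  | refl => exact ⟨le_rfl, le_rfl⟩
  | @head s c h' _ ih =>
    obtain ⟨h0, rfl⟩ := h'
    have hp := D.par_lt s hs h0
    obtain ⟨i1, i2⟩ := ih (by omega)
    have e1 := h.start_eq s hs h0
    have e2 := h.sub_eq (D.par s) (by omega)
    have e3 := childSum_mono (par := D.par) (S := sub) (s := D.par s) (show s + 1 ≤ D.N by omega)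
    rw [childSum_succ, if_pos ⟨h0, rfl⟩] at e3
    omega

/-- A place in the interval of `t` is in the block of `t` or in the interval of a child, which has a
larger number. -/
theorem exists_own {t : ℕ} (ht : t < D.N) (x : ℕ) (h1 : start t ≤ x) (h2 : x < start t + sub t) :
    ∃ s < D.N, D.Desc t s ∧ ∃ j < (D.own s).length, x = start s + j := by
  obtain ⟨i, hi⟩ : ∃ i, i = D.N - t := ⟨_, rfl⟩
  induction i using Nat.strong_induction_on generalizing t with
  | _ i ih =>
    rcases lt_or_ge x (start t + (D.own t).length) with h3 | h3
    · exact ⟨t, ht, .refl, x - start t, by omega, by omega⟩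
    · have e2 := h.sub_eq t ht
      obtain ⟨c, hc, h0, hp, l1, l2⟩ := exists_child_interval (par := D.par) (S := sub) (s := t) D.N
        (x - start t - (D.own t).length) (by omega)
      have e1 := h.start_eq c hc h0
      rw [hp] at e1
      have hlt := D.par_lt c hc h0
      obtain ⟨s, hs, hd, hj⟩ := ih (D.N - c) (by omega) hc (by omega) (by omega) rfl
      exact ⟨s, hs, .tail hd ⟨h0, hp⟩, hj⟩

/-- Sum the recursion over all nodes: every node but the root is a child exactly once, so only `sub
0` and the total number of new vertices remain. -/
theorem sub_zero : sub 0 = D.n := by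
  have e1 : ∑ t ∈ Finset.range D.N, sub t = D.n +
      ∑ t ∈ Finset.range D.N, childSum D.par sub 0 D.N t := by
    rw [← D.sum_own, ← Finset.sum_add_distrib]
    exact Finset.sum_congr rfl fun t ht => h.sub_eq t (Finset.mem_range.1 ht)
  have e2 : ∑ t ∈ Finset.range D.N, childSum D.par sub 0 D.N t =
      ∑ c ∈ (Finset.Ico 0 D.N).filter fun c => c ≠ 0, sub c := by
    rw [← Finset.sum_fiberwise_of_maps_to (s := (Finset.Ico 0 D.N).filter fun c => c ≠ 0)
      (g := D.par) (t := Finset.range D.N)]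
    · refine Finset.sum_congr rfl fun t _ => ?_
      rw [childSum, Finset.filter_filter]
    · intro c hc
      simp only [Finset.mem_filter, Finset.mem_Ico] at hc
      have := D.par_lt c hc.1.2 hc.2
      exact Finset.mem_range.2 (by omega)
  have e3 : ∑ t ∈ Finset.range D.N, sub t = sub 0 +
      ∑ c ∈ (Finset.Ico 0 D.N).filter fun c => c ≠ 0, sub c := by
    rw [← Finset.sum_insert (by simp)]
    refine Finset.sum_congr ?_ fun _ _ => rfl
    ext c
    simp only [Finset.mem_range, Finset.mem_insert, Finset.mem_filter, Finset.mem_Ico]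
    have := D.N_pos
    omega
  omega

/-- There are `n` pairs of a node and a position in its block, and by `exists_own` their places
cover all numbers below `n`. A surjection between finite sets of equal size is injective. -/
theorem place_injective {t t' j j' : ℕ} (ht : t < D.N) (ht' : t' < D.N)
    (hj : j < (D.own t).length) (hj' : j' < (D.own t').length) (he : start t + j = start t' + j') :
    t = t' ∧ j = j' := by
  let A : Finset (Σ _ : ℕ, ℕ) := (Finset.range D.N).sigma fun t => Finset.range (D.own t).length
  have hcard : A.card = D.n := by simp [A, Finset.card_sigma, D.sum_own]
  have hsurj : Set.SurjOn (fun x : Σ _ : ℕ, ℕ => start x.1 + x.2) A (Finset.range D.n) := by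
    intro x hx
    have hx : x < D.n := by simpa using hx
    obtain ⟨s, hs, -, j, hj, rfl⟩ := h.exists_own D.N_pos x (by rw [h.start_zero]; omega)
      (by rw [h.start_zero, h.sub_zero]; omega)
    exact ⟨⟨s, j⟩, by simp [A, hs, hj], rfl⟩
  have hinj := Finset.injOn_of_surjOn_of_card_le (s := A) (t := Finset.range D.n)
    (fun x : Σ _ : ℕ, ℕ => start x.1 + x.2) ?_ hsurj (by simp [hcard])
  · have := @hinj ⟨t, j⟩ (by simp [A, ht, hj]) ⟨t', j'⟩ (by simp [A, ht', hj']) he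
    simpa using this
  · rintro ⟨s, j⟩ hx
    simp only [A, Finset.coe_sigma, Set.mem_sigma_iff, Finset.coe_range, Set.mem_Iio] at hx ⊢
    have e1 := h.interval_subset (D.desc_root hx.1) hx.1
    have e2 := h.sub_eq s hx.1
    rw [h.start_zero, h.sub_zero] at e1
    omega

/-- Thus a start and a length suffice to describe the vertices below a node to the reduction. -/
theorem exists_list {P : ℕ → ℕ} (hP : ∀ t < D.N, Holds P (start t) (D.own t)) {t : ℕ}
    (ht : t < D.N) : ∃ ys, ListsSet ys (D.below t) ∧ ys.length = sub t ∧ Holds P (start t) ys := by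
  refine ⟨(List.range (sub t)).map fun i => P (start t + i), ⟨?_, ?_⟩, by simp, ?_⟩
  · refine List.Nodup.map_on ?_ List.nodup_range
    intro x hx y hy hxy
    obtain ⟨s, hs, -, j, hj, e⟩ := h.exists_own ht (start t + x) (by omega) (by simpa using hx)
    obtain ⟨s', hs', -, j', hj', e'⟩ := h.exists_own ht (start t + y) (by omega) (by simpa using hy)
    rw [e, e', hP s hs j hj, hP s' hs' j' hj'] at hxy
    have h1 := (D.mem_own.1 (List.getElem_mem hj)).2
    have h2 := (D.mem_own.1 (List.getElem_mem hj')).2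
    obtain rfl : s = s' := by rw [← h1, ← h2, hxy]
    obtain rfl := (D.own_nodup s).getElem_inj_iff.1 hxy
    omega
  · ext v
    simp only [List.mem_toFinset, List.mem_map, List.mem_range, D.mem_below]
    constructor
    · rintro ⟨x, hx, rfl⟩
      obtain ⟨s, hs, hd, j, hj, e⟩ := h.exists_own ht (start t + x) (by omega) (by omega)
      rw [e, hP s hs j hj]
      obtain ⟨h1, h2⟩ := D.mem_own.1 (List.getElem_mem hj)
      exact ⟨h1, by rw [h2]; exact hd⟩
    · rintro ⟨hv, hd⟩
      have hs := D.top_lt v hv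
      obtain ⟨j, hj, e⟩ := List.mem_iff_getElem.1 (D.mem_own.2 ⟨hv, rfl⟩)
      have e1 := h.interval_subset hd hs
      have e2 := h.sub_eq _ hs
      refine ⟨start (D.top v) + j - start t, by omega, ?_⟩
      rw [show start t + (start (D.top v) + j - start t) = start (D.top v) + j by omega,
        hP _ hs j hj, e]
  · intro i hi
    simp

end IsPreorder

end RootedDec

/-! ## The rooted decomposition of a tree decomposition -/

section

variable {H : GraphClass} {G : FinGraph} (D : HTreeDec H G) {parent : Fin D.N → Fin D.N}

/-- The `N - 1` edges from the nodes to their parents are distinct, and a tree has no more edges. -/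
theorem HTreeDec.adj_parent (hp : IsParentMap D.T parent) {s t : Fin D.N} (h : D.T.Adj s t) :
    (s.val ≠ 0 ∧ parent s = t) ∨ (t.val ≠ 0 ∧ parent t = s) := by
  classical
  have hN : 0 < D.N := s.pos
  let f : Fin D.N → Sym2 (Fin D.N) := fun s => s(s, parent s)
  let A : Finset (Fin D.N) := Finset.univ.filter fun s => s.val ≠ 0
  have hinj : Set.InjOn f A := by
    intro a ha b hb hab
    simp only [A, Finset.coe_filter, Finset.mem_univ, true_and, Set.mem_ofPred_eq] at ha hb
    have h1 := (hp a ha).1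
    have h2 := (hp b hb).1
    rcases Sym2.eq_iff.1 hab with ⟨h3, -⟩ | ⟨h3, h4⟩
    · exact h3
    · rw [h4] at h1; rw [← h3] at h2; exact absurd h1 (by omega)
  have hA : A.card + 1 = D.N := by
    have : A = Finset.univ.erase ⟨0, hN⟩ := by
      ext x; simp [A, Fin.ext_iff]
    rw [this, Finset.card_erase_of_mem (by simp)]
    simp; omega
  have hE := D.isTree.card_edgeFinset
  rw [Fintype.card_fin] at hE
  have hsub : A.image f ⊆ D.T.edgeFinset := by
    intro e he
    obtain ⟨x, hx, rfl⟩ := Finset.mem_image.1 he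
    rw [SimpleGraph.mem_edgeFinset]
    exact (hp x (by simpa [A] using hx)).2
  have heq := Finset.eq_of_subset_of_card_le hsub (by rw [Finset.card_image_of_injOn hinj]; omega)
  have hst : s(s, t) ∈ D.T.edgeFinset := by rw [SimpleGraph.mem_edgeFinset]; exact h
  rw [← heq] at hst
  obtain ⟨x, hx, hxe⟩ := Finset.mem_image.1 hst
  have hx0 : x.val ≠ 0 := by simpa [A] using hx
  rcases Sym2.eq_iff.1 hxe with ⟨rfl, h2⟩ | ⟨rfl, h2⟩
  · exact Or.inl ⟨hx0, h2⟩
  · exact Or.inr ⟨hx0, h2⟩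

/-- The nodes that contain `v` are connected. Descendants of `t` are at least `t`, so a walk from
`t` to `s` leaves the subtree of `t`, which is only possible through the parent of `t`. -/
theorem HTreeDec.climb (hp : IsParentMap D.T parent) {s t : Fin D.N} (hst : s < t) {v : ℕ}
    (hv : v ∈ G.verts) (ht : v ∈ D.α t ∪ D.β t) (hs : v ∈ D.α s ∪ D.β s) :
    v ∈ D.α (parent t) ∪ D.β (parent t) := by
  let R : Fin D.N → Prop := fun u => Relation.ReflTransGen (fun a b => a.val ≠ 0 ∧ parent a = b) u t
  have hR : ∀ u, R u → t ≤ u := by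
    intro u hu
    induction hu using Relation.ReflTransGen.head_induction_on with
    | refl => exact le_rfl
    | head h' _ ih =>
      obtain ⟨h0, rfl⟩ := h'
      exact ih.trans (hp _ h0).1.le
  obtain ⟨w⟩ := (D.conn v hv).preconnected ⟨t, ht⟩ ⟨s, hs⟩
  -- Follow the walk to the first edge that leaves the subtree; it leads from `t` to its parent.
  have key : ∀ (x y : {t | v ∈ D.α t ∪ D.β t}) (w : (D.T.induce {t | v ∈ D.α t ∪ D.β t}).Walk x y),
      R x → ¬ R y → v ∈ D.α (parent t) ∪ D.β (parent t) := by
    intro x y w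
    induction w with
    | nil => intro h1 h2; exact absurd h1 h2
    | @cons x z y hxz w ih =>
      intro h1 h2
      by_cases hz : R z
      · exact ih hz h2
      · have hadj : D.T.Adj x.1 z.1 := hxz
        rcases D.adj_parent hp hadj with ⟨h0, h3⟩ | ⟨h0, h3⟩
        · rcases Relation.ReflTransGen.cases_head h1 with h4 | ⟨c, ⟨-, h5⟩, h6⟩
          · rw [← h4, h3]; exact z.2
          · rw [← h5, h3] at h6; exact absurd h6 hz
        · exact absurd (Relation.ReflTransGen.head ⟨h0, h3⟩ h1) hz
  refine key _ _ w .refl fun h => ?_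
  exact absurd (hR s h) (by omega)

/-- The family of lists, extended by empty lists. -/
def extendLists {N : ℕ} (l : Fin N → List ℕ) (t : ℕ) : List ℕ := if h : t < N then l ⟨t, h⟩ else []

theorem extendLists_val {N : ℕ} (l : Fin N → List ℕ) (t : Fin N) : extendLists l t = l t := by
  simp [extendLists]

open scoped Classical in
/-- The first node whose bag contains a vertex. -/
noncomputable def firstNode {N : ℕ} (as bs : Fin N → List ℕ) (v : ℕ) : ℕ :=
  if h : ∃ t, v ∈ extendLists as t ++ extendLists bs t then Nat.find h else 0

/-- A tree decomposition given by lists. -/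
noncomputable def HTreeDec.rooted (hp : IsParentMap D.T parent) {n : ℕ} (hn : G.verts = Finset.range n)
    {as bs : Fin D.N → List ℕ} (has : ∀ t, ListsSet (as t) (D.α t))
    (hbs : ∀ t, ListsSet (bs t) (D.β t)) : RootedDec H G :=
  have hN : 0 < D.N := (D.isTree.connected.nonempty.elim fun t => t.pos)
  have hmem : ∀ (t : Fin D.N) v, v ∈ extendLists as t ++ extendLists bs t ↔ v ∈ D.α t ∪ D.β t := by
    intro t v
    rw [extendLists_val, extendLists_val, ← (has t).2, ← (hbs t).2]; simp
  have hcov : ∀ v, v < n ↔ ∃ t, v ∈ D.α t ∪ D.β t := by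
    intro v
    rw [← Finset.mem_range, ← hn, ← D.cover]; simp
  have hfirst : ∀ v < n, ∃ h : ∃ t, v ∈ extendLists as t ++ extendLists bs t, firstNode as bs v = Nat.find h := by
    intro v hv
    obtain ⟨t, ht⟩ := (hcov v).1 hv
    have h : ∃ t, v ∈ extendLists as t ++ extendLists bs t := ⟨t, (hmem t v).2 ht⟩
    exact ⟨h, by rw [firstNode, dif_pos h]⟩
  { n := n
    N := D.N
    k := D.width
    par := fun t => if h : t < D.N then parent ⟨t, h⟩ else 0
    as := extendLists as
    bs := extendLists bs
    top := firstNode as bs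
    verts := hn
    N_pos := hN
    par_lt := fun t ht h0 => by
      rw [dif_pos ht]; exact (hp ⟨t, ht⟩ h0).1
    bag_lt := fun t ht v hv => (hcov v).2 ⟨⟨t, ht⟩, (hmem ⟨t, ht⟩ v).1 hv⟩
    bag_nil := fun t ht => by simp [extendLists, not_lt.2 ht]
    nodup := fun t ht => by
      rw [extendLists_val as ⟨t, ht⟩, extendLists_val bs ⟨t, ht⟩]
      refine List.nodup_append'.2 ⟨(has _).1, (hbs _).1, fun v h1 h2 => ?_⟩
      have := D.disj ⟨t, ht⟩
      rw [← (has _).2, ← (hbs _).2] at this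
      exact Finset.disjoint_left.1 this (List.mem_toFinset.2 h1) (List.mem_toFinset.2 h2)
    edge := fun e he => by
      obtain ⟨t, ht⟩ := D.edge e he
      exact ⟨t, t.2, fun v hv => (hmem t v).2 (ht v hv)⟩
    climb := fun t ht s hs v hvt hvs => by
      rw [hmem ⟨t, ht⟩] at hvt
      have hvs := (hmem ⟨s, by omega⟩ v).1 hvs
      rw [dif_pos ht, hmem (parent ⟨t, ht⟩)]
      refine D.climb hp (s := ⟨s, by omega⟩) (t := ⟨t, ht⟩) hs ?_ hvt hvs
      rw [hn, Finset.mem_range]; exact (hcov v).2 ⟨_, hvt⟩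
    mem_class := fun t ht => by
      rw [extendLists_val bs ⟨t, ht⟩, (hbs _).2]; exact D.mem_class _
    adhesion_up := fun t ht h0 => by
      rw [dif_pos ht, extendLists_val bs (parent ⟨t, ht⟩), (hbs _).2, extendLists_val as ⟨t, ht⟩,
        extendLists_val bs ⟨t, ht⟩, List.toFinset_append, (has _).2, (hbs _).2]
      exact D.adhesion _ _ (hp ⟨t, ht⟩ h0).2.symm
    adhesion_down := fun t ht h0 => by
      rw [dif_pos ht, extendLists_val bs (parent ⟨t, ht⟩), extendLists_val as (parent ⟨t, ht⟩),
        extendLists_val bs ⟨t, ht⟩, List.toFinset_append, (has _).2, (hbs _).2, (hbs _).2]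
      exact D.adhesion _ _ (hp ⟨t, ht⟩ h0).2
    width := fun t ht => by
      rw [extendLists_val as ⟨t, ht⟩, ← listsSet_card (has _)]
      exact Finset.le_sup (f := fun t => (D.α t).card) (Finset.mem_univ _)
    top_lt := fun v hv => by
      obtain ⟨t, ht⟩ := (hcov v).1 hv
      obtain ⟨h, e⟩ := hfirst v hv
      rw [e]
      exact (Nat.find_min' h ((hmem t v).2 ht)).trans_lt t.2
    top_mem := fun v hv => by
      obtain ⟨h, e⟩ := hfirst v hv
      rw [e]
      exact Nat.find_spec h
    top_le := fun t ht v hv => by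
      obtain ⟨h, e⟩ := hfirst v ((hcov v).2 ⟨⟨t, ht⟩, (hmem ⟨t, ht⟩ v).1 hv⟩)
      rw [e]
      exact Nat.find_min' h hv }

end

theorem firstArr_eq (bag : ℕ → List ℕ) (N v t : ℕ) (ht : t < N) (hv : v ∈ bag t)
    (hmin : ∀ s < t, v ∉ bag s) :
    firstArr ((List.range N).flatMap fun t => (bag t).map (t, ·)) v = t + 1 := by
  obtain ⟨r, rfl⟩ : ∃ r, N = t + (r + 1) := ⟨N - t - 1, by omega⟩
  rw [firstArr, List.range_add, List.flatMap_append, List.find?_append, List.find?_eq_none.2]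
  · rw [List.range_succ_eq_map]
    simp only [Option.none_or, List.map_cons, List.flatMap_cons, add_zero, List.find?_append]
    have : (((bag t).map (t, ·)).find? fun e => e.2 == v) = some (t, v) := by
      rw [List.find?_map]
      have : (bag t).find? ((fun e : ℕ × ℕ => e.2 == v) ∘ (t, ·)) = some v := by
        rw [List.find?_eq_some_iff_getElem]
        have h1 := List.idxOf_lt_length_iff.2 hv
        refine ⟨by simp, (bag t).idxOf v, h1, by simp, fun j hj => ?_⟩
        have := List.not_of_lt_findIdx (p := (· == v)) (xs := bag t) hj
        simpa using this
      rw [this]; rfl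
    rw [this]; simp
  · rintro ⟨s, w⟩ hx
    simp only [List.mem_flatMap, List.mem_range, List.mem_map, Prod.mk.injEq] at hx
    obtain ⟨s', hs', w', hw', rfl, rfl⟩ := hx
    simp only [beq_iff_eq]
    rintro rfl
    exact hmin _ hs' hw'

/-! ### ## The program for one table -/

/-- Is zero iff the two numbers are equal. -/
def distExpr (x y : Expr) : Expr := (x - y) + (y - x)

@[simp] theorem eval_distExpr (I M : Arrays) (x y : Expr) : Expr.eval I M (distExpr x y) =
    (x.eval I M - y.eval I M) + (y.eval I M - x.eval I M) := rfl

/-- The table of the part at a node. -/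
def tableP (p : ℕ) (opt : Opt) (R S : Prog) : Prog :=
  .call (filterP (1 - distExpr (.inp 2 (.mem 3 0)) (.inp 3 0)))
    [.inp 0 0, .inp 1 0, .inp 4 0, .inp 5 0] 1 ;;
  .call catP [.inp 6 1, .inp 6 0, .mem 1 1, .mem 1 0] 2 ;;
  .call gatherP [.inp 8 1, .inp 8 0, .inp 9 0, .inp 10 0] 3 ;;
  .call marksP [.mem 3 1, .mem 3 0] 4 ;;
  .call (filterP (1 - (distExpr (.inp 2 (.mem 3 0)) (.inp 3 0) + (1 - .inp 4 (.mem 3 0)))))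
    [.inp 2 0, .inp 3 0, .inp 4 0, .inp 5 0, .mem 4 0] 5 ;;
  .call catP [.mem 2 1, .mem 2 0, .mem 5 1, .mem 5 0] 6 ;;
  .call marksP [.mem 6 1, .mem 6 0] 7 ;;
  .call catP [.inp 6 1, .inp 6 0, .inp 7 1, .inp 7 0] 8 ;;
  .call recordsP [.inp 8 1, .inp 8 0, .inp 9 0] 9 ;;
  .call bagEdgesP [.inp 15 0, .inp 16 0, .inp 6 0, .inp 14 0, .inp 13 0] 10 ;;
  .call (powP p) [.mem 2 0] 11 ;;
  .set 12 0 (.mem 2 0) ;; .set 12 1 (.mem 5 0) ;; .set 12 2 (.inp 8 0) ;; .set 12 3 (.inp 17 0) ;;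
  .call (loopP p opt R S) [.mem 12 0, .mem 2 1, .mem 5 1, .inp 13 0, .inp 14 0, .mem 9 0, .inp 10 0,
    .inp 11 0, .inp 12 0, .mem 8 0, .mem 10 0, .mem 7 0, .inp 18 0, .mem 11 0] 0

theorem arr_four (x y z w : ℕ) : Function.update (Function.update (Function.update (sc x) 1 y) 2 z) 3 w =
    arr [x, y, z, w] := by
  rw [arr_three, arr_push (by simp)]; rfl

/-- Only pairs of vertices of the induced graph are constrained, so the matrix of `G` serves for
every part. -/
theorem HoldsAdj.induce {row bits : ℕ → ℕ} {G : FinGraph} (h : HoldsAdj row 0 bits G) (S : Finset ℕ) :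
    HoldsAdj row 0 bits (G.induce S) := by
  intro u hu v hv
  obtain ⟨hu1, hu2⟩ := Finset.mem_inter.1 hu
  obtain ⟨hv1, hv2⟩ := Finset.mem_inter.1 hv
  obtain ⟨h1, h2⟩ := h u hu1 v hv1
  refine ⟨fun he => h1 (FinGraph.mem_induce_edges.1 he).1, fun he => h2 fun h => he ?_⟩
  refine FinGraph.mem_induce_edges.2 ⟨h, fun w hw => ?_⟩
  rcases Sym2.mem_iff.1 hw with rfl | rfl <;> assumption

namespace RootedDec

open scoped Classical

variable {p : ℕ} {g : PartitionEval p} {opt : Opt} {H : GraphClass} {f : ℕ → ℕ} {c d K : ℕ}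
  {R S : Prog} {G : FinGraph}

/-- The record of the part at the node `c`. -/
structure HoldsRecord (D : RootedDec H G) (g : PartitionEval p) (opt : Opt)
    (rec dl pre tab : ℕ → ℕ) (c : ℕ) : Prop where
  length : rec (6 * c) = (D.bdry c).length
  bdry : Holds dl (rec (6 * c + 1)) (D.bdry c)
  below : ∃ ys, ListsSet ys (D.below c) ∧ rec (6 * c + 2) = ys.length ∧
    Holds pre (rec (6 * c + 3)) ys
  table : HoldsTable g opt tab (rec (6 * c + 4)) (D.part c).graph (D.bdry c)
  adj : rec (6 * c + 5) = 0

/-- A bound for the time spent at a node apart from the colourings. -/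
noncomputable def load (D : RootedDec H G) (es : List (ℕ × ℕ)) (t : ℕ) : ℕ :=
  (D.bag t).length + (D.k + 2) * ((D.children t).length + 1) + (D.ownEdges es t).length +
    (D.bdry t).length * (D.bdry t).length

set_option maxHeartbeats 1000000 in
-- The arrays of `tableP` are: 1 the new vertices of `α(t)`, 2 the set `A`, 3 and 4 the boundary
-- vertices of the children and their marks, 5 the set `B`, 6 and 7 the cut and its marks, 8 the
-- piece, 9 the records of the children, 10 the edges of the piece, 11 the number of colourings, 12
-- the sizes.
theorem tableP_spec (D : RootedDec H G) (hp : 1 ≤ p) (hH : H.Hereditary)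
    (hR : Reduces g opt H K R) (hS : Solves g opt H f c d S) (hf : Monotone f)
    {t Sz : ℕ} (I : Arrays) {es : List (ℕ × ℕ)} (ht : t < D.N) (hes : ListsEdges es G.edges)
    (h0 : Holds (I 0) 0 (D.as t)) (h1 : I 1 0 = (D.as t).length)
    (h2 : Holds (I 2) 0 (D.bs t)) (h3 : I 3 0 = (D.bs t).length)
    (h4 : ∀ v < D.n, I 4 v = D.top v + 1) (h5 : I 5 0 = t + 1)
    (h6 : Holds (I 6) 0 ((D.bdry t).length :: D.bdry t))
    (h7 : Holds (I 7) 0 ((D.own t).length :: D.own t))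
    (h8 : Holds (I 8) 0 ((D.children t).length :: D.children t))
    (hrec : ∀ j ∈ D.children t, D.HoldsRecord g opt (I 9) (I 10) (I 11) (I 12) (j + 1))
    (h13 : ∀ v < D.n, I 13 v = v * Sz) (hSz : D.n ≤ Sz) (h14 : HoldsAdj (I 13) 0 (I 14) G)
    (h15 : Holds (I 15) 0 (flat es))
    (h16 : Holds (I 16) 0 ((D.ownEdges es t).length :: D.ownEdges es t))
    (h17 : I 17 0 = D.n) (h18 : I 18 0 = p ^ (D.bdry t).length) :
    Wp I (tableP p opt R S) 0 fun M' s =>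
      HoldsTable g opt (M' 0) 0 (D.part t).graph (D.bdry t) ∧
      s ≤ 100 * D.load es t + p ^ (D.bdry t ++ D.ownA t).length *
        (entryTime K f c d (D.bdry t ++ D.ownA t).length (D.ownB t).length (D.children t).length
          (D.piece t).length (D.pieceEdges (I 13) (I 14) es t).length +
          (D.bdry t ++ D.ownA t).length * 10 + 17) := by
  obtain ⟨h60, h61⟩ := holds_cons.1 h6
  obtain ⟨h70, h71⟩ := holds_cons.1 h7
  obtain ⟨h80, h81⟩ := holds_cons.1 h8
  simp only [zero_add] at h61 h71 h81
  have hbag : ∀ v, v ∈ D.as t ∨ v ∈ D.bs t → v < D.n := fun v hv =>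
    D.bag_lt t ht v (List.mem_append.2 hv)
  have hadj : ∀ u < D.n, ∀ v < D.n, I 14 (I 13 u + v) ≠ 0 ↔ s(u, v) ∈ G.edges := by
    intro u hu v hv
    obtain ⟨e1, e2⟩ := h14 u (by rw [D.verts]; simpa using hu) v (by rw [D.verts]; simpa using hv)
    rw [zero_add] at e1 e2
    constructor
    · intro h; by_contra h'; exact h (e2 h')
    · intro h; rw [e1 h]; omega
  have hpe := D.listsEdges_pieceEdges (row := I 13) (adj := I 14) hes hadj ht
  rw [tableP, zero_eq_mk 13]
  simp only [wp_seq, wp_call, passArgs_eq, List.map_cons, List.map_nil, deref_inp, deref_mem]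
  refine (filterP_spec _ (D.as t) _ (fun v => D.top v = t) ?_ ?_ ?_).mono ?_
  · simpa using h0
  · simpa using h1
  · intro M hM
    simp [h4 _ (hbag _ (Or.inl hM)), h5]; omega
  rintro M1 t1 ⟨e1, ht1⟩
  rw [show (D.as t).filter (fun v => decide (D.top v = t)) = D.ownA t from rfl] at e1
  refine (catP_spec _ (D.bdry t) (D.ownA t) ?_ ?_ ?_ ?_).mono ?_
  · simp; exact holds_shift h61
  · simpa using h60
  · simp [mk_update, e1]; exact holds_shift (holds_arr_cons _ _)
  · simp [mk_update, e1]
  rintro M2 t2 ⟨e2, ht2⟩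
  refine (gatherP_spec _ (D.children t) (fun j => D.bdry (j + 1)) ?_ ?_ ?_).mono ?_
  · simp; exact holds_shift h81
  · simpa using h80
  · intro j hj
    simpa using ⟨(hrec j hj).length, (hrec j hj).bdry⟩
  rintro M3 t3 ⟨e3, ht3⟩
  refine (marksP_spec _ ((D.children t).flatMap fun j => D.bdry (j + 1)) ?_ ?_).mono ?_
  · simp [mk_update, e3, -List.length_flatMap]; exact holds_shift (holds_arr_cons _ _)
  · simp [mk_update, e3]
  rintro M4 t4 ⟨e4, ht4⟩
  refine (filterP_spec _ (D.bs t) _ (fun v => D.top v = t ∧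
    v ∈ (D.children t).flatMap fun j => D.bdry (j + 1)) ?_ ?_ ?_).mono ?_
  · simpa using h2
  · simpa using h3
  · intro M hM
    simp only [mk_update, mk_zero, mk_succ, Expr.eval_inp, Expr.eval_mem, Expr.eval_ofNat,
      Expr.eval_sub, Expr.eval_add, eval_distExpr, List.replicate, List.length_cons,
      List.length_nil, Nat.reduceAdd, Nat.reduceLT, List.set_cons_succ, List.set_cons_zero, zero_add, e4,
      h4 _ (hbag _ (Or.inr hM)), h5]
    -- The test is nonzero iff the distance of the two nodes is zero and the mark is set.
    by_cases hm : M 3 0 ∈ (D.children t).flatMap fun j => D.bdry (j + 1)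
    · simp only [marks, hm, and_true, if_true]; omega
    · simp only [marks, hm, and_false, not_false_eq_true, iff_true, if_false]; omega
  rintro M5 t5 ⟨e5, ht5⟩
  rw [show (D.bs t).filter (fun v => decide (D.top v = t ∧
    v ∈ (D.children t).flatMap fun j => D.bdry (j + 1))) = D.ownB t from rfl] at e5
  refine (catP_spec _ (D.bdry t ++ D.ownA t) (D.ownB t) ?_ ?_ ?_ ?_).mono ?_
  · simp [mk_update, e2]; exact holds_shift (holds_arr_cons _ _)
  · simp [mk_update, e2]
  · simp [mk_update, e5]; exact holds_shift (holds_arr_cons _ _)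
  · simp [mk_update, e5]
  rintro M6 t6 ⟨e6, ht6⟩
  rw [show D.bdry t ++ D.ownA t ++ D.ownB t = D.cut t from rfl] at e6 ht6
  refine (marksP_spec _ (D.cut t) ?_ ?_).mono ?_
  · simp [mk_update, e6]; exact holds_shift (holds_arr_cons _ _)
  · simp [mk_update, e6]
  rintro M7 t7 ⟨e7, ht7⟩
  refine (catP_spec _ (D.bdry t) (D.own t) ?_ ?_ ?_ ?_).mono ?_
  · simp; exact holds_shift h61
  · simpa using h60
  · simp; exact holds_shift h71
  · simpa using h70
  rintro M8 t8 ⟨e8, ht8⟩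
  rw [show D.bdry t ++ D.own t = D.piece t from rfl] at e8 ht8
  refine (recordsP_spec _ (D.children t) ?_ ?_).mono ?_
  · simp; exact holds_shift h81
  · simpa using h80
  rintro M9 t9 ⟨e9, ht9⟩
  refine (bagEdgesP_spec _ es (D.ownEdges es t) (D.bdry t) ?_ ?_ ?_ ?_).mono ?_
  · simpa using h15
  · simpa using h16
  · intro i hi
    exact List.mem_range.1 (List.mem_filter.1 hi).1
  · simpa using h6
  rintro M10 t10 ⟨⟨eb, hebe, e10⟩, ht10⟩
  simp only [mk_zero, mk_succ, zero_add, Expr.eval_ofNat] at hebe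
  rw [show (fun i => I 13 i) = I 13 from rfl, show (fun i => I 14 i) = I 14 from rfl,
    show (D.ownEdges es t).map (fun e => es.getD e (0, 0)) ++ innerEdges (I 13) (I 14) (D.bdry t)
      (D.bdry t).length = D.pieceEdges (I 13) (I 14) es t from rfl] at hebe
  subst hebe
  refine (powP_spec _ p (D.bdry t ++ D.ownA t).length ?_).mono ?_
  · simp [mk_update, e2]
  rintro M11 t11 ⟨e11, ht11⟩
  simp only [wp_set]
  have hcut : (D.inner t).bd = (D.cut t).toFinset := rfl
  have hlen : (D.parts t).length = (D.children t).length := by simp [parts]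
  refine (loopP_spec hp hR hS hf (n := D.n) (Sz := Sz) _ (D.inner_isBoxSum t) (D.cut_nodup ht) hcut
    D.parts_bd_card ?_ ?_ ?_ ?_ ?_ ?_ (D.outer_compatible ht) (D.inner_glueable ht) ?_
    (bag := D.piece t) (eb := D.pieceEdges (I 13) (I 14) es t) ?_ ?_ ?_ ?_ ?_ ?_ hSz ?_ ?_
    (D.outer_del_mem hH ht)).mono ?_
  · intro v hv
    rw [inner, G.induce_verts (D.innerVerts_sub t)] at hv
    have := D.innerVerts_sub t hv
    rwa [D.verts, Finset.mem_range] at this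
  · simp [mk_update, e2, e5, h80, h17, arr_four, hlen]
    exact holds_arr _
  · simp [mk_update, e2]; exact holds_shift (holds_arr_cons _ _)
  · simp [mk_update, e5]; exact holds_shift (holds_arr_cons _ _)
  · simp [inner]; exact h14.induce _
  · intro i hi
    have hi' : i < (D.children t).length := by rwa [hlen] at hi
    have hget : (D.parts t)[i] = D.part ((D.children t)[i] + 1) := by simp [parts]
    have hr := hrec _ (List.getElem_mem hi')
    obtain ⟨ys, hys, hyl, hyh⟩ := hr.below
    have hgv : (D.part ((D.children t)[i] + 1)).graph.verts = D.partVerts ((D.children t)[i] + 1) :=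
      G.induce_verts (D.partVerts_sub _)
    have hc := (D.mem_children.1 (List.getElem_mem hi')).1
    rw [hget]
    refine ⟨D.bdry ((D.children t)[i] + 1), ys, I 9 (6 * ((D.children t)[i] + 1) + 1),
      I 9 (6 * ((D.children t)[i] + 1) + 3), I 9 (6 * ((D.children t)[i] + 1) + 4),
      0, ⟨(D.nodup _ hc).filter _, rfl⟩, ?_, ?_, ?_, ?_, ?_, ?_⟩
    · rw [hgv, partVerts, show (D.part ((D.children t)[i] + 1)).bd =
        (D.bdry ((D.children t)[i] + 1)).toFinset from rfl, Finset.union_sdiff_cancel_right]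
      · exact hys
      · rw [Finset.disjoint_left]
        intro v hv hv'
        have := D.below_lt hv
        have := D.bdry_top (List.mem_toFinset.1 hv')
        omega
    · intro k hk
      have hk6 : k < 6 := by simpa using hk
      have := e9 i hi' k hk6
      simp only [mk_succ, mk_zero, Expr.eval_ofNat, zero_add] at this
      simp [mk_update]
      rw [this]
      have l1 := hr.length
      have l2 := hr.adj
      interval_cases k <;> simp [l1, l2, hyl]
    · simpa using hr.bdry
    · simpa using hyh
    · simpa using hr.table
    · simp [part]; exact h14.induce _
  · intro v hv
    rw [outer, G.induce_verts (D.piece_sub t)] at hv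
    exact D.bag_lt' (D.piece_bag (List.mem_toFinset.1 hv))
  · refine ⟨D.piece_nodup ht, ?_⟩
    rw [outer, G.induce_verts (D.piece_sub t)]
  · simp [mk_update, e8]; exact holds_arr _
  · exact hpe
  · simp [mk_update, e10]; exact holds_arr _
  · intro v
    simp [mk_update, e7, marks, hcut]
  · simpa using h13
  · simpa using h18
  · simp [mk_update, e11]
  rintro M12 t12 ⟨e12, ht12⟩
  rw [D.inner_glue_outer ht] at e12
  refine ⟨by simpa using e12, ?_⟩
  rw [hlen] at ht12
  have b1 := D.annotated_length ht
  have b2 := D.ownB_length ht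
  have b3 := D.piece_length ht
  -- The boundaries of the children are gathered with repetitions; each has at most `k + 1`
  -- vertices.
  have b4 : ((D.children t).flatMap fun j => D.bdry (j + 1)).length ≤ (D.children t).length * (D.k + 1) := by
    rw [List.length_flatMap, ← smul_eq_mul]
    refine (List.sum_le_card_nsmul _ (D.k + 1) ?_).trans (by simp)
    intro x hx
    obtain ⟨j, hj, rfl⟩ := List.mem_map.1 hx
    have := D.annotated_length (D.mem_children.1 hj).1
    rw [List.length_append] at this
    omega
  have b5 : (D.bag t).length = (D.as t).length + (D.bs t).length := List.length_append ..
  have b6 : (D.cut t).length = (D.bdry t ++ D.ownA t).length + (D.ownB t).length := List.length_append ..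
  have b7 : (D.bdry t).length ≤ (D.bdry t ++ D.ownA t).length := by simp
  have b8 : (D.k + 2) * ((D.children t).length + 1) = (D.children t).length * (D.k + 1) +
    (D.children t).length + D.k + 2 := by ring
  have b9 : (D.bdry t).length * ((D.bdry t).length * 6 + 4) =
    6 * ((D.bdry t).length * (D.bdry t).length) + 4 * (D.bdry t).length := by ring
  rw [load]
  generalize p ^ (D.bdry t ++ D.ownA t).length * _ = z at ht12 ⊢
  clear e12 hR hS hf hrec h14 h6 h7 h8 h15 h16 h61 h71 h81 hpe e1 e2 e3 e4 e5 e6 e7 e8 e9 e10 e11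
  generalize ((D.children t).flatMap fun j => D.bdry (j + 1)).length = fl at *
  generalize (D.bdry t ++ D.ownA t).length = a at *
  rw [b8]
  omega

end RootedDec

/-! ### ## The sweep over the nodes -/

/-- Treats one node. -/
def nodeP (p : ℕ) (opt : Opt) (R S : Prog) : Prog :=
  .set 2 0 (.inp 0 2 - (.mem 1 0 + 1)) ;; .set 13 0 (.mem 2 0 + 1) ;;
  .call catP [.inp 3 (.inp 4 (.mem 2 0)), .inp 2 (.mem 2 0), .inp 6 (.inp 7 (.mem 2 0)),
    .inp 5 (.mem 2 0)] 8 ;;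
  .call (filterP (1 - ((.inp 2 (.mem 3 0) - .inp 3 0) + (1 - .inp 4 (.mem 3 0)))))
    [.mem 8 1, .mem 8 0, .inp 11 0, .mem 2 0, .inp 10 0] 9 ;;
  .call (powP p) [.mem 9 0] 10 ;;
  .call (tableP p opt R S) [.inp 3 (.inp 4 (.mem 2 0)), .inp 2 (.mem 2 0),
    .inp 6 (.inp 7 (.mem 2 0)), .inp 5 (.mem 2 0), .inp 11 0, .mem 13 0, .mem 9 0,
    .inp 12 (.inp 8 (.mem 13 0)), .inp 13 (.inp 8 (.mem 2 0)), .mem 3 0, .mem 4 0, .inp 17 0,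
    .mem 5 0, .inp 8 0, .inp 9 0, .inp 1 0, .inp 14 (.inp 8 (.mem 13 0)), .inp 0 0, .mem 10 0] 11 ;;
  .set 3 (recPos (.mem 2 0) - 6) (.mem 9 0) ;; .set 3 (recPos (.mem 2 0) - 6 + 1) (.mem 6 0) ;;
  .set 3 (recPos (.mem 2 0) - 6 + 2) (.inp 15 (.mem 2 0)) ;;
  .set 3 (recPos (.mem 2 0) - 6 + 3) (.inp 16 (.mem 2 0)) ;;
  .set 3 (recPos (.mem 2 0) - 6 + 4) (.mem 7 0) ;; .set 3 (recPos (.mem 2 0) - 6 + 5) 0 ;;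
  .for 12 (.mem 9 0) (.set 4 (.mem 6 0 + .mem 12 0) (.mem 9 (.mem 12 0 + 1))) ;;
  .set 6 0 (.mem 6 0 + .mem 9 0) ;;
  .for 12 (.mem 10 0) (.set 5 (.mem 7 0 + .mem 12 0) (.mem 11 (.mem 12 0))) ;;
  .set 7 0 (.mem 7 0 + .mem 10 0)

/-- Treats the nodes from the last to the first. -/
def sweepP (p : ℕ) (opt : Opt) (R S : Prog) : Prog :=
  .for 1 (.inp 0 2) (nodeP p opt R S) ;; .set 0 0 (.mem 11 0)

/-- Overwrites `n` cells from the index `o` on. -/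
def overwrite (a : ℕ → ℕ) (o n : ℕ) (b : ℕ → ℕ) : ℕ → ℕ :=
  fun x => if o ≤ x ∧ x < o + n then b (x - o) else a x

theorem overwrite_zero (a : ℕ → ℕ) (o : ℕ) (b : ℕ → ℕ) : overwrite a o 0 b = a := by
  funext x
  exact if_neg (by omega)

theorem overwrite_succ (a : ℕ → ℕ) (o n : ℕ) (b : ℕ → ℕ) :
    Function.update (overwrite a o n b) (o + n) (b n) = overwrite a o (n + 1) b := by
  funext x
  rcases eq_or_ne x (o + n) with rfl | h
  · simp [overwrite]
  · rw [Function.update_of_ne h, overwrite, overwrite]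
    congr 1
    rw [eq_iff_iff]; omega

theorem overwrite_lt {a : ℕ → ℕ} {o n : ℕ} {b : ℕ → ℕ} {x : ℕ} (h : x < o) :
    overwrite a o n b x = a x := if_neg (by omega)

theorem overwrite_add {a : ℕ → ℕ} {o n : ℕ} {b : ℕ → ℕ} {x : ℕ} (h : x < n) :
    overwrite a o n b (o + x) = b x := by
  rw [overwrite, if_pos (by omega), Nat.add_sub_cancel_left]

namespace RootedDec

open scoped Classical

variable {p : ℕ} {g : PartitionEval p} {opt : Opt} {H : GraphClass} {f : ℕ → ℕ} {c d K : ℕ}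
  {R S : Prog} {G : FinGraph}

/-- The input arrays of `sweepP`. -/
structure HoldsSweepInput (D : RootedDec H G) (es : List (ℕ × ℕ)) (Sz : ℕ) (I : Arrays) : Prop where
  edges : ListsEdges es G.edges
  n_eq : I 0 0 = D.n
  N_eq : I 0 2 = D.N
  es_eq : Holds (I 1) 0 (flat es)
  as_length : ∀ t < D.N, I 2 t = (D.as t).length
  as_eq : ∀ t < D.N, Holds (I 3) (I 4 t) (D.as t)
  bs_length : ∀ t < D.N, I 5 t = (D.bs t).length
  bs_eq : ∀ t < D.N, Holds (I 6) (I 7 t) (D.bs t)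
  row : ∀ v ≤ D.n + D.N, I 8 v = v * Sz
  n_le : D.n ≤ Sz
  adj : HoldsAdj (I 8) 0 (I 9) G
  nonIsolated : ∀ v, I 10 v = if NonIsolated G v then 1 else 0
  top : ∀ v < D.n, I 11 v = D.top v + 1
  own : ∀ t < D.N, Holds (I 12) ((t + 1) * Sz) ((D.own t).length :: D.own t)
  children : ∀ t < D.N, Holds (I 13) (t * Sz) ((D.children t).length :: D.children t)
  ownEdges : ∀ t < D.N, Holds (I 14) ((t + 1) * Sz) ((D.ownEdges es t).length :: D.ownEdges es t)
  preorder : D.IsPreorder (I 15) (I 16)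
  order : ∀ t < D.N, Holds (I 17) (I 16 t) (D.own t)

/-- A bound for the time spent at a node. -/
noncomputable def nodeTime (D : RootedDec H G) (es : List (ℕ × ℕ)) (row adj : ℕ → ℕ) (p K : ℕ)
    (f : ℕ → ℕ) (c d t : ℕ) : ℕ :=
  140 * D.load es t + p ^ (D.bdry t ++ D.ownA t).length *
        (entryTime K f c d (D.bdry t ++ D.ownA t).length (D.ownB t).length (D.children t).length
          (D.piece t).length (D.pieceEdges row adj es t).length +
          (D.bdry t ++ D.ownA t).length * 10 + 20)

/-- The records of the nodes from `s` on are complete. -/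
def HoldsRecords (D : RootedDec H G) (g : PartitionEval p) (opt : Opt)
    (rec dl pre tab : ℕ → ℕ) (dp tp s : ℕ) : Prop :=
  ∀ c < D.N, s ≤ c → D.HoldsRecord g opt rec dl pre tab c ∧
    rec (6 * c + 1) + (D.bdry c).length ≤ dp ∧ rec (6 * c + 4) + p ^ (D.bdry c).length ≤ tp

/-- Boundaries and tables are stored one after the other, and a record depends only on its own
cells, so later entries do not affect it. -/
theorem HoldsRecord.congr {D : RootedDec H G} {rec dl pre tab rec' dl' tab' : ℕ → ℕ} {e : ℕ}
    (h : D.HoldsRecord g opt rec dl pre tab e) (hrec : ∀ k < 6, rec' (6 * e + k) = rec (6 * e + k))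
    (hdl : ∀ x < (D.bdry e).length, dl' (rec (6 * e + 1) + x) = dl (rec (6 * e + 1) + x))
    (htab : ∀ x < p ^ (D.bdry e).length, tab' (rec (6 * e + 4) + x) = tab (rec (6 * e + 4) + x)) :
    D.HoldsRecord g opt rec' dl' pre tab' e where
  length := (hrec 0 (by omega)).trans h.length
  bdry := by
    rw [hrec 1 (by omega)]; exact h.bdry.congr hdl
  below := by
    rw [hrec 2 (by omega), hrec 3 (by omega)]; exact h.below
  table := by
    rw [hrec 4 (by omega)]
    intro φ
    rw [htab, h.table φ]
    simpa using ofDigits_lt ((D.bdry e).map fun v => (φ v).val) (by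
      intro d hd; obtain ⟨v, -, rfl⟩ := List.mem_map.1 hd; exact (φ v).2)
  adj := (hrec 5 (by omega)).trans h.adj

set_option maxHeartbeats 1000000 in
-- Round `i` treats the node `N - 1 - i`, whose children have larger numbers and hence complete
-- records. The numbers `dp` and `tp` are the first free places for boundaries and tables.
theorem nodeP_spec (D : RootedDec H G) (hp : 1 ≤ p) (hH : H.Hereditary)
    (hR : Reduces g opt H K R) (hS : Solves g opt H f c d S) (hf : Monotone f)
    {Sz : ℕ} {I : Arrays} {es : List (ℕ × ℕ)} (hI : D.HoldsSweepInput es Sz I) {i : ℕ} (hi : i < D.N)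
    {rec dl tab x2 x8 x9 x10 x11 x12 x13 : ℕ → ℕ} {dp tp : ℕ}
    (hrec : D.HoldsRecords g opt rec dl (I 17) tab dp tp (D.N - i)) :
    Wp I (nodeP p opt R S)
      (_root_.mk [0, sc i, x2, rec, dl, tab, sc dp, sc tp, x8, x9, x10, x11, x12, x13]) fun M' s =>
      s ≤ D.nodeTime es (I 8) (I 9) p K f c d (D.N - (i + 1)) ∧
      ∃ x2 rec dl tab dp tp x8 x9 x10 x11 x12 x13,
        M' = _root_.mk [0, sc i, x2, rec, dl, tab, sc dp, sc tp, x8, x9, x10, x11, x12, x13] ∧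
        D.HoldsRecords g opt rec dl (I 17) tab dp tp (D.N - (i + 1)) ∧
        HoldsTable g opt x11 0 (D.part (D.N - (i + 1))).graph (D.bdry (D.N - (i + 1))) := by
  obtain ⟨t, htd⟩ : ∃ t, t = D.N - (i + 1) := ⟨_, rfl⟩
  have ht : t < D.N := by omega
  rw [nodeP, ← htd]
  simp only [wp_seq, wp_set, wp_call, passArgs_eq, List.map_cons, List.map_nil, deref_inp, deref_mem]
  simp only [mk_update, List.length_cons, List.length_nil, Nat.reduceAdd,
      Nat.reduceLT, List.set_cons_succ, List.set_cons_zero, Expr.eval_add, Expr.eval_sub,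
      Expr.eval_mem, Expr.eval_inp, Expr.eval_ofNat, mk_zero, mk_succ, sc_zero, hI.N_eq, ← htd,
      Function.update_self, zero_add]
  refine (catP_spec _ (D.as t) (D.bs t) ?_ ?_ ?_ ?_).mono ?_
  · simp; exact holds_shift (hI.as_eq t ht)
  · simpa using hI.as_length t ht
  · simp; exact holds_shift (hI.bs_eq t ht)
  · simpa using hI.bs_length t ht
  rintro M1 t1 ⟨e1, ht1⟩
  rw [show D.as t ++ D.bs t = D.bag t from rfl] at e1 ht1
  refine (filterP_spec _ (D.bag t) _ (fun v => D.top v < t ∧ NonIsolated G v) ?_ ?_ ?_).mono ?_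
  · simp [e1]; exact holds_shift (holds_arr_cons _ _)
  · simp [e1]
  · intro M hM
    simp only [Expr.eval_add, Expr.eval_sub, Expr.eval_mem, Expr.eval_inp, Expr.eval_ofNat,
      mk_zero, mk_succ, Function.update_self, hI.top _ (D.bag_lt' hM), hI.nonIsolated, add_zero]
    by_cases hm : NonIsolated G (M 3 0)
    · simp only [hm, if_true, and_true]; omega
    · simp only [hm, if_false, and_false, not_false_eq_true, iff_true]; omega
  rintro M2 t2 ⟨e2, ht2⟩
  rw [show (D.bag t).filter (fun v => decide (D.top v < t ∧ NonIsolated G v)) = D.bdry t from rfl]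
    at e2
  refine (powP_spec _ p (D.bdry t).length ?_).mono ?_
  · simp [e2]
  rintro M3 t3 ⟨e3, ht3⟩
  refine (D.tableP_spec hp hH hR hS hf (t := t) (Sz := Sz) _ ht hI.edges ?_ ?_ ?_ ?_ ?_ ?_ ?_ ?_ ?_
    ?_ ?_ hI.n_le ?_ ?_ ?_ ?_ ?_).mono ?_
  · simp; exact holds_shift (hI.as_eq t ht)
  · simpa using hI.as_length t ht
  · simp; exact holds_shift (hI.bs_eq t ht)
  · simpa using hI.bs_length t ht
  · simpa using hI.top
  · simp
  · simp [e2]; exact holds_arr _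
  · simp [hI.row (t + 1) (by omega)]; exact holds_shift (hI.own t ht)
  · simp [hI.row t (by omega)]; exact holds_shift (hI.children t ht)
  · intro j hj
    obtain ⟨hj1, hj2⟩ := D.mem_children.1 hj
    have := D.par_lt (j + 1) hj1 (by omega)
    simpa using (hrec (j + 1) hj1 (by omega)).1
  · intro v hv
    simpa using hI.row v (by omega)
  · simpa using hI.adj
  · simpa using hI.es_eq
  · simp [hI.row (t + 1) (by omega)]; exact holds_shift (hI.ownEdges t ht)
  · simpa using hI.n_eq
  · simp [e3]
  rintro M4 t4 ⟨e4, ht4⟩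
  simp only [mk_zero, mk_succ, zero_add] at ht4
  rw [show (fun i => I 8 i) = I 8 from rfl, show (fun i => I 9 i) = I 9 from rfl] at ht4
  have h6 : 6 * (t + 1) - 6 = 6 * t := by omega
  simp only [mk_update, List.length_cons, List.length_nil, Nat.reduceAdd,
      Nat.reduceLT, List.set_cons_succ, List.set_cons_zero, Expr.eval_add, Expr.eval_sub,
      Expr.eval_mem, Expr.eval_inp, Expr.eval_ofNat, mk_zero, mk_succ, sc_zero, eval_recPos, h6,
      Function.update_self, e2, e3, arr_cons_zero]
  generalize hrec' : Function.update (Function.update (Function.update (Function.update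
    (Function.update (Function.update rec (6 * t) (D.bdry t).length) (6 * t + 1) dp) (6 * t + 2)
    (I 15 t)) (6 * t + 3) (I 16 t)) (6 * t + 4) tp) (6 * t + 5) 0 = rec'
  have hnew : rec' (6 * t) = (D.bdry t).length ∧ rec' (6 * t + 1) = dp ∧ rec' (6 * t + 2) = I 15 t ∧
      rec' (6 * t + 3) = I 16 t ∧ rec' (6 * t + 4) = tp ∧ rec' (6 * t + 5) = 0 := by
    rw [← hrec']
    simp
  have hold : ∀ e, e ≠ t → ∀ k < 6, rec' (6 * e + k) = rec (6 * e + k) := by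
    intro e he k hk
    rw [← hrec', Function.update_of_ne (by omega), Function.update_of_ne (by omega),
      Function.update_of_ne (by omega), Function.update_of_ne (by omega),
      Function.update_of_ne (by omega), Function.update_of_ne (by omega)]
  clear hrec'
  obtain ⟨n0, n1, n2, n3, n4, n5⟩ := hnew
  refine (Wp.for (D.bdry t).length (fun j M => M = _root_.mk [0, sc i, Function.update x2 0 t, rec',
    overwrite dl dp j fun x => (D.bdry t).getD x 0, tab, sc dp, sc tp, M1 0,
    arr ((D.bdry t).length :: D.bdry t), sc (p ^ (D.bdry t).length), M4 0, Function.update x12 0 j,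
    Function.update x13 0 (t + 1)]) (fun _ => 2) ?_ ?_ ?_).mono ?_
  · rintro j hj _ rfl; simp
  · simp [mk_update, overwrite_zero]
  · rintro j hj _ rfl
    simp only [wp_seq, wp_set, mk_update, List.length_cons, List.length_nil, Nat.reduceAdd,
      Nat.reduceLT, List.set_cons_succ, List.set_cons_zero, Expr.eval_add, Expr.eval_sub,
      Expr.eval_mem, Expr.eval_inp, Expr.eval_ofNat, mk_zero, mk_succ, sc_zero,
      Function.update_self, Function.update_idem, arr_cons_succ]
    refine ⟨le_rfl, ?_⟩
    rw [← overwrite_succ]; rfl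
  rintro _ t5 ⟨rfl, ht5⟩
  simp only [mk_update, List.length_cons, List.length_nil, Nat.reduceAdd,
      Nat.reduceLT, List.set_cons_succ, List.set_cons_zero, Expr.eval_add, Expr.eval_sub,
      Expr.eval_mem, Expr.eval_inp, Expr.eval_ofNat, mk_zero, mk_succ, sc_zero,
      Function.update_self, arr_cons_zero, update_sc]
  refine (Wp.for (p ^ (D.bdry t).length) (fun j M => M = _root_.mk [0, sc i, Function.update x2 0 t, rec',
    overwrite dl dp (D.bdry t).length fun x => (D.bdry t).getD x 0, overwrite tab tp j (M4 0),
    sc (dp + (D.bdry t).length), sc tp, M1 0,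
    arr ((D.bdry t).length :: D.bdry t), sc (p ^ (D.bdry t).length), M4 0, Function.update x12 0 j,
    Function.update x13 0 (t + 1)]) (fun _ => 2) ?_ ?_ ?_).mono ?_
  · rintro j hj _ rfl; simp
  · simp [mk_update, overwrite_zero]
  · rintro j hj _ rfl
    simp only [wp_seq, wp_set, mk_update, List.length_cons, List.length_nil, Nat.reduceAdd,
      Nat.reduceLT, List.set_cons_succ, List.set_cons_zero, Expr.eval_add, Expr.eval_sub,
      Expr.eval_mem, Expr.eval_inp, Expr.eval_ofNat, mk_zero, mk_succ, sc_zero,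
      Function.update_self, Function.update_idem, arr_cons_succ]
    refine ⟨le_rfl, ?_⟩
    rw [← overwrite_succ]
  rintro _ t6 ⟨rfl, ht6⟩
  simp only [mk_update, List.length_cons, List.length_nil, Nat.reduceAdd,
      Nat.reduceLT, List.set_cons_succ, List.set_cons_zero, Expr.eval_add, Expr.eval_sub,
      Expr.eval_mem, Expr.eval_inp, Expr.eval_ofNat, mk_zero, mk_succ, sc_zero,
      Function.update_self, arr_cons_zero, update_sc]
  refine ⟨?_, _, _, _, _, _, _, _, _, _, _, _, _, rfl, ?_, e4⟩
  · rw [nodeTime]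
    have b1 : p ^ (D.bdry t).length ≤ p ^ (D.bdry t ++ D.ownA t).length :=
      Nat.pow_le_pow_right hp (by simp)
    have b2 : (D.bag t).length + 2 ≤ D.load es t := by
      rw [load]
      have : 2 * 1 ≤ (D.k + 2) * ((D.children t).length + 1) := Nat.mul_le_mul (by omega) (by omega)
      omega
    have b3 : (D.bdry t).length ≤ (D.bag t).length := List.length_filter_le _ _
    generalize D.load es t = L at *
    simp only [Finset.sum_const, Finset.card_range, smul_eq_mul] at ht5 ht6
    generalize entryTime _ _ _ _ _ _ _ _ _ = E at *
    generalize p ^ (D.bdry t ++ D.ownA t).length = q at *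
    generalize (D.bdry t ++ D.ownA t).length * 10 = a at *
    rw [show q * (E + a + 20) = q * (E + a + 17) + q * 3 by ring]
    generalize q * (E + a + 17) = w at *
    clear e4 hrec hold hR hS hf hI e1 e2 e3
    omega
  · intro e he hte
    rcases eq_or_lt_of_le hte with rfl | hlt
    · refine ⟨⟨n0, ?_, ?_, ?_, n5⟩, by rw [n1], by rw [n4]⟩
      · rw [n1]
        intro j hj
        rw [overwrite_add hj]; simp [hj]
      · rw [n2, n3]
        obtain ⟨ys, h1, h2, h3⟩ := hI.preorder.exists_list hI.order ht
        exact ⟨ys, h1, h2.symm, h3⟩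
      · rw [n4]
        intro φ
        rw [overwrite_add]
        · simpa using e4 φ
        · simpa using ofDigits_lt ((D.bdry t).map fun v => (φ v).val) (by
            intro d hd; obtain ⟨v, -, rfl⟩ := List.mem_map.1 hd; exact (φ v).2)
    · obtain ⟨r1, r2, r3⟩ := hrec e he (by omega)
      have hk := hold e (by omega)
      refine ⟨r1.congr hk (fun x hx => overwrite_lt (by omega)) (fun x hx => overwrite_lt (by omega)),
        ?_, ?_⟩
      · rw [hk 1 (by omega)]; omega
      · rw [hk 4 (by omega)]; omega

/-- The last table belongs to the root, whose part is `G` and whose boundary is empty. Its only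
entry is the optimal value. -/
theorem sweepP_spec (D : RootedDec H G) (hp : 1 ≤ p) (hH : H.Hereditary)
    (hR : Reduces g opt H K R) (hS : Solves g opt H f c d S) (hf : Monotone f)
    {Sz : ℕ} {I : Arrays} {es : List (ℕ × ℕ)} (hI : D.HoldsSweepInput es Sz I) :
    Wp I (sweepP p opt R S) 0 fun M' s => M' 0 0 = encValue (optValue g opt G) ∧
      s ≤ 3 + ∑ t ∈ Finset.range D.N, (D.nodeTime es (I 8) (I 9) p K f c d t + 2) := by
  rw [sweepP, wp_seq, zero_eq_mk 14]
  refine (Wp.for D.N (fun i M => ∃ x2 rec dl tab dp tp x8 x9 x10 x11 x12 x13,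
        M = _root_.mk [0, sc i, x2, rec, dl, tab, sc dp, sc tp, x8, x9, x10, x11, x12, x13] ∧
        D.HoldsRecords g opt rec dl (I 17) tab dp tp (D.N - i) ∧
        (0 < i → HoldsTable g opt x11 0 (D.part (D.N - i)).graph (D.bdry (D.N - i))))
    (fun i => D.nodeTime es (I 8) (I 9) p K f c d (D.N - 1 - i) + 1) ?_ ?_ ?_).mono ?_
  · rintro i hi _ ⟨x2, rec, dl, tab, dp, tp, x8, x9, x10, x11, x12, x13, rfl, -⟩
    simp [hI.N_eq]
  · refine ⟨0, 0, 0, 0, 0, 0, 0, 0, 0, 0, 0, 0, by simp [mk_update], ?_, by simp⟩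
    intro c h1 h2; omega
  · rintro i hi _ ⟨x2, rec, dl, tab, dp, tp, x8, x9, x10, x11, x12, x13, rfl, h1, -⟩
    rw [wp_seq]
    refine (D.nodeP_spec hp hH hR hS hf hI hi h1).mono ?_
    rintro _ s ⟨hs, x2, rec, dl, tab, dp, tp, x8, x9, x10, x11, x12, x13, rfl, h1, h2⟩
    rw [wp_set, show D.N - 1 - i = D.N - (i + 1) by omega]
    refine ⟨by omega, x2, rec, dl, tab, dp, tp, x8, x9, x10, x11, x12, x13, ?_, h1, fun _ => h2⟩
    simp [mk_update]
  · rintro _ s ⟨⟨x2, rec, dl, tab, dp, tp, x8, x9, x10, x11, x12, x13, rfl, -, h2⟩, hs⟩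
    rw [wp_set]
    have h3 := h2 D.N_pos
    rw [Nat.sub_self, D.part_zero, D.bdry_zero] at h3
    refine ⟨?_, ?_⟩
    · have h4 := h3 fun _ => ⟨0, hp⟩
      simp [mk_update] at h4 ⊢
      rw [h4, optValue_eq]
      rfl
    · rw [Finset.sum_range_reflect (fun t => D.nodeTime es (I 8) (I 9) p K f c d t + 1 + 1)] at hs
      simp only [add_assoc, Nat.reduceAdd] at hs ⊢
      omega

end RootedDec

/-! ### ## The whole program -/

/-- Computes the optimal value from a tree decomposition. -/
def mainP (p : ℕ) (opt : Opt) (R S : Prog) : Prog :=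
  .call mulP [.inp 0 0] 1 ;; .call adjP [.inp 1 0, .mem 1 0, .inp 0 1] 2 ;;
  .set 3 0 (.inp 0 1 + .inp 0 1) ;; .call marksP [.inp 1 0, .mem 3 0] 3 ;;
  .call partialSumsP [.inp 3 0, .inp 0 2] 4 ;; .call partialSumsP [.inp 5 0, .inp 0 2] 5 ;;
  .call topP [.inp 0 0, .inp 3 0, .mem 4 0, .inp 4 0, .inp 5 0, .mem 5 0, .inp 6 0] 6 ;;
  .call bucketP [.mem 6 0, .mem 1 0, .inp 0 0] 7 ;;
  .set 8 0 (.inp 0 2 - 1) ;; .call bucketP [.inp 2 1, .mem 1 0, .mem 8 0] 8 ;;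
  .call edgeKeyP [.inp 1 0, .mem 6 0, .inp 0 1] 9 ;;
  .call bucketP [.mem 9 0, .mem 1 0, .inp 0 1] 10 ;;
  .call subP [.inp 0 0, .inp 2 0, .mem 7 0, .mem 1 0] 11 ;;
  .call startP [.inp 0 0, .inp 2 0, .mem 7 0, .mem 1 0, .mem 11 0] 12 ;;
  .call orderP [.inp 0 0, .mem 7 0, .mem 1 0, .mem 12 0] 13 ;;
  .call (sweepP p opt R S) [.inp 0 0, .inp 1 0, .inp 3 0, .inp 4 0, .mem 4 0, .inp 5 0, .inp 6 0,
    .mem 5 0, .mem 1 0, .mem 2 0, .mem 3 0, .mem 6 0, .mem 7 0, .mem 8 0, .mem 10 0, .mem 11 0,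
    .mem 12 0, .mem 13 0] 0

/-- The place of a list in a concatenation is the partial sum of the lengths. -/
theorem holds_flatten (L : List (List ℕ)) (t : ℕ) (ht : t < L.length) :
    Holds (arr L.flatten) (∑ s ∈ Finset.range t, arr (L.map List.length) s) L[t] := by
  induction L generalizing t with
  | nil => simp at ht
  | cons l L ih =>
    cases t with
    | zero =>
      intro i hi
      have hi : i < l.length := by simpa using hi
      simp [arr, List.getElem?_append, hi]
    | succ t =>
      rw [Finset.sum_range_succ']
      intro i hi
      have := ih t (by simpa using ht) i (by simpa using hi)
      simp only [arr, List.flatten_cons, List.map_cons, List.getD_cons_succ, List.getD_cons_zero] at this ⊢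
      rw [show ∑ s ∈ Finset.range t, (L.map List.length).getD s 0 + l.length + i =
        l.length + (∑ s ∈ Finset.range t, (L.map List.length).getD s 0 + i) by ring,
        List.getD_append_right _ _ _ _ (by omega), Nat.add_sub_cancel_left, this]
      simp

section

variable {N : ℕ} (as : Fin N → List ℕ)

theorem arr_ofFn {N : ℕ} (w : Fin N → ℕ) (t : ℕ) (ht : t < N) : arr (List.ofFn w) t = w ⟨t, ht⟩ := by
  rw [arr_get _ _ (by simpa using ht)]; simp

theorem arr_ofFn_length (t : ℕ) (ht : t < N) :
    arr (List.ofFn fun t => (as t).length) t = (extendLists as t).length := by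
  rw [arr_ofFn _ t ht, ← extendLists_val as ⟨t, ht⟩]

theorem holds_ofFn_flatten (t : ℕ) (ht : t < N) :
    Holds (arr (List.ofFn as).flatten)
      (∑ s ∈ Finset.range t, arr (List.ofFn fun t => (as t).length) s) (extendLists as t) := by
  have := holds_flatten (List.ofFn as) t (by simpa using ht)
  rw [List.map_ofFn] at this
  simp [extendLists, ht] at this ⊢
  exact this

theorem ofFn_flatten_length : (List.ofFn as).flatten.length =
    ∑ t ∈ Finset.range N, (extendLists as t).length := by
  rw [List.length_flatten, List.map_ofFn, List.sum_ofFn, ← Fin.sum_univ_eq_sum_range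
    (fun t => (extendLists as t).length) N]
  exact Finset.sum_congr rfl fun t _ => by rw [extendLists_val]; rfl

end

theorem arr_range_map (k S v : ℕ) (h : v < k) : arr ((List.range k).map (· * S)) v = v * S := by
  rw [arr_get _ _ (by simpa using h)]; simp

/-- The keys are shifted because first nodes are stored plus one. -/
theorem bucket_eq_filter (key top : ℕ → ℕ) (L k : ℕ) (h : ∀ i < L, key i = top i + 1) :
    bucket key L (k + 1) = (List.range L).filter fun i => top i = k := by
  refine List.filter_congr fun i hi => ?_
  rw [h i (List.mem_range.1 hi)]
  simp

theorem HTreeDec.rooted_par {H : GraphClass} {G : FinGraph} (D : HTreeDec H G)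
    {parent : Fin D.N → Fin D.N} (hp : IsParentMap D.T parent) {n : ℕ}
    (hn : G.verts = Finset.range n) {as bs : Fin D.N → List ℕ} (has : ∀ t, ListsSet (as t) (D.α t))
    (hbs : ∀ t, ListsSet (bs t) (D.β t)) :
    (D.rooted hp hn has hbs).par = arr (List.ofFn fun t => (parent t).val) := by
  funext t
  by_cases h : t < D.N
  · rw [arr_ofFn _ t h]; simp [rooted, h]
  · simp [rooted, h, arr]

theorem mem_flat {l : List (ℕ × ℕ)} {v : ℕ} : v ∈ flat l ↔ ∃ e ∈ toEdges l, v ∈ e := by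
  simp [flat, toEdges]

set_option maxHeartbeats 2000000 in
-- The functions `row` and `adj` occur in the statement because `nodeTime` counts edges that are
-- read off the matrix.
theorem mainP_spec {p : ℕ} {g : PartitionEval p} {opt : Opt} {H : GraphClass} {f : ℕ → ℕ}
    {c d K : ℕ} {R S : Prog} (hp : 1 ≤ p) (hH : H.Hereditary)
    (hR : Reduces g opt H K R) (hS : Solves g opt H f c d S) (hf : Monotone f)
    {n : ℕ} {G : FinGraph} (T : HTreeDec H G)
    {parent : Fin T.N → Fin T.N} {es : List (ℕ × ℕ)} {as bs : Fin T.N → List ℕ}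
    (hn : G.verts = Finset.range n) (hpar : IsParentMap T.T parent) (hes : ListsEdges es G.edges)
    (has : ∀ t, ListsSet (as t) (T.α t)) (hbs : ∀ t, ListsSet (bs t) (T.β t))
    {D : RootedDec H G} (hD : D = T.rooted hpar hn has hbs) :
    ∃ row adj : ℕ → ℕ, (∀ u < n, ∀ v < n, adj (row u + v) ≠ 0 ↔ s(u, v) ∈ G.edges) ∧
      (mainP p opt R S).ComputesWithin (encDec n es parent as bs) (encValue (optValue g opt G))
        (200 * (n + es.length + D.N + 1 + ∑ t ∈ Finset.range D.N, (D.bag t).length) +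
          ∑ t ∈ Finset.range D.N, (D.nodeTime es row adj p K f c d t + 2)) := by
  have hDn : D.n = n := by rw [hD]; rfl
  have hDN : D.N = T.N := by rw [hD]; rfl
  have hDpar : D.par = arr (List.ofFn fun t => (parent t).val) := by rw [hD]; exact T.rooted_par ..
  have hDas : D.as = extendLists as := by rw [hD]; rfl
  have hDbs : D.bs = extendLists bs := by rw [hD]; rfl
  clear hD
  set I : Arrays := load (encDec n es parent as bs) with hI
  have hI' : I = mk [arr [n, es.length, T.N], arr (flat es), arr (List.ofFn fun t => (parent t).val),
    arr (List.ofFn fun t => (as t).length), arr (List.ofFn as).flatten,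
    arr (List.ofFn fun t => (bs t).length), arr (List.ofFn bs).flatten] := by
    rw [hI, load_eq_mk]; rfl
  have hS1 : n < n + es.length + T.N + 1 := by omega
  -- The row length exceeds `n`, `m` and `N`, so the matrix and the buckets of vertices, edges and
  -- children can share one table of multiples.
  obtain ⟨Sz, hSz⟩ : ∃ Sz, Sz = n + es.length + T.N + 1 := ⟨_, rfl⟩
  obtain ⟨row, hrow⟩ : ∃ row, row = arr ((List.range (n + T.N + 1)).map (· * Sz)) := ⟨_, rfl⟩
  have hrow' : ∀ v ≤ n + T.N, row v = v * Sz := fun v hv => by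
    rw [hrow, arr_range_map _ _ _ (by omega)]
  have hesn : ∀ e ∈ es, e.1 < n ∧ e.2 < n := by
    intro e he
    have := D.edge_lt (u := e.1) (v := e.2) (by
      rw [← hes.2, List.mem_toFinset]; exact List.mem_map.2 ⟨e, he, rfl⟩)
    rwa [hDn] at this
  have hmem : ∀ u < n, ∀ v < n, row u + v ∈ adjList row es ↔ s(u, v) ∈ G.edges := by
    intro u hu v hv
    rw [adjList_mem (n := n) (S := Sz) (fun v hv => hrow' v (by omega)) (by omega) hesn hu hv,
      ← List.mem_toFinset, hes.2]
  have hpl : ∀ t < T.N, t ≠ 0 → D.par t < t := fun t ht => D.par_lt t (by omega)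
  have hsum : ∑ t ∈ Finset.range D.N, (D.bag t).length =
      (List.ofFn as).flatten.length + (List.ofFn bs).flatten.length := by
    rw [ofFn_flatten_length, ofFn_flatten_length, hDN, ← Finset.sum_add_distrib]
    exact Finset.sum_congr rfl fun t _ => by rw [RootedDec.bag, hDas, hDbs, List.length_append]
  have hown : ∑ t ∈ Finset.range T.N, ((D.own t).length * 3 + 4) = n * 3 + T.N * 4 := by
    rw [Finset.sum_add_distrib, ← Finset.sum_mul, ← hDN, D.sum_own, hDn]; simp
  have htop : ∑ t ∈ Finset.range T.N, (((extendLists as t).length + (extendLists bs t).length) * 5 + 6) =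
      ((List.ofFn as).flatten.length + (List.ofFn bs).flatten.length) * 5 + T.N * 6 := by
    rw [Finset.sum_add_distrib, ← Finset.sum_mul, Finset.sum_add_distrib, ofFn_flatten_length,
      ofFn_flatten_length]; simp
  refine ⟨row, marks (adjList row es), fun u hu v hv => by
    rw [← hmem u hu v hv, ← not_iff_not, not_not]; exact marks_eq_zero, ?_⟩
  -- The other half of the constant 200 pays for loading the input.
  suffices h : Wp I (mainP p opt R S) 0 fun M' t => M' 0 0 = encValue (optValue g opt G) ∧
      t ≤ 100 * (n + es.length + D.N + 1 + ∑ t ∈ Finset.range D.N, (D.bag t).length) +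
      ∑ t ∈ Finset.range D.N, (D.nodeTime es row (marks (adjList row es)) p K f c d t + 2) by
    obtain ⟨M', t, he, ho, ht⟩ := h
    refine ⟨M', t, he, ho, ?_⟩
    simp only [encDec, List.map_cons, List.map_nil, List.sum_cons, List.sum_nil, List.length_cons,
      List.length_nil, flat_length, List.length_ofFn]
    rw [hsum] at ht ⊢
    omega
  rw [hsum]
  rw [mainP, zero_eq_mk 14, hI']
  simp only [wp_seq, wp_set, wp_call, passArgs_eq, List.map_cons, List.map_nil, deref_inp, deref_mem]
  refine (mulP_spec _ n es.length T.N ?_ ?_ ?_).mono ?_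
  · simp
  · simp
  · simp
  rintro M1 t1 ⟨e1, ht1⟩
  rw [← hSz, ← hrow] at e1
  refine (adjP_spec _ es ?_ ?_).mono ?_
  · simp; exact holds_arr _
  · simp
  rintro M2 t2 ⟨e2, ht2⟩
  have hr : (fun i => row (0 + i)) = row := by simp
  simp [mk_update, e1] at e2
  refine (marksP_spec _ (flat es) ?_ ?_).mono ?_
  · simp; exact holds_arr _
  · simp [mk_update]
  rintro M3 t3 ⟨e3, ht3⟩
  refine (partialSumsP_spec _ T.N ?_).mono ?_
  · simp
  rintro M4 t4 ⟨e4, ht4⟩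
  refine (partialSumsP_spec _ T.N ?_).mono ?_
  · simp
  rintro M5 t5 ⟨e5, ht5⟩
  simp at e4 e5
  have e4' : ∀ t < T.N, M4 0 t = ∑ s ∈ Finset.range t, arr (List.ofFn fun t => (as t).length) s := by
    intro t ht
    rw [e4, arr_get _ _ (by simpa using ht)]; simp
  have e5' : ∀ t < T.N, M5 0 t = ∑ s ∈ Finset.range t, arr (List.ofFn fun t => (bs t).length) s := by
    intro t ht
    rw [e5, arr_get _ _ (by simpa using ht)]; simp
  refine (topP_spec _ T.N (extendLists as) (extendLists bs) ?_ ?_ ?_ ?_ ?_).mono ?_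
  · simp
  · simpa using arr_ofFn_length as
  · intro t ht
    simp [mk_update, e4' t ht]; exact holds_ofFn_flatten as t ht
  · simpa using arr_ofFn_length bs
  · intro t ht
    simp [mk_update, e5' t ht]; exact holds_ofFn_flatten bs t ht
  rintro M6 t6 ⟨e6, ht6⟩
  have e6' : ∀ v < n, M6 0 v = D.top v + 1 := by
    intro v hv
    rw [e6]
    have hv' : v < D.n := by omega
    have h1 := D.top_lt v hv'
    refine firstArr_eq (fun t => extendLists as t ++ extendLists bs t) T.N v (D.top v) (by omega) ?_ ?_
    · have := D.top_mem v hv'; rwa [hDas, hDbs] at this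
    · intro s hs hvs
      have := D.top_le s (by omega) v (by rw [hDas, hDbs]; exact hvs)
      omega
  refine (bucketP_spec _ n (T.N + 1) Sz ?_ ?_ ?_ (by omega)).mono ?_
  · simp
  · intro v hv
    have := D.top_lt v (by omega)
    simp [mk_update, e6' v hv]; omega
  · intro k hk
    simp [mk_update, e1, hrow' k (by omega)]
  rintro M7 t7 ⟨e7, ht7⟩
  simp [mk_update] at e7
  have e7' : ∀ t < T.N, Holds (M7 0) ((t + 1) * Sz) ((D.own t).length :: D.own t) := by
    intro t ht
    have := e7 (t + 1) (by omega)
    rwa [bucket_eq_filter _ D.top n t (by simpa using e6'), ← hDn] at this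
  have e8 : ∀ t < T.N, M7 0 (row (t + 1)) = (D.own t).length := by
    intro t ht
    rw [hrow' (t + 1) (by omega)]; exact (holds_cons.1 (e7' t ht)).1
  -- The pointer skips the entry of the root, so the index `j` stands for the node `j + 1`.
  refine (bucketP_spec _ (T.N - 1) T.N Sz ?_ ?_ ?_ (by omega)).mono ?_
  · simp [mk_update]
  · intro j hj
    have := D.par_lt (j + 1) (by omega) (by omega)
    simp [mk_update, ← hDpar, add_comm 1 j]; omega
  · intro k hk
    simp [mk_update, e1, hrow' k (by omega)]
  rintro M8 t8 ⟨e8c, ht8⟩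
  simp [mk_update] at e8c
  have e8' : ∀ t < T.N, Holds (M8 0) (t * Sz) ((D.children t).length :: D.children t) := by
    intro t ht
    have := e8c t ht
    rwa [← hDpar, show (bucket (fun i => D.par (1 + i)) (T.N - 1) t) = D.children t by
      rw [RootedDec.children, ← hDN, bucket]; simp only [add_comm 1]] at this
  refine (edgeKeyP_spec _ es ?_ ?_).mono ?_
  · simp; exact holds_arr _
  · simp
  rintro M9 t9 ⟨e9, ht9⟩
  simp [mk_update] at e9
  have e9' : ∀ i < es.length, M9 0 i =
      max (D.top (es.getD i (0, 0)).1) (D.top (es.getD i (0, 0)).2) + 1 := by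
    intro i hi
    obtain ⟨l1, l2⟩ := hesn _ (List.getElem_mem hi)
    rw [e9, arr_get _ _ (by simpa using hi)]
    simp [e6' _ l1, e6' _ l2, hi]
  refine (bucketP_spec _ es.length (T.N + 1) Sz ?_ ?_ ?_ (by omega)).mono ?_
  · simp
  · intro i hi
    obtain ⟨l1, l2⟩ := hesn _ (List.getElem_mem hi)
    have := D.top_lt _ (hDn ▸ l1)
    have := D.top_lt _ (hDn ▸ l2)
    simp [mk_update, e9' i hi, hi]; omega
  · intro k hk
    simp [mk_update, e1, hrow' k (by omega)]
  rintro M10 t10 ⟨e10, ht10⟩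
  simp [mk_update] at e10
  have e10' : ∀ t < T.N, Holds (M10 0) ((t + 1) * Sz)
      ((D.ownEdges es t).length :: D.ownEdges es t) := by
    intro t ht
    have := e10 (t + 1) (by omega)
    rwa [bucket_eq_filter _ _ es.length t (by simpa using e9')] at this
  refine (subP_spec _ T.N ?_ ?_).mono ?_
  · simp
  · simpa [← hDpar] using hpl
  rintro M11 t11 ⟨e11, ht11⟩
  refine (startP_spec _ T.N ?_ ?_).mono ?_
  · simp
  · simpa [← hDpar] using hpl
  rintro M12 t12 ⟨⟨e120, e12⟩, ht12⟩
  simp [mk_update, e1, ← hDpar] at e11 e12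
  have hpre : D.IsPreorder (M11 0) (M12 0) := by
    refine ⟨?_, e120, ?_⟩
    · intro t ht
      rw [hDN] at ht ⊢
      rw [← e8 t ht]; exact e11 t ht
    · intro t ht h0
      have := D.par_lt t ht h0
      rw [← e8 _ (by omega)]; exact e12 t (by omega) h0
  refine (orderP_spec _ T.N D.own ?_ ?_ ?_).mono ?_
  · simp
  · intro t ht
    simp [mk_update, e1, hrow' (t + 1) (by omega)]; exact e7' t ht
  · intro t ht t' ht' j hj j' hj' he
    refine hpre.place_injective (by omega) (by omega) hj hj' ?_
    simpa [mk_update] using he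
  rintro M13 t13 ⟨e13, ht13⟩
  simp [mk_update] at e13
  have hin : D.HoldsSweepInput es Sz (mk [arr [n, es.length, T.N], arr (flat es),
      arr (List.ofFn fun t => (as t).length), arr (List.ofFn as).flatten, M4 0,
      arr (List.ofFn fun t => (bs t).length), arr (List.ofFn bs).flatten, M5 0, row,
      marks (adjList row es), M3 0, M6 0, M7 0, M8 0, M10 0, M11 0, M12 0, M13 0]) := by
    refine ⟨hes, hDn.symm, hDN.symm, holds_arr _, ?_, ?_, ?_, ?_, ?_, by omega, ?_, ?_, ?_, ?_, ?_, ?_,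
      hpre, ?_⟩
    · rw [hDN, hDas]; exact arr_ofFn_length as
    · intro t ht
      rw [hDN] at ht
      simp [e4' t ht, hDas]; exact holds_ofFn_flatten as t ht
    · rw [hDN, hDbs]; exact arr_ofFn_length bs
    · intro t ht
      rw [hDN] at ht
      simp [e5' t ht, hDbs]; exact holds_ofFn_flatten bs t ht
    · rw [hDN, hDn]; exact hrow'
    · intro u hu v hv
      rw [hn, Finset.mem_range] at hu hv
      simp only [mk_zero, mk_succ, zero_add, marks, hmem u hu v hv]
      exact ⟨fun h => if_pos h, fun h => if_neg h⟩
    · intro v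
      simp only [mk_zero, mk_succ, e3, marks, mem_flat, RootedDec.NonIsolated, ← hes.2, List.mem_toFinset]
    · rw [hDn]; exact e6'
    · rw [hDN]; exact e7'
    · rw [hDN]; exact e8'
    · rw [hDN]; exact e10'
    · rw [hDN]; exact e13
  have hw := D.sweepP_spec hp hH hR hS hf hin
  simp [mk_update, e1, e2, -List.length_flatten]
  refine hw.mono ?_
  rintro M14 t14 ⟨e14, ht14⟩
  refine ⟨e14, ?_⟩
  simp only [mk_zero, mk_succ] at ht14
  rw [htop] at ht6
  rw [hown] at ht13
  simp only [flat_length] at ht3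
  rw [hDN] at ht14 ⊢
  generalize ∑ t ∈ Finset.range T.N, (D.nodeTime es row (marks (adjList row es)) p K f c d t + 2) = W at *
  clear hw hin e13 e14 e12 e11 e10 e9 e8c e7 e6 e5 e4 e3 e2 e1
  omega

/-! ### ## The running time -/

/-- Superadditivity of a positive power: all factors of `x t ^ c` but one are bounded by the whole
sum. For `c = 0` the left side would be the number of terms. -/
theorem sum_pow_le (s : Finset ℕ) (x : ℕ → ℕ) (c : ℕ) (hc : c ≠ 0) :
    ∑ t ∈ s, x t ^ c ≤ (∑ t ∈ s, x t) ^ c := by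
  obtain ⟨c, rfl⟩ := Nat.exists_eq_succ_of_ne_zero hc
  simp only [Nat.succ_eq_add_one, pow_succ, Finset.mul_sum]
  refine Finset.sum_le_sum fun t ht => Nat.mul_le_mul_right _ ?_
  exact Nat.pow_le_pow_left (Finset.single_le_sum (fun _ _ => Nat.zero_le _) ht) c

/-- A hereditary class that contains some graph contains the graph without vertices. -/
theorem GraphClass.Hereditary.empty_mem {H : GraphClass} (hH : H.Hereditary) {G Γ : FinGraph}
    {S : Finset ℕ} (hG : G.induce S ∈ H.mem) (hV : Γ.verts = ∅) : Γ ∈ H.mem := by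
  have := hH.induce_mem hG (Finset.empty_subset S)
  convert this
  ext e
  · simp [FinGraph.induce, hV]
  · rw [FinGraph.mem_induce_edges]
    induction e with
    | _ u v =>
      constructor
      · intro h
        have := Γ.mem_verts _ h u (by simp)
        simp [hV] at this
      · rintro ⟨-, h⟩
        have := h u (by simp)
        simp at this

section

variable {p : ℕ} {g : PartitionEval p} {opt : Opt} {H : GraphClass} {f : ℕ → ℕ} {c d K : ℕ}
  {S : Prog}

/-- Loading counts as time, so the time bound is at least the number of input cells: three sizes,
two cells per edge and two per annotated vertex. -/
theorem Solves.size_le (hp : 1 ≤ p) (hS : Solves g opt H f c d S) {Γ : FinGraph} {vl A : List ℕ}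
    {el : List (ℕ × ℕ)} (hV : ListsSet vl Γ.verts) (hE : ListsEdges el Γ.edges) (hA : A.Nodup)
    (hAV : A.toFinset ⊆ Γ.verts) (hH : Γ.del A.toFinset ∈ H.mem) :
    3 + 2 * el.length + 2 * A.length ≤ f A.length * (vl.length + 1) ^ c * (el.length + 1) ^ d := by
  have hd : dom (colourClasses (fun _ => (⟨0, hp⟩ : Fin p)) A.toFinset) = A.toFinset :=
    (colourClasses_isPPartition _ _).2
  have := hS.renamed (nn := fun v => vl.idxOf v) hV hE (listsPartition_map A hA fun _ => ⟨0, hp⟩)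
    (by rw [hd]; exact colourClasses_isPPartition _ _) (by rw [hd]; exact hAV) (by rwa [hd])
    (fun j h => hV.1.idxOf_getElem j h)
  rw [hd, List.toFinset_card_of_nodup hA] at this
  obtain ⟨M, t, -, -, ht⟩ := this
  simp only [encAnnotated, List.map_cons, List.map_nil, List.sum_cons, List.sum_nil,
    List.length_cons, List.length_nil, flat_length, List.length_map] at ht
  omega

/-- The instance is the complete graph on `j` vertices with all vertices annotated; deleting them
leaves the empty graph, which is in `H`. -/
theorem Solves.sq_le (hp : 1 ≤ p) (hS : Solves g opt H f c 0 S)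
    (hH : ∀ Γ : FinGraph, Γ.verts = ∅ → Γ ∈ H.mem) (j : ℕ) : j * j ≤ f j * (j + 1) ^ c := by
  let Γ : FinGraph :=
    { verts := Finset.range j
      edges := (Finset.range j).offDiag.image Sym2.mk.uncurry
      not_diag := by
        intro e he
        obtain ⟨⟨u, v⟩, h, rfl⟩ := Finset.mem_image.1 he
        simpa using (Finset.mem_offDiag.1 h).2.2
      mem_verts := by
        intro e he w hw
        obtain ⟨⟨u, v⟩, h, rfl⟩ := Finset.mem_image.1 he
        obtain ⟨h1, h2, -⟩ := Finset.mem_offDiag.1 h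
        rcases Sym2.mem_iff.1 hw with rfl | rfl <;> assumption }
  -- `Quot.out` chooses an orientation of every edge.
  have hl : toEdges (Γ.edges.toList.map Quot.out) = Γ.edges.toList := by
    rw [toEdges, List.map_map]
    conv_rhs => rw [← List.map_id Γ.edges.toList]
    exact List.map_congr_left fun e _ => Quot.out_eq e
  have := hS.size_le hp (Γ := Γ) (vl := List.range j) (A := List.range j)
    (el := Γ.edges.toList.map Quot.out) ⟨List.nodup_range, by ext; simp [Γ]⟩
    ⟨by rw [hl]; exact Finset.nodup_toList _, by rw [hl]; simp⟩ List.nodup_range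
    (by intro v; simp [Γ]) (hH _ ?_)
  · have hc : Γ.edges.card = j.choose 2 := by
      have := Sym2.card_image_offDiag (Finset.range j)
      simpa [Γ] using this
    rw [List.length_map, Finset.length_toList, hc, pow_zero, mul_one, List.length_range,
      Nat.choose_two_right, Nat.mul_div_cancel' (Nat.even_mul_pred_self j).two_dvd] at this
    cases j with
    | zero => simp
    | succ j =>
      simp only [Nat.add_sub_cancel] at this
      nlinarith
  · ext v
    simp [Γ, FinGraph.del, FinGraph.induce]

namespace RootedDec

open scoped Classical

variable {G : FinGraph} (D : RootedDec H G)

/-- The size of a node. -/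
noncomputable def weight (t : ℕ) : ℕ := (D.bag t).length + (D.k + 2) * ((D.children t).length + 1)

/-- The new vertices sum to `n` and the children to `N - 1`; the rest is `O(k + 1)` for each node.
-/
theorem sum_weight_le : ∑ t ∈ Finset.range D.N, D.weight t ≤ 6 * ((D.k + 1) * max D.n D.N) := by
  have h1 : ∑ t ∈ Finset.range D.N, D.weight t ≤ ∑ t ∈ Finset.range D.N,
      ((D.own t).length + (D.k + 1) + (D.k + 2) * ((D.children t).length + 1)) :=
    Finset.sum_le_sum fun t ht => Nat.add_le_add_right (D.bag_length (Finset.mem_range.1 ht)) _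
  have h0 : ∑ t ∈ Finset.range D.N, ((D.children t).length + 1) = D.N - 1 + D.N := by
    rw [Finset.sum_add_distrib, D.sum_children]; simp
  rw [Finset.sum_add_distrib, Finset.sum_add_distrib, D.sum_own, ← Finset.mul_sum, h0] at h1
  simp only [Finset.sum_const, Finset.card_range, smul_eq_mul] at h1
  have h2 := le_max_left D.n D.N
  have h3 := le_max_right D.n D.N
  generalize max D.n D.N = x at *
  have h4 : (D.k + 2) * (D.N - 1 + D.N) ≤ (D.k + 2) * (2 * x) := Nat.mul_le_mul_left _ (by omega)
  have h5 : D.N * (D.k + 1) ≤ x * (D.k + 1) := Nat.mul_le_mul_right _ h3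
  nlinarith

/-- Replaces `|A|` by `k + 1` and separates the overhead, linear in the size of the node, from the
time of the solver. -/
theorem nodeTime_le (hp : 1 ≤ p) (hf : Monotone f) {row adj : ℕ → ℕ} {es : List (ℕ × ℕ)}
    {t : ℕ} (ht : t < D.N) :
    D.nodeTime es row adj p K f c d t + 2 ≤ p ^ (D.k + 1) * ((121 * K + 390) * (D.weight t +
      (D.pieceEdges row adj es t).length + (D.bdry t).length * (D.bdry t).length) +
      f (D.k + 1 + K) * (((D.piece t).length + K * ((D.ownB t).length + 1) + 1) ^ c *
        ((D.pieceEdges row adj es t).length + K * ((D.ownB t).length + 1) + 1) ^ d)) := by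
  have h1 := D.annotated_length ht
  have h2 := D.ownB_length ht
  have h3 := D.piece_length ht
  have h4 := (D.pieceEdges_length (row := row) (adj := adj) (es := es) (t := t)).1
  have hP : 1 ≤ p ^ (D.k + 1) := Nat.one_le_pow _ _ hp
  have hload : D.load es t ≤ D.weight t + (D.pieceEdges row adj es t).length +
      (D.bdry t).length * (D.bdry t).length := by
    rw [load, weight]; omega
  rw [nodeTime, entryTime]
  generalize (D.pieceEdges row adj es t).length = m at *
  generalize (D.bdry t).length * (D.bdry t).length = q at *
  have hw : 2 ≤ D.weight t := by
    rw [weight]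
    have : 2 * 1 ≤ (D.k + 2) * ((D.children t).length + 1) := Nat.mul_le_mul (by omega) (by omega)
    omega
  have h5 : K * ((D.ownB t).length + 1) ≤ K * D.weight t := by
    refine Nat.mul_le_mul_left _ ?_
    rw [weight]
    have : 1 * ((D.children t).length + 1) ≤ (D.k + 2) * ((D.children t).length + 1) :=
      Nat.mul_le_mul_right _ (by omega)
    omega
  have h6 : K * ((D.bdry t ++ D.ownA t).length + 1) * ((D.children t).length + 1) ≤ K * D.weight t := by
    rw [mul_assoc]
    refine Nat.mul_le_mul_left _ ?_
    rw [weight]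
    have : ((D.bdry t ++ D.ownA t).length + 1) * ((D.children t).length + 1) ≤
      (D.k + 2) * ((D.children t).length + 1) := Nat.mul_le_mul_right _ (by omega)
    omega
  have h7 : (D.piece t).length + D.k + 2 ≤ D.weight t := by
    rw [weight]
    have : (D.k + 2) * 1 ≤ (D.k + 2) * ((D.children t).length + 1) := Nat.mul_le_mul_left _ (by omega)
    omega
  have h8 : f ((D.bdry t ++ D.ownA t).length + K) ≤ f (D.k + 1 + K) := hf (by omega)
  have h9 : p ^ (D.bdry t ++ D.ownA t).length ≤ p ^ (D.k + 1) := Nat.pow_le_pow_right hp h1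
  rw [mul_assoc (f ((D.bdry t ++ D.ownA t).length + K))]
  generalize ((D.piece t).length + K * ((D.ownB t).length + 1) + 1) ^ c *
    (m + K * ((D.ownB t).length + 1) + 1) ^ d = X
  have h10 := Nat.mul_le_mul_right X h8
  generalize f (D.k + 1 + K) * X = Y at *
  have h11 : 140 * D.load es t + 2 ≤ p ^ (D.k + 1) * (141 * (D.weight t + m + q)) := by
    refine le_trans ?_ (Nat.le_mul_of_pos_left _ hP)
    omega
  refine le_trans (Nat.add_le_add_right (Nat.add_le_add_left (Nat.mul_le_mul h9
    (le_refl _)) _) _) ?_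
  have h12 : 61 * (K * ((D.bdry t ++ D.ownA t).length + 1) * ((D.children t).length + 1)) +
      60 * ((D.piece t).length + m + K * ((D.ownB t).length + 1) + 1) + 2 +
      f ((D.bdry t ++ D.ownA t).length + K) * X + (D.bdry t ++ D.ownA t).length * 10 + 20 ≤
      (121 * K + 249) * (D.weight t + m + q) + Y := by
    have : (121 * K + 249) * (D.weight t + m + q) = 121 * (K * D.weight t) + 121 * (K * (m + q)) +
      249 * (D.weight t + m + q) := by ring
    rw [this]
    omega
  have h13 := Nat.mul_le_mul_left (p ^ (D.k + 1)) h12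
  have h14 : p ^ (D.k + 1) * ((121 * K + 390) * (D.weight t + m + q) + Y) =
    p ^ (D.k + 1) * (141 * (D.weight t + m + q)) + p ^ (D.k + 1) * ((121 * K + 249) * (D.weight t + m + q) + Y) := by
    ring
  rw [h14]
  omega

end RootedDec

end

namespace RootedDec

open scoped Classical

variable {p : ℕ} {g : PartitionEval p} {opt : Opt} {H : GraphClass} {f : ℕ → ℕ} {c d K : ℕ}
  {S : Prog} {G : FinGraph} (D : RootedDec H G) {row adj : ℕ → ℕ} {es : List (ℕ × ℕ)}

/-- The total size of the nodes, their pieces and their boundaries. -/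
noncomputable def totalSize (row adj : ℕ → ℕ) (es : List (ℕ × ℕ)) : ℕ :=
  ∑ t ∈ Finset.range D.N, (D.weight t + (D.pieceEdges row adj es t).length +
    (D.bdry t).length * (D.bdry t).length)

/-- The total of the factors in the running times of the solver. -/
noncomputable def totalSolve (row adj : ℕ → ℕ) (es : List (ℕ × ℕ)) (K c d : ℕ) : ℕ :=
  ∑ t ∈ Finset.range D.N, ((D.piece t).length + K * ((D.ownB t).length + 1) + 1) ^ c *
    ((D.pieceEdges row adj es t).length + K * ((D.ownB t).length + 1) + 1) ^ d

theorem sum_nodeTime_add_two_le (hp : 1 ≤ p) (hf : Monotone f) :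
    ∑ t ∈ Finset.range D.N, (D.nodeTime es row adj p K f c d t + 2) ≤ p ^ (D.k + 1) *
      ((121 * K + 390) * D.totalSize row adj es + f (D.k + 1 + K) * D.totalSolve row adj es K c d) := by
  rw [totalSize, totalSolve, Finset.mul_sum, Finset.mul_sum, ← Finset.sum_add_distrib,
    Finset.mul_sum]
  exact Finset.sum_le_sum fun t ht => D.nodeTime_le hp hf (Finset.mem_range.1 ht)

/-- The preprocessing and the loading are linear in the input, and the input is covered by the bags
and the new edges of the nodes. -/
theorem outer_le (hes : ListsEdges es G.edges) :
    200 * (D.n + es.length + D.N + 1 + ∑ t ∈ Finset.range D.N, (D.bag t).length) ≤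
      600 * D.totalSize row adj es := by
  have h1 : ∑ t ∈ Finset.range D.N, ((D.bag t).length + 2) ≤ ∑ t ∈ Finset.range D.N, D.weight t := by
    refine Finset.sum_le_sum fun t _ => ?_
    rw [weight]
    have : 2 * 1 ≤ (D.k + 2) * ((D.children t).length + 1) := Nat.mul_le_mul (by omega) (by omega)
    omega
  have h2 : D.n ≤ ∑ t ∈ Finset.range D.N, (D.bag t).length := by
    rw [← D.sum_own]
    refine Finset.sum_le_sum fun t _ => ((D.own_nodup t).subperm fun v hv => ?_).length_le
    obtain ⟨h1, h2⟩ := List.mem_filter.1 hv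
    have := D.top_mem v (List.mem_range.1 h1)
    rwa [of_decide_eq_true h2] at this
  have h3 : es.length ≤ ∑ t ∈ Finset.range D.N, (D.pieceEdges row adj es t).length := by
    rw [← D.sum_ownEdges hes]
    exact Finset.sum_le_sum fun t _ => D.pieceEdges_length.1
  have h4 := D.N_pos
  rw [totalSize, Finset.sum_add_distrib, Finset.sum_add_distrib]
  rw [Finset.sum_add_distrib] at h1
  simp only [Finset.sum_const, Finset.card_range, smul_eq_mul] at h1
  omega

theorem sum_pieceEdges_le (hes : ListsEdges es G.edges) :
    ∑ t ∈ Finset.range D.N, (D.pieceEdges row adj es t).length ≤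
      es.length + ∑ t ∈ Finset.range D.N, (D.bdry t).length * (D.bdry t).length := by
  rw [← D.sum_ownEdges hes, ← Finset.sum_add_distrib]
  exact Finset.sum_le_sum fun t _ => D.pieceEdges_length.2

theorem sum_bdry_sq_le {x : ℕ} (h : ∀ t < D.N, (D.bdry t).length * (D.bdry t).length ≤ x) :
    ∑ t ∈ Finset.range D.N, (D.bdry t).length * (D.bdry t).length ≤ x * max D.n D.N := by
  refine (Finset.sum_le_card_nsmul _ _ x fun t ht => h t (Finset.mem_range.1 ht)).trans ?_
  rw [Finset.card_range, smul_eq_mul, mul_comm]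
  exact Nat.mul_le_mul_left _ (le_max_right _ _)

theorem bdry_le {t : ℕ} (ht : t < D.N) : (D.bdry t).length ≤ D.k + 1 := by
  have := D.annotated_length ht
  rw [List.length_append] at this
  omega

theorem weight_mul_le (t : ℕ) : (D.piece t).length ≤ (D.bag t).length → (D.ownB t).length ≤
    (D.children t).length →
    (D.piece t).length + K * ((D.ownB t).length + 1) + 1 ≤ (K + 1) * D.weight t := by
  intro h1 h2
  have h3 : (D.bag t).length + ((D.children t).length + 1) ≤ D.weight t := by
    rw [weight]
    have : 1 * ((D.children t).length + 1) ≤ (D.k + 2) * ((D.children t).length + 1) :=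
      Nat.mul_le_mul_right _ (by omega)
    omega
  have h4 : K * ((D.ownB t).length + 1) ≤ K * D.weight t := Nat.mul_le_mul_left _ (by omega)
  rw [add_mul]
  omega

theorem totalSize_le_nine_mul (hes : ListsEdges es G.edges) :
    D.totalSize row adj es ≤ 9 * (es.length + (D.k + 1) ^ 2 * max D.n D.N) := by
  have h1 := D.sum_weight_le
  have h2 := D.sum_pieceEdges_le (row := row) (adj := adj) hes
  have h3 := D.sum_bdry_sq_le (x := (D.k + 1) ^ 2) fun t ht => by
    rw [sq]; exact Nat.mul_le_mul (D.bdry_le ht) (D.bdry_le ht)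
  rw [totalSize, Finset.sum_add_distrib, Finset.sum_add_distrib]
  have h4 : (D.k + 1) * max D.n D.N ≤ (D.k + 1) ^ 2 * max D.n D.N :=
    Nat.mul_le_mul_right _ (Nat.le_self_pow two_ne_zero _)
  omega

/-- With `c = 0` the sum of `d`-th powers is at most the power of the sum, and the edges of the
pieces sum to `m` plus the squares of the boundaries. -/
theorem totalSolve_zero_le (hd : d ≠ 0) (hes : ListsEdges es G.edges) :
    D.totalSolve row adj es K 0 d ≤
      (8 * (K + 1)) ^ d * (es.length + (D.k + 1) ^ 2 * max D.n D.N) ^ d := by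
  have h1 : D.totalSolve row adj es K 0 d ≤ ∑ t ∈ Finset.range D.N,
      ((K + 1) * ((D.pieceEdges row adj es t).length + D.weight t)) ^ d := by
    refine Finset.sum_le_sum fun t ht => ?_
    rw [pow_zero, one_mul]
    refine Nat.pow_le_pow_left ?_ d
    have := D.weight_mul_le (K := K) t (D.piece_length (Finset.mem_range.1 ht))
      (D.ownB_length (Finset.mem_range.1 ht))
    rw [mul_add (K + 1)]
    have h : 1 * (D.pieceEdges row adj es t).length ≤ (K + 1) * (D.pieceEdges row adj es t).length :=
      Nat.mul_le_mul_right _ (by omega)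
    omega
  refine h1.trans ((sum_pow_le _ _ d hd).trans ?_)
  rw [← mul_pow]
  refine Nat.pow_le_pow_left ?_ d
  rw [← Finset.mul_sum, Finset.sum_add_distrib, mul_comm 8, mul_assoc]
  refine Nat.mul_le_mul_left _ ?_
  have h1 := D.sum_weight_le
  have h2 := D.sum_pieceEdges_le (row := row) (adj := adj) hes
  have h3 := D.sum_bdry_sq_le (x := (D.k + 1) ^ 2) fun t ht => by
    rw [sq]; exact Nat.mul_le_mul (D.bdry_le ht) (D.bdry_le ht)
  have h4 : (D.k + 1) * max D.n D.N ≤ (D.k + 1) ^ 2 * max D.n D.N :=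
    Nat.mul_le_mul_right _ (Nat.le_self_pow two_ne_zero _)
  omega

/-- The edge factor is bounded uniformly, since a piece has at most `m` edges and `|B| ≤ 2m`. Only
the vertex factor is summed over the nodes. -/
theorem totalSolve_le (hc : c ≠ 0) (hes : ListsEdges es G.edges)
    (hadj : ∀ u < D.n, ∀ v < D.n, adj (row u + v) ≠ 0 ↔ s(u, v) ∈ G.edges) :
    D.totalSolve row adj es K c d ≤ (6 * (K + 1)) ^ c * (2 * K + 1) ^ d *
      (((D.k + 1) * max D.n D.N) ^ c * (es.length + 1) ^ d) := by
  have h1 : D.totalSolve row adj es K c d ≤ ∑ t ∈ Finset.range D.N,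
      ((K + 1) * D.weight t) ^ c * ((2 * K + 1) * (es.length + 1)) ^ d := by
    refine Finset.sum_le_sum fun t ht => ?_
    rw [Finset.mem_range] at ht
    refine Nat.mul_le_mul (Nat.pow_le_pow_left ?_ c) (Nat.pow_le_pow_left ?_ d)
    · exact D.weight_mul_le t (D.piece_length ht) (D.ownB_length ht)
    · have h1 : (D.pieceEdges row adj es t).length ≤ es.length := by
        rw [← listsEdges_card (D.listsEdges_pieceEdges hes hadj ht), ← listsEdges_card hes]
        exact Finset.card_le_card (Finset.filter_subset _ _)
      have h2 := D.ownB_length' ht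
      rw [listsEdges_card hes] at h2
      have h3 : K * ((D.ownB t).length + 1) ≤ K * (2 * (es.length + 1)) :=
        Nat.mul_le_mul_left _ (by omega)
      have h4 : (2 * K + 1) * (es.length + 1) = K * (2 * (es.length + 1)) + (es.length + 1) := by ring
      omega
  refine h1.trans ?_
  rw [← Finset.sum_mul]
  refine (Nat.mul_le_mul_right _ (sum_pow_le _ _ c hc)).trans ?_
  rw [← Finset.mul_sum]
  refine (Nat.mul_le_mul_right _ (Nat.pow_le_pow_left (Nat.mul_le_mul_left _ D.sum_weight_le) c)).trans
    (le_of_eq ?_)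
  rw [← mul_assoc, mul_comm (K + 1) 6, mul_pow (6 * (K + 1)), mul_pow (2 * K + 1)]
  ring

/-- One factor of `|bdry t|²` is bounded by `k + 1` and the other by `2m`, so the boundaries are
paid by `(k + 1) N m`. -/
theorem totalSize_le_pos (hc : c ≠ 0) (hd : d ≠ 0) (hes : ListsEdges es G.edges) :
    D.totalSize row adj es ≤ 11 * (((D.k + 1) * max D.n D.N) ^ c * (es.length + 1) ^ d) := by
  have h1 := D.sum_weight_le
  have h2 := D.sum_pieceEdges_le (row := row) (adj := adj) hes
  have h3 := D.sum_bdry_sq_le (x := (D.k + 1) * (2 * es.length)) fun t ht => by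
    have := D.bdry_length ht
    rw [listsEdges_card hes] at this
    exact Nat.mul_le_mul (D.bdry_le ht) this
  rw [totalSize, Finset.sum_add_distrib, Finset.sum_add_distrib]
  have h4 : (D.k + 1) * (2 * es.length) * max D.n D.N = 2 * ((D.k + 1) * max D.n D.N * es.length) := by
    ring
  have h5 : 1 * es.length ≤ (D.k + 1) * max D.n D.N * es.length :=
    Nat.mul_le_mul_right _ (Nat.mul_pos (by omega) (lt_of_lt_of_le D.N_pos (le_max_right _ _)))
  have h6 : (D.k + 1) * max D.n D.N * (es.length + 1) ≤
      ((D.k + 1) * max D.n D.N) ^ c * (es.length + 1) ^ d :=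
    Nat.mul_le_mul (Nat.le_self_pow hc _) (Nat.le_self_pow hd _)
  rw [mul_add] at h6
  omega

/-- For `d = 0` the bound contains no `m`. The edges are charged to the solver instead, which has to
load them. -/
theorem totalSize_le_edgeless (hp : 1 ≤ p) (hH : H.Hereditary) (hS : Solves g opt H f c 0 S)
    (hf : Monotone f) (hc : c ≠ 0) (hes : ListsEdges es G.edges)
    (hadj : ∀ u < D.n, ∀ v < D.n, adj (row u + v) ≠ 0 ↔ s(u, v) ∈ G.edges) :
    D.totalSize row adj es ≤
      (6 + 6 ^ c + 2 ^ c) * f (D.k + 1 + K) * ((D.k + 1) * max D.n D.N) ^ c := by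
  have hF : 1 ≤ f (D.k + 1 + K) := by
    have h := hS.sq_le hp (fun Γ hV => hH.empty_mem (D.mem_class 0 D.N_pos) hV) 1
    by_contra h0
    have h1 : f 1 = 0 := by
      have := hf (show 1 ≤ D.k + 1 + K by omega)
      omega
    simp [h1] at h
  have h1 := D.sum_weight_le
  have hZ := Nat.le_self_pow hc ((D.k + 1) * max D.n D.N)
  have h2 : ∑ t ∈ Finset.range D.N, (D.pieceEdges row adj es t).length ≤
      f (D.k + 1 + K) * (6 ^ c * ((D.k + 1) * max D.n D.N) ^ c) := by
    have : ∑ t ∈ Finset.range D.N, (D.pieceEdges row adj es t).length ≤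
        ∑ t ∈ Finset.range D.N, f (D.k + 1 + K) * D.weight t ^ c := by
      refine Finset.sum_le_sum fun t ht => ?_
      rw [Finset.mem_range] at ht
      -- The piece itself with `A` annotated is a legal instance, so its number of edges is below
      -- the time bound of the solver.
      have h := hS.size_le hp (Γ := G.induce (D.piece t).toFinset) (vl := D.piece t)
        (A := D.bdry t ++ D.ownA t) ⟨D.piece_nodup ht, (G.induce_verts (D.piece_sub t)).symm⟩
        (D.listsEdges_pieceEdges hes hadj ht) (List.nodup_append'.1 (D.cut_nodup ht)).1 ?_ (D.piece_del_mem hH ht)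
      · have h3 : f (D.bdry t ++ D.ownA t).length ≤ f (D.k + 1 + K) :=
          hf ((D.annotated_length ht).trans (by omega))
        have h4 : (D.piece t).length + 1 ≤ D.weight t := by
          have := D.piece_length ht
          rw [weight]
          have : 2 * 1 ≤ (D.k + 2) * ((D.children t).length + 1) := Nat.mul_le_mul (by omega) (by omega)
          omega
        have h5 := Nat.mul_le_mul h3 (Nat.pow_le_pow_left h4 c)
        rw [pow_zero, mul_one] at h
        omega
      · rw [G.induce_verts (D.piece_sub t)]
        intro v hv
        simp only [List.mem_toFinset, List.mem_append, piece] at hv ⊢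
        refine hv.imp_right fun h => ?_
        obtain ⟨h1, h2⟩ := List.mem_filter.1 h
        exact List.mem_filter.2 ⟨List.mem_range.2 (D.bag_lt t ht v (List.mem_append_left _ h1)), h2⟩
    refine this.trans ?_
    rw [← Finset.mul_sum, ← mul_pow]
    exact Nat.mul_le_mul_left _ ((sum_pow_le _ _ c hc).trans (Nat.pow_le_pow_left h1 c))
  -- The squares of the boundaries are bounded through complete graphs.
  have h3 := D.sum_bdry_sq_le (x := f (D.k + 1 + K) * (2 ^ c * (D.k + 1) ^ c)) fun t ht => by
    refine (hS.sq_le hp (fun Γ hV => hH.empty_mem (D.mem_class 0 D.N_pos) hV) _).trans ?_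
    have := D.bdry_le ht
    rw [← mul_pow]
    exact Nat.mul_le_mul (hf (by omega)) (Nat.pow_le_pow_left (by omega) c)
  have h4 : f (D.k + 1 + K) * (2 ^ c * (D.k + 1) ^ c) * max D.n D.N ≤
      f (D.k + 1 + K) * (2 ^ c * ((D.k + 1) * max D.n D.N) ^ c) := by
    rw [mul_assoc, mul_assoc, mul_pow (D.k + 1)]
    exact Nat.mul_le_mul_left _ (Nat.mul_le_mul_left _
      (Nat.mul_le_mul_left _ (Nat.le_self_pow hc _)))
  rw [totalSize, Finset.sum_add_distrib, Finset.sum_add_distrib]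
  generalize ((D.k + 1) * max D.n D.N) ^ c = W at *
  generalize f (D.k + 1 + K) = F at *
  have h5 : 1 * W ≤ F * W := Nat.mul_le_mul_right _ hF
  have h6 : (6 + 6 ^ c + 2 ^ c) * F * W = 6 * (F * W) + F * (6 ^ c * W) + F * (2 ^ c * W) := by ring
  omega

/-- Even the empty instance has three cells to load. -/
theorem one_le_of_solves (D : RootedDec H G) (hp : 1 ≤ p) (hH : H.Hereditary) (hS : Solves g opt H f c d S)
    (hf : Monotone f) (j : ℕ) : 1 ≤ f j := by
  let Γ : FinGraph := ⟨∅, ∅, by simp, by simp⟩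
  have h := hS.size_le hp (Γ := Γ) (vl := []) (A := []) (el := []) ⟨List.nodup_nil, rfl⟩
    ⟨List.nodup_nil, rfl⟩ List.nodup_nil (by simp)
    (hH.empty_mem (D.mem_class 0 D.N_pos) (by simp [Γ, FinGraph.del, FinGraph.induce]))
  have := hf (Nat.zero_le j)
  simp at h
  omega

theorem totalSize_le (hp : 1 ≤ p) (hH : H.Hereditary) (hS : Solves g opt H f c d S)
    (hf : Monotone f) (hcd : 1 ≤ c + d) (hes : ListsEdges es G.edges)
    (hadj : ∀ u < D.n, ∀ v < D.n, adj (row u + v) ≠ 0 ↔ s(u, v) ∈ G.edges) :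
    D.totalSize row adj es ≤ (11 + 6 ^ c + 2 ^ c) * f (D.k + 1 + K) *
      (if c = 0 then (es.length + (D.k + 1) ^ 2 * max D.n D.N) ^ d
        else ((D.k + 1) * max D.n D.N) ^ c * (es.length + 1) ^ d) := by
  have hF := D.one_le_of_solves hp hH hS hf (D.k + 1 + K)
  split_ifs with hc
  · refine (D.totalSize_le_nine_mul hes).trans (Nat.mul_le_mul ?_ (Nat.le_self_pow (by omega) _))
    exact le_trans (by generalize 6 ^ c = x; generalize 2 ^ c = y; omega) (Nat.le_mul_of_pos_right (11 + 6 ^ c + 2 ^ c) hF)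
  · by_cases hd : d = 0
    · subst hd
      rw [pow_zero, mul_one]
      refine (D.totalSize_le_edgeless (K := K) hp hH hS hf hc hes hadj).trans ?_
      gcongr
      omega
    · refine (D.totalSize_le_pos hc hd hes).trans (Nat.mul_le_mul_right _ ?_)
      exact le_trans (by generalize 6 ^ c = x; generalize 2 ^ c = y; omega) (Nat.le_mul_of_pos_right (11 + 6 ^ c + 2 ^ c) hF)

theorem totalSolve_le_bound (hcd : 1 ≤ c + d) (hes : ListsEdges es G.edges)
    (hadj : ∀ u < D.n, ∀ v < D.n, adj (row u + v) ≠ 0 ↔ s(u, v) ∈ G.edges) :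
    D.totalSolve row adj es K c d ≤ ((6 * (K + 1)) ^ c * (8 * (K + 1)) ^ d) *
      (if c = 0 then (es.length + (D.k + 1) ^ 2 * max D.n D.N) ^ d
        else ((D.k + 1) * max D.n D.N) ^ c * (es.length + 1) ^ d) := by
  split_ifs with hc
  · subst hc
    rw [pow_zero, one_mul]
    exact D.totalSolve_zero_le (by omega) hes
  · refine (D.totalSolve_le hc hes hadj).trans ?_
    gcongr
    omega

theorem time_le (hp : 1 ≤ p) (hH : H.Hereditary) (hS : Solves g opt H f c d S)
    (hf : Monotone f) (hcd : 1 ≤ c + d) (hes : ListsEdges es G.edges)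
    (hadj : ∀ u < D.n, ∀ v < D.n, adj (row u + v) ≠ 0 ↔ s(u, v) ∈ G.edges) :
    200 * (D.n + es.length + D.N + 1 + ∑ t ∈ Finset.range D.N, (D.bag t).length) +
      ∑ t ∈ Finset.range D.N, (D.nodeTime es row adj p K f c d t + 2) ≤
    (p * ((121 * K + 990) * (11 + 6 ^ c + 2 ^ c) + (6 * (K + 1)) ^ c * (8 * (K + 1)) ^ d)) * p ^ D.k *
      f (D.k + 1 + K) * (if c = 0 then (es.length + (D.k + 1) ^ 2 * max D.n D.N) ^ d
        else ((D.k + 1) * max D.n D.N) ^ c * (es.length + 1) ^ d) := by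
  have h1 := D.outer_le (row := row) (adj := adj) hes
  have h2 := D.sum_nodeTime_add_two_le (es := es) (row := row) (adj := adj) (K := K) (c := c) (d := d) hp hf
  have h3 := D.totalSize_le (K := K) hp hH hS hf hcd hes hadj
  have h4 := D.totalSolve_le_bound (K := K) hcd hes hadj
  generalize (if c = 0 then (es.length + (D.k + 1) ^ 2 * max D.n D.N) ^ d
        else ((D.k + 1) * max D.n D.N) ^ c * (es.length + 1) ^ d) = W at *
  generalize (6 * (K + 1)) ^ c * (8 * (K + 1)) ^ d = C at *
  generalize 11 + 6 ^ c + 2 ^ c = C' at *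
  generalize f (D.k + 1 + K) = F at *
  have hP : 1 ≤ p ^ (D.k + 1) := Nat.one_le_pow _ _ hp
  refine (Nat.add_le_add (h1.trans (Nat.le_mul_of_pos_left _ hP)) h2).trans ?_
  rw [← mul_add]
  have h5 : 600 * D.totalSize row adj es + ((121 * K + 390) * D.totalSize row adj es +
      F * D.totalSolve row adj es K c d) ≤ (121 * K + 990) * (C' * F * W) + F * (C * W) := by
    have := Nat.mul_le_mul_left (121 * K + 990) h3
    have := Nat.mul_le_mul_left F h4
    have h6 : (121 * K + 990) * D.totalSize row adj es = 600 * D.totalSize row adj es +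
      (121 * K + 390) * D.totalSize row adj es := by ring
    omega
  refine (Nat.mul_le_mul_left _ h5).trans (le_of_eq ?_)
  -- There are `p ^ (k + 1)` colourings in the bound; the additional factor `p` belongs to the
  -- constant.
  rw [pow_succ]
  ring

end RootedDec

theorem mainTheorem5 (p : ℕ) (hp : 1 ≤ p) (H : GraphClass) (hH : H.Hereditary)
    (g : PartitionEval p) (opt : Opt) (f : ℕ → ℕ) (hf : Monotone f) (c d : ℕ) (hcd : 1 ≤ c + d)
    (hnice : IsNiceProblem H g opt) (hsolv : AnnSolvable g opt H f c d) :
    ∃ (P : Prog) (K : ℕ), ∀ (n : ℕ) (G : FinGraph) (D : HTreeDec H G)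
      (parent : Fin D.N → Fin D.N) (es : List (ℕ × ℕ)) (as bs : Fin D.N → List ℕ),
      G.verts = Finset.range n → IsParentMap D.T parent → ListsEdges es G.edges →
      (∀ t, ListsSet (as t) (D.α t)) → (∀ t, ListsSet (bs t) (D.β t)) →
      P.ComputesWithin (encDec n es parent as bs) (encValue (optValue g opt G))
        (K * p ^ D.width * f (D.width + K) *
          (if c = 0 then (G.edges.card + (D.width + 1) ^ 2 * max n D.N) ^ d
           else ((D.width + 1) * max n D.N) ^ c * (G.edges.card + 1) ^ d)) := by
  obtain ⟨R, K, hR⟩ := hnice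
  obtain ⟨S, hS⟩ := hsolv
  -- The summand `K + 1` lets the final constant also serve inside `f`, where the annotated sets
  -- have at most `k + 1 + K` vertices.
  refine ⟨mainP p opt R S, p * ((121 * K + 990) * (11 + 6 ^ c + 2 ^ c) +
    (6 * (K + 1)) ^ c * (8 * (K + 1)) ^ d) + (K + 1), ?_⟩
  intro n G T parent es as bs hn hpar hes has hbs
  obtain ⟨row, adj, hadj, M, t, hM, hout, ht⟩ :=
    mainP_spec hp hH hR hS hf T hn hpar hes has hbs (D := T.rooted hpar hn has hbs) rfl
  refine ⟨M, t, hM, hout, ht.trans ?_⟩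
  refine ((T.rooted hpar hn has hbs).time_le (K := K) hp hH hS hf hcd hes hadj).trans ?_
  rw [listsEdges_card hes]
  refine Nat.mul_le_mul_right _ (Nat.mul_le_mul (Nat.mul_le_mul_right _ (by omega)) (hf ?_))
  show T.width + 1 + K ≤ _
  omega
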